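/- Let $G$ be a real Lie group with simple Lie algebra $\mathfrak g$. Fix a system of simple restricted roots of $\mathfrak g$ with respect to a maximal split toral subalgebra $\mathfrak a$. For a set $\Xi'$ of simple restricted roots let $\mathfrak g=\bigoplus_k\mathfrak g_{\Xi',k}$ be the grading by $\Xi'$-heights, and put $\mathfrak g_{\Xi',-}=\bigoplus_{k<0}\mathfrak g_{\Xi',k}$, $\mathfrak p_{\Xi',+}=\bigoplus_{k>0}\mathfrak g_{\Xi',k}$ and $\mathfrak p_{\Xi'}=\mathfrak g_{\Xi',0}\oplus\mathfrak p_{\Xi',+}$. Fix a set $\Xi$ of simple restricted roots, a closed subgroup $P\subset G$ with Lie algebra $\mathfrak p_\Xi$ that normalizes $\mathfrak p_\Xi$, and a parabolic geometry $(\mathcal B\to M,\omega)$ of type $(G,P)$ (for example, a regular, normal and homogeneous one). Its curvature function $\kappa(u)(X,Y)=[X,Y]-\omega_u([\omega^{-1}(X),\omega^{-1}(Y)])$ is regarded as a function with values in $\Lambda^2(\mathfrak g/\mathfrak p_\Xi)^*\otimes\mathfrak g=\Lambda^2(\mathfrak g_{\Xi,-})^*\otimes\mathfrak g$. Let $\kappa_H(u)$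 be the projection of $\kappa(u)$ to the kernel of the Kostant Laplacian $\Box=\partial\partial^*+\partial^*\partial$ along the image of $\Box$. Let $\Psi$ be the maximal subset of $\Xi$ such that $\kappa_H$ has no entries in $\mathfrak g_{\Xi-\Psi,0}$, i.e. such that $\kappa_H(u)(X,Y)=0$ for all $u\in\mathcal B$, $X\in\mathfrak g_{\Xi-\Psi,0}\cap\mathfrak g_{\Xi,-}$ and $Y\in\mathfrak g_{\Xi,-}$. Choose a Cartan subalgebra of $\mathfrak g_{\mathbb C}=\mathfrak g\otimes\mathbb C$ that contains $\mathfrak a$, and simple roots of $\mathfrak g_{\mathbb C}$ each of which restricts on $\mathfrak a$ to $0$ or to a simple restricted root. Let $\langle\ ,\ \rangle$ be the scalar product on weights induced by the Killing form, $\rho$ half the sum of the positive roots, and $s_\alpha$ the reflection in $\alpha$. For simple roots $\alpha_a\ne\alpha_b$ write $(\alpha_a,\alpha_b)$ for the weight $s_{\alpha_a}s_{\alpha_b}(\mu^{\mathfrak g}+\rho)-\rho$, where $\mu^{\mathfrak g}$ is the highest root of $\mathfrak g_{\mathbb C}$ (of either simple ideal, if $\mathfrak g_{\mathbb C}$ is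 not simple). The component of $\kappa_H$ represented by $(\alpha_a,\alpha_b)$ is the component of $\kappa_H$ in the isotypical component of the $(\mathfrak g_{\Xi,0})_{\mathbb C}$-module $(\ker\Box)_{\mathbb C}$ with lowest weight $-(\alpha_a,\alpha_b)$ (this isotypical component is dual to the one with highest weight $(\alpha_a,\alpha_b)$ in $H^2(\mathfrak p_{\Xi,+},\mathfrak g)$). It is non-trivial if it is nonzero at some $u\in\mathcal B$. Then the maximal subset $\Psi$ exists, and it is the set of all restricted roots in $\Xi$ such that every simple root $\alpha_i$ of $\mathfrak g_{\mathbb C}$ that restricts to it satisfies $\langle\alpha_i,(\alpha_a,\alpha_b)\rangle\ge 0$ for all weights $(\alpha_a,\alpha_b)$ representing non-trivial components of $\kappa_H$. Moreover, for all simple roots $\alpha_a\neq\alpha_b$ and each weight $(\alpha_a,\alpha_b)$: 1. If $\langle\alpha_a,\alpha_b\rangle\ne 0$, then $\alpha_a$ is the unique simple root $\alpha$ such that $\langle\alpha,(\alpha_a,\alpha_b)\rangle<0$. 2. If $\langle\alpha_a,\alpha_b\rangle=0$, then $\alpha_a$ and $\alpha_b$ are the only simple roots $\alpha$ such that $\langle\alpha,(\alpha_a,\alpha_b)\rangle<0$.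 -/

import Mathlib

open scoped TensorProduct Manifold ContDiff ComplexOrder

noncomputable section

namespace Parabolic

/-! ### Restricted roots, gradings and parabolic subalgebras of a real Lie algebra -/

section RestrictedRoots

variable {𝔤 : Type*} [LieRing 𝔤] [LieAlgebra ℝ 𝔤]

/-- The simultaneous eigenspace `𝔤_lam = {x | [h, x] = lam(h) x for all h ∈ 𝔞}`. -/
def restrictedRootSpace (𝔞 : Submodule ℝ 𝔤) (lam : Module.Dual ℝ 𝔞) : Submodule ℝ 𝔤 where
  carrier := {x | ∀ h : 𝔞, ⁅(h : 𝔤), x⁆ = lam h • x}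
  add_mem' := by
    intro x y hx hy h
    rw [lie_add, hx h, hy h, smul_add]
  zero_mem' := by
    intro h
    simp
  smul_mem' := by
    intro c x hx h
    rw [lie_smul, hx h, smul_comm]

/-- `𝔞` is abelian and acts on `𝔤` by endomorphisms that are diagonalizable over `ℝ`. -/
structure IsSplitToral (𝔞 : Submodule ℝ 𝔤) : Prop where
  lie_eq_zero : ∀ x ∈ 𝔞, ∀ y ∈ 𝔞, ⁅x, y⁆ = 0
  iSup_eq_top : ⨆ lam : Module.Dual ℝ 𝔞, restrictedRootSpace 𝔞 lam = ⊤

/-- Restricted roots: the nonzero weights of `𝔞` on `𝔤`. -/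
def IsRestrictedRoot (𝔞 : Submodule ℝ 𝔤) (lam : Module.Dual ℝ 𝔞) : Prop :=
  lam ≠ 0 ∧ restrictedRootSpace 𝔞 lam ≠ ⊥

variable (𝔤) in
/-- A maximal split toral subalgebra `𝔞` of `𝔤` with a system of simple restricted roots
`α_j`, `j ∈ ι`. -/
structure SimpleRestrictedRoots (ι : Type*) [Fintype ι] where
  𝔞 : Submodule ℝ 𝔤
  maximal : Maximal IsSplitToral 𝔞
  simple : ι → Module.Dual ℝ 𝔞
  linearIndependent : LinearIndependent ℝ simple
  isRestrictedRoot : ∀ j, IsRestrictedRoot 𝔞 (simple j)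
  pos_or_neg : ∀ lam, IsRestrictedRoot 𝔞 lam →
    ∃ n : ι → ℕ, lam = ∑ j, n j • simple j ∨ lam = -∑ j, n j • simple j

variable {ι : Type*} [Fintype ι] (D : SimpleRestrictedRoots 𝔤 ι)

/-- The `Ξ`-height of `∑ n_j α_j`: the sum of the coefficients `n_j` with `j ∈ Ξ`. -/
def xiHeight (Ξ : Set ι) (n : ι → ℤ) : ℤ := ∑ j, Ξ.indicator n j

/-- The component `𝔤_{Ξ,k}` of the grading of `𝔤` by `Ξ`-heights: the sum of the spaces `𝔤_lam`
for `lam = ∑ n_j α_j` of `Ξ`-height `k` (including the centralizer of `𝔞`, for `lam = 0`). -/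
def gradedPiece (Ξ : Set ι) (k : ℤ) : Submodule ℝ 𝔤 :=
  ⨆ n : {n : ι → ℤ // xiHeight Ξ n = k},
    restrictedRootSpace D.𝔞 (∑ j, n.1 j • D.simple j)

/-- The standard parabolic subalgebra `𝔭_Ξ`. -/
def parabolic (Ξ : Set ι) : Submodule ℝ 𝔤 := ⨆ k : {k : ℤ // 0 ≤ k}, gradedPiece D Ξ k

/-- The nilradical `𝔭_{Ξ,+}` of `𝔭_Ξ`. -/
def pPlus (Ξ : Set ι) : Submodule ℝ 𝔤 := ⨆ k : {k : ℤ // 0 < k}, gradedPiece D Ξ k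

lemma lie_mem_restrictedRootSpace {𝔞 : Submodule ℝ 𝔤} {lam mu : Module.Dual ℝ 𝔞} {x y : 𝔤}
    (hx : x ∈ restrictedRootSpace 𝔞 lam) (hy : y ∈ restrictedRootSpace 𝔞 mu) :
    ⁅x, y⁆ ∈ restrictedRootSpace 𝔞 (lam + mu) := by
  intro h
  rw [leibniz_lie, hx h, hy h, smul_lie, lie_smul, LinearMap.add_apply, add_smul]

lemma xiHeight_add (Ξ : Set ι) (n m : ι → ℤ) :
    xiHeight Ξ (n + m) = xiHeight Ξ n + xiHeight Ξ m := by
  simp [xiHeight, Set.indicator_add', Finset.sum_add_distrib]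

lemma lie_mem_gradedPiece {Ξ : Set ι} {k l : ℤ} {x y : 𝔤}
    (hx : x ∈ gradedPiece D Ξ k) (hy : y ∈ gradedPiece D Ξ l) :
    ⁅x, y⁆ ∈ gradedPiece D Ξ (k + l) := by
  unfold gradedPiece at hx hy
  induction hx using Submodule.iSup_induction' with
  | zero => simp
  | add a b _ _ ha hb => rw [add_lie]; exact add_mem ha hb
  | mem n a ha =>
    induction hy using Submodule.iSup_induction' with
    | zero => simp
    | add c d _ _ hc hd => rw [lie_add]; exact add_mem hc hd
    | mem m c hc =>
      refine Submodule.mem_iSup_of_mem ⟨n.1 + m.1, by rw [xiHeight_add, n.2, m.2]⟩ ?_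
      have := lie_mem_restrictedRootSpace ha hc
      rwa [← Finset.sum_add_distrib, Finset.sum_congr rfl fun j _ =>
        (add_smul (n.1 j) (m.1 j) (D.simple j)).symm] at this

lemma restrictedRootSpace_zero_le (Ξ : Set ι) :
    restrictedRootSpace D.𝔞 0 ≤ gradedPiece D Ξ 0 := by
  intro x hx
  refine Submodule.mem_iSup_of_mem ⟨0, by simp [xiHeight]⟩ ?_
  simpa using hx

lemma iSup_gradedPiece (Ξ : Set ι) : ⨆ k, gradedPiece D Ξ k = ⊤ := by
  rw [eq_top_iff, ← D.maximal.prop.iSup_eq_top, iSup_le_iff]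
  intro lam
  by_cases h0 : lam = 0
  · subst h0
    exact (restrictedRootSpace_zero_le D Ξ).trans (le_iSup _ _)
  by_cases hb : restrictedRootSpace D.𝔞 lam = ⊥
  · simp [hb]
  have key : ∀ m : ι → ℤ, restrictedRootSpace D.𝔞 (∑ j, m j • D.simple j) ≤
      ⨆ k, gradedPiece D Ξ k := fun m =>
    (le_iSup (fun n : {n : ι → ℤ // xiHeight Ξ n = xiHeight Ξ m} =>
      restrictedRootSpace D.𝔞 (∑ j, n.1 j • D.simple j)) ⟨m, rfl⟩).trans
      (le_iSup (gradedPiece D Ξ) (xiHeight Ξ m))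
  obtain ⟨n, h | h⟩ := D.pos_or_neg lam ⟨h0, hb⟩
  · simpa [h] using key fun j => (n j : ℤ)
  · simpa [h] using key fun j => -(n j : ℤ)

/-- The reductive subalgebra `𝔤_{Ξ,0}`. -/
def gZero (Ξ : Set ι) : LieSubalgebra ℝ 𝔤 :=
  { gradedPiece D Ξ 0 with
    lie_mem' := by
      intro x y hx hy
      simpa using lie_mem_gradedPiece D hx hy }

lemma lie_mem_iSup_neg {Ξ : Set ι} {k : ℤ} (hk : k ≤ 0) {x y : 𝔤}
    (hx : x ∈ gradedPiece D Ξ k) (hy : y ∈ ⨆ l : {l : ℤ // l < 0}, gradedPiece D Ξ l) :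
    ⁅x, y⁆ ∈ ⨆ l : {l : ℤ // l < 0}, gradedPiece D Ξ l := by
  induction hy using Submodule.iSup_induction' with
  | zero => simp
  | add c d _ _ hc hd => rw [lie_add]; exact add_mem hc hd
  | mem l c hc =>
    exact Submodule.mem_iSup_of_mem ⟨k + l.1, by have := l.2; lia⟩ (lie_mem_gradedPiece D hx hc)

/-- The subalgebra `𝔤_{Ξ,-}`, as a `𝔤_{Ξ,0}`-submodule of `𝔤`. -/
def gMinus (Ξ : Set ι) : LieSubmodule ℝ (gZero D Ξ) 𝔤 :=
  { (⨆ k : {k : ℤ // k < 0}, gradedPiece D Ξ k : Submodule ℝ 𝔤) with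
    lie_mem := by
      intro x m hm
      exact lie_mem_iSup_neg D le_rfl x.2 hm }

lemma mem_gMinus {Ξ : Set ι} {x : 𝔤} :
    x ∈ gMinus D Ξ ↔ x ∈ ⨆ k : {k : ℤ // k < 0}, gradedPiece D Ξ k := Iff.rfl

lemma lie_mem_gMinus {Ξ : Set ι} {x y : 𝔤} (hx : x ∈ gMinus D Ξ) (hy : y ∈ gMinus D Ξ) :
    ⁅x, y⁆ ∈ gMinus D Ξ := by
  rw [mem_gMinus] at hx ⊢
  induction hx using Submodule.iSup_induction' with
  | zero => simp
  | add c d _ _ hc hd => rw [add_lie]; exact add_mem hc hd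
  | mem l c hc => exact lie_mem_iSup_neg D l.2.le hc hy

/-- The bracket of `𝔤_{Ξ,-}`. -/
def minusBracket {Ξ : Set ι} (X Y : gMinus D Ξ) : gMinus D Ξ :=
  ⟨⁅(X : 𝔤), (Y : 𝔤)⁆, lie_mem_gMinus D X.2 Y.2⟩

/-! ### Dual bases of `𝔤_{Ξ,-}` and `𝔭_{Ξ,+}` for the Killing form -/

lemma killingForm_restrictedRootSpace {𝔞 : Submodule ℝ 𝔤} {lam mu : Module.Dual ℝ 𝔞} {x y : 𝔤}
    (hx : x ∈ restrictedRootSpace 𝔞 lam) (hy : y ∈ restrictedRootSpace 𝔞 mu)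
    (h : lam + mu ≠ 0) : killingForm ℝ 𝔤 x y = 0 := by
  by_contra hxy
  refine h (LinearMap.ext fun a => ?_)
  have h1 : killingForm ℝ 𝔤 ⁅(a : 𝔤), x⁆ y = -killingForm ℝ 𝔤 x ⁅(a : 𝔤), y⁆ := by
    rw [← lie_skew, map_neg, LinearMap.neg_apply]
    exact congrArg Neg.neg (LieModule.traceForm_apply_lie_apply ℝ 𝔤 𝔤 x (a : 𝔤) y)
  rw [hx a, hy a, map_smul, map_smul, LinearMap.smul_apply, smul_eq_mul, smul_eq_mul] at h1
  have h2 : (lam a + mu a) * killingForm ℝ 𝔤 x y = 0 := by linarith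
  simpa using (mul_eq_zero.mp h2).resolve_right hxy

lemma killingForm_gradedPiece {Ξ : Set ι} {k l : ℤ} (hkl : k + l ≠ 0) {x y : 𝔤}
    (hx : x ∈ gradedPiece D Ξ k) (hy : y ∈ gradedPiece D Ξ l) : killingForm ℝ 𝔤 x y = 0 := by
  unfold gradedPiece at hx hy
  induction hx using Submodule.iSup_induction' with
  | zero => simp
  | add a b _ _ ha hb => simp [ha, hb]
  | mem n a ha =>
    induction hy using Submodule.iSup_induction' with
    | zero => simp
    | add c d _ _ hc hd => simp [hc, hd]
    | mem m c hc =>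
      refine killingForm_restrictedRootSpace ha hc fun h0 => hkl ?_
      rw [← Finset.sum_add_distrib] at h0
      have h1 : ∑ j, ((n.1 j + m.1 j : ℤ) : ℝ) • D.simple j = 0 := by
        rw [← h0]
        refine Finset.sum_congr rfl fun j _ => ?_
        rw [Int.cast_add, add_smul, Int.cast_smul_eq_zsmul, Int.cast_smul_eq_zsmul]
      have h2 : n.1 + m.1 = 0 := by
        funext j
        exact_mod_cast Fintype.linearIndependent_iff.mp D.linearIndependent _ h1 j
      rw [← n.2, ← m.2, ← xiHeight_add, h2]
      simp [xiHeight]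

lemma exists_dual_mem_pPlus [Module.Finite ℝ 𝔤] [LieAlgebra.IsKilling ℝ 𝔤] (Ξ : Set ι)
    (f : Module.Dual ℝ (gMinus D Ξ)) :
    ∃ Z ∈ pPlus D Ξ, ∀ X : gMinus D Ξ, killingForm ℝ 𝔤 Z (X : 𝔤) = f X := by
  obtain ⟨F, hF⟩ := LinearMap.exists_extend (p := (gMinus D Ξ).toSubmodule) f
  obtain ⟨Z, hZ⟩ := (LinearMap.BilinForm.toDual (killingForm ℝ 𝔤)
    (LieAlgebra.IsKilling.killingForm_nondegenerate ℝ 𝔤)).surjective F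
  have hZF : ∀ X : gMinus D Ξ, killingForm ℝ 𝔤 Z (X : 𝔤) = f X := by
    intro X
    have h1 := LinearMap.congr_fun hZ (X : 𝔤)
    have h2 := LinearMap.congr_fun hF X
    rw [LinearMap.BilinForm.toDual_def] at h1
    rw [h1]
    exact h2
  suffices h : ∀ Z : 𝔤, ∃ Z' ∈ pPlus D Ξ, ∀ X : gMinus D Ξ,
      killingForm ℝ 𝔤 Z' (X : 𝔤) = killingForm ℝ 𝔤 Z (X : 𝔤) by
    obtain ⟨Z', h1, h2⟩ := h Z
    exact ⟨Z', h1, fun X => (h2 X).trans (hZF X)⟩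
  intro Z
  have hZ : Z ∈ ⨆ k, gradedPiece D Ξ k := by rw [iSup_gradedPiece]; trivial
  induction hZ using Submodule.iSup_induction' with
  | zero => exact ⟨0, zero_mem _, fun _ => rfl⟩
  | add a b _ _ ha hb =>
    obtain ⟨a', ha1, ha2⟩ := ha
    obtain ⟨b', hb1, hb2⟩ := hb
    exact ⟨a' + b', add_mem ha1 hb1, fun X => by simp [ha2 X, hb2 X]⟩
  | mem k a ha =>
    by_cases hk : 0 < k
    · exact ⟨a, Submodule.mem_iSup_of_mem ⟨k, hk⟩ ha, fun _ => rfl⟩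
    · refine ⟨0, zero_mem _, fun X => ?_⟩
      have hX := (mem_gMinus D).mp X.2
      rw [map_zero, LinearMap.zero_apply]
      generalize (X : 𝔤) = Y at hX
      induction hX using Submodule.iSup_induction' with
      | zero => simp
      | add c d _ _ hc hd => rw [map_add, ← hc, ← hd, add_zero]
      | mem l c hc =>
        exact (killingForm_gradedPiece D (by have := l.2; lia) ha hc).symm

variable [Module.Finite ℝ 𝔤] [LieAlgebra.IsKilling ℝ 𝔤]

/-- A basis `X_i` of `𝔤_{Ξ,-}`. The codifferential does not depend on it. -/
def minusBasis (Ξ : Set ι) : Module.Basis (Fin (Module.finrank ℝ (gMinus D Ξ))) ℝ (gMinus D Ξ) :=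
  Module.finBasis ℝ (gMinus D Ξ)

/-- The basis `Z^i` of `𝔭_{Ξ,+}` that is dual to `X_i` for the Killing form. -/
def plusBasis (Ξ : Set ι) (i : Fin (Module.finrank ℝ (gMinus D Ξ))) : 𝔤 :=
  (exists_dual_mem_pPlus D Ξ ((minusBasis D Ξ).coord i)).choose

lemma plusBasis_mem (Ξ : Set ι) (i) : plusBasis D Ξ i ∈ pPlus D Ξ :=
  (exists_dual_mem_pPlus D Ξ ((minusBasis D Ξ).coord i)).choose_spec.1

lemma killingForm_plusBasis (Ξ : Set ι) (i) (X : gMinus D Ξ) :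
    killingForm ℝ 𝔤 (plusBasis D Ξ i) (X : 𝔤) = (minusBasis D Ξ).coord i X :=
  (exists_dual_mem_pPlus D Ξ ((minusBasis D Ξ).coord i)).choose_spec.2 X

end RestrictedRoots

/-! ### The Kostant Laplacian on `2`-cochains -/

section Kostant

variable {𝔤 : Type*} [LieRing 𝔤] [LieAlgebra ℝ 𝔤] {ι : Type*} [Fintype ι]
  (D : SimpleRestrictedRoots 𝔤 ι) (Ξ : Set ι)

/-- Bilinear maps `𝔤_{Ξ,-} × 𝔤_{Ξ,-} → 𝔤`, as a `𝔤_{Ξ,0}`-module. The alternating ones are the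
`2`-cochains, i.e. the elements of `Λ²(𝔤_{Ξ,-})^* ⊗ 𝔤 = Λ²(𝔤/𝔭_Ξ)^* ⊗ 𝔤`. -/
abbrev BilinearCochain : Type _ := gMinus D Ξ →ₗ[ℝ] gMinus D Ξ →ₗ[ℝ] 𝔤

variable {D Ξ}

/-- The Lie algebra differential `C¹(𝔤_{Ξ,-}, 𝔤) → C²(𝔤_{Ξ,-}, 𝔤)`. -/
def diff₁ (φ : gMinus D Ξ → 𝔤) (X Y : gMinus D Ξ) : 𝔤 :=
  ⁅(X : 𝔤), φ Y⁆ - ⁅(Y : 𝔤), φ X⁆ - φ (minusBracket D X Y)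

/-- The Lie algebra differential `C²(𝔤_{Ξ,-}, 𝔤) → C³(𝔤_{Ξ,-}, 𝔤)`. -/
def diff₂ (φ : gMinus D Ξ → gMinus D Ξ → 𝔤) (X Y Z : gMinus D Ξ) : 𝔤 :=
  ⁅(X : 𝔤), φ Y Z⁆ - ⁅(Y : 𝔤), φ X Z⁆ + ⁅(Z : 𝔤), φ X Y⁆
    - φ (minusBracket D X Y) Z + φ (minusBracket D X Z) Y - φ (minusBracket D Y Z) X

variable [Module.Finite ℝ 𝔤] [LieAlgebra.IsKilling ℝ 𝔤]

/-- The Kostant codifferential `∂^* : C²(𝔤_{Ξ,-}, 𝔤) → C¹(𝔤_{Ξ,-}, 𝔤)`, that is the Lie algebra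
homology differential
`Z₁∧⋯∧Zₙ⊗A ↦ ∑ᵢ (-1)^i Z₁∧⋯Ẑᵢ⋯∧Zₙ⊗[Zᵢ,A] + ∑_{i<j} (-1)^{i+j} [Zᵢ,Zⱼ]∧Z₁∧⋯Ẑᵢ⋯Ẑⱼ⋯∧Zₙ⊗A`
of `𝔭_{Ξ,+}` under the identification `(𝔤_{Ξ,-})^* = 𝔭_{Ξ,+}` given by the Killing form. -/
def codiff₂ (φ : gMinus D Ξ → gMinus D Ξ → 𝔤) (X : gMinus D Ξ) : 𝔤 :=
  -∑ i, ⁅plusBasis D Ξ i, φ (minusBasis D Ξ i) X⁆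
    - (2 : ℝ)⁻¹ • ∑ i, ∑ j, killingForm ℝ 𝔤 ⁅plusBasis D Ξ i, plusBasis D Ξ j⁆ (X : 𝔤) •
        φ (minusBasis D Ξ i) (minusBasis D Ξ j)

/-- The Kostant codifferential `∂^* : C³(𝔤_{Ξ,-}, 𝔤) → C²(𝔤_{Ξ,-}, 𝔤)`. -/
def codiff₃ (φ : gMinus D Ξ → gMinus D Ξ → gMinus D Ξ → 𝔤) (X Y : gMinus D Ξ) : 𝔤 :=
  -∑ i, ⁅plusBasis D Ξ i, φ (minusBasis D Ξ i) X Y⁆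
    - (2 : ℝ)⁻¹ • ∑ i, ∑ j,
      (killingForm ℝ 𝔤 ⁅plusBasis D Ξ i, plusBasis D Ξ j⁆ (X : 𝔤) •
          φ (minusBasis D Ξ i) (minusBasis D Ξ j) Y
        - killingForm ℝ 𝔤 ⁅plusBasis D Ξ i, plusBasis D Ξ j⁆ (Y : 𝔤) •
          φ (minusBasis D Ξ i) (minusBasis D Ξ j) X)

/-- The Kostant Laplacian `□ = ∂ ∂^* + ∂^* ∂` on `2`-cochains. -/
def laplacian (φ : gMinus D Ξ → gMinus D Ξ → 𝔤) (X Y : gMinus D Ξ) : 𝔤 :=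
  diff₁ (codiff₂ φ) X Y + codiff₃ (diff₂ φ) X Y

lemma laplacian_add (φ ψ : BilinearCochain D Ξ) (X Y : gMinus D Ξ) :
    laplacian (fun A B => (φ + ψ) A B) X Y =
      laplacian (fun A B => φ A B) X Y + laplacian (fun A B => ψ A B) X Y := by
  simp only [laplacian, diff₁, diff₂, codiff₂, codiff₃, LinearMap.add_apply, lie_add, lie_sub,
    lie_neg, smul_add, smul_sub, Finset.sum_add_distrib, Finset.sum_sub_distrib]
  abel

lemma laplacian_smul (c : ℝ) (φ : BilinearCochain D Ξ) (X Y : gMinus D Ξ) :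
    laplacian (fun A B => (c • φ) A B) X Y = c • laplacian (fun A B => φ A B) X Y := by
  have h : ∀ (r : ℝ) (x : 𝔤), r • c • x = c • r • x := fun r x => smul_comm r c x
  have h1 : ∀ (f : gMinus D Ξ → 𝔤), diff₁ (fun A => c • f A) X Y = c • diff₁ f X Y := by
    intro f
    simp only [diff₁, lie_smul, smul_sub]
  have h2 : ∀ (f : gMinus D Ξ → gMinus D Ξ → 𝔤) (A : gMinus D Ξ),
      codiff₂ (fun A B => c • f A B) A = c • codiff₂ f A := by
    intro f A
    simp only [codiff₂, lie_smul, smul_sub, smul_neg, Finset.smul_sum, h]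
  have h3 : ∀ (f : gMinus D Ξ → gMinus D Ξ → 𝔤) (A B C : gMinus D Ξ),
      diff₂ (fun A B => c • f A B) A B C = c • diff₂ f A B C := by
    intro f A B C
    simp only [diff₂, lie_smul, smul_sub, smul_add]
  have h4 : ∀ (f : gMinus D Ξ → gMinus D Ξ → gMinus D Ξ → 𝔤),
      codiff₃ (fun A B C => c • f A B C) X Y = c • codiff₃ f X Y := by
    intro f
    simp only [codiff₃, lie_smul, smul_sub, smul_neg, Finset.smul_sum, h]
  have e2 := funext (h2 fun A B => φ A B)
  have e3 := funext fun A => funext fun B => funext (h3 (fun A B => φ A B) A B)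
  simp only [laplacian, LinearMap.smul_apply, smul_add]
  rw [← h1, ← h4, e2, e3]

variable (D Ξ) in
/-- The space `ker □` of harmonic `2`-cochains. -/
def harmonicSpace : Submodule ℝ (BilinearCochain D Ξ) where
  carrier := {φ | φ.IsAlt ∧ ∀ X Y, laplacian (fun A B => φ A B) X Y = 0}
  add_mem' := by
    rintro φ ψ ⟨h1, h2⟩ ⟨h3, h4⟩
    refine ⟨fun X => ?_, fun X Y => ?_⟩
    · rw [LinearMap.add_apply, LinearMap.add_apply, h1 X, h3 X, add_zero]
    · rw [laplacian_add, h2, h4, add_zero]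
  zero_mem' := by
    refine ⟨fun X => rfl, fun X Y => ?_⟩
    have := laplacian_smul (0 : ℝ) (0 : BilinearCochain D Ξ) X Y
    rwa [zero_smul, zero_smul] at this
  smul_mem' := by
    rintro c φ ⟨h1, h2⟩
    refine ⟨fun X => ?_, fun X Y => ?_⟩
    · rw [LinearMap.smul_apply, LinearMap.smul_apply, h1 X, smul_zero]
    · rw [laplacian_smul, h2, smul_zero]

/-- `φH` is the projection of the `2`-cochain `φ` to `ker □` along the image of `□`. -/
def IsHarmonicProjection (φ φH : BilinearCochain D Ξ) : Prop :=
  φH ∈ harmonicSpace D Ξ ∧ ∃ ψ : BilinearCochain D Ξ, ψ.IsAlt ∧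
    ∀ X Y, φ X Y - φH X Y = laplacian (fun A B => ψ A B) X Y

end Kostant

/-- `φ` has no entries in `𝔤_{Ξ-Ψ,0}`: it vanishes upon insertion of an element of
`𝔤_{Ξ-Ψ,0} ∩ 𝔤_{Ξ,-} ≅ 𝔭_{Ξ-Ψ}/𝔭_Ξ`. -/
def HasNoEntries {𝔤 : Type*} [LieRing 𝔤] [LieAlgebra ℝ 𝔤] {ι : Type*} [Fintype ι]
    {D : SimpleRestrictedRoots 𝔤 ι} {Ξ : Set ι} (Ψ : Set ι) (φ : BilinearCochain D Ξ) : Prop :=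
  ∀ X : gMinus D Ξ, (X : 𝔤) ∈ gradedPiece D (Ξ \ Ψ) 0 → ∀ Y : gMinus D Ξ, φ X Y = 0

/-! ### Roots and weights of the complexification -/

section Complexification

open LieAlgebra LieAlgebra.IsKilling

/-- The complexification of a semisimple real Lie algebra is semisimple. -/
instance instIsKillingComplexification {𝔤 : Type*} [LieRing 𝔤] [LieAlgebra ℝ 𝔤]
    [Module.Finite ℝ 𝔤] [LieAlgebra.IsKilling ℝ 𝔤] : LieAlgebra.IsKilling ℂ (ℂ ⊗[ℝ] 𝔤) := by
  have h : (killingForm ℂ (ℂ ⊗[ℝ] 𝔤)).Nondegenerate := by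
    let e := Module.finBasis ℝ 𝔤
    have h1 := (LinearMap.BilinForm.nondegenerate_iff_det_ne_zero e).mp
      (LieAlgebra.IsKilling.killingForm_nondegenerate ℝ 𝔤)
    refine (LinearMap.BilinForm.nondegenerate_iff_det_ne_zero
      (Module.Basis.baseChange ℂ e)).mpr ?_
    have h2 : LinearMap.BilinForm.toMatrix (Module.Basis.baseChange ℂ e)
        (killingForm ℂ (ℂ ⊗[ℝ] 𝔤)) =
        (algebraMap ℝ ℂ).mapMatrix (LinearMap.BilinForm.toMatrix e (killingForm ℝ 𝔤)) := by
      have h3 : killingForm ℂ (ℂ ⊗[ℝ] 𝔤) = LinearMap.BilinForm.baseChange ℂ (killingForm ℝ 𝔤) :=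
        LieModule.traceForm_baseChange ℝ 𝔤 𝔤 ℂ
      rw [RingHom.mapMatrix_apply]
      ext i j
      rw [Matrix.map_apply, LinearMap.BilinForm.toMatrix_apply, LinearMap.BilinForm.toMatrix_apply,
        h3, Module.Basis.baseChange_apply, Module.Basis.baseChange_apply,
        LinearMap.BilinForm.baseChange_tmul, mul_one, Algebra.algebraMap_eq_smul_one]
    rw [h2, ← RingHom.map_det]
    exact (map_ne_zero _).mpr h1
  refine ⟨?_⟩
  rw [eq_bot_iff]
  intro x hx
  rw [LieIdeal.mem_killingCompl] at hx
  exact h.1 x fun y => by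
    rw [LieModule.traceForm_comm]
    exact hx y trivial

variable {𝔤 : Type*} [LieRing 𝔤] [LieAlgebra ℝ 𝔤] [Module.Finite ℝ 𝔤]
  [LieAlgebra.IsKilling ℝ 𝔤]
  {H : LieSubalgebra ℂ (ℂ ⊗[ℝ] 𝔤)} [H.IsCartanSubalgebra]

/-- The scalar product on weights that is induced by the Killing form. -/
def killingInner (lam mu : Module.Dual ℂ H) : ℂ := lam ((cartanEquivDual H).symm mu)

variable (b : (rootSystem H).Base)

open scoped Classical in
/-- Half the sum of the positive roots (the sum of the fundamental weights). -/
def rho : Module.Dual ℂ H :=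
  (2 : ℂ)⁻¹ • ∑ i : H.root, if b.IsPos i then (rootSystem H).root i else 0

/-- `m` is the highest root of `𝔤_ℂ`, or of one of its simple ideals if `𝔤_ℂ` is not simple:
a positive root that is maximal among the roots. -/
def IsHighestRoot (m : H.root) : Prop :=
  b.IsPos m ∧ ∀ i ∈ b.support,
    (rootSystem H).root m + (rootSystem H).root i ∉ Set.range (rootSystem H).root

/-- The weight `(α_a, α_c)`: the affine action of `s_{α_a} s_{α_c}` on the highest root `m`. -/
def pairWeight (a c m : H.root) : Module.Dual ℂ H :=
  (rootSystem H).reflection a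
    ((rootSystem H).reflection c ((rootSystem H).root m + rho b)) - rho b

variable {ι : Type*} [Fintype ι] (D : SimpleRestrictedRoots 𝔤 ι)

/-- The restriction of `α ∈ H^*` to `𝔞` is `lam`. -/
def RestrictsTo (α : Module.Dual ℂ H) (lam : Module.Dual ℝ D.𝔞) : Prop :=
  ∀ (x : D.𝔞) (hx : (1 : ℂ) ⊗ₜ[ℝ] (x : 𝔤) ∈ H), α ⟨(1 : ℂ) ⊗ₜ[ℝ] (x : 𝔤), hx⟩ = (lam x : ℂ)

/-- The Cartan subalgebra `H` of `𝔤_ℂ` contains `𝔞`, and each simple root for `b` restricts to `0`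
or to a simple restricted root. -/
structure IsAdapted : Prop where
  mem : ∀ x ∈ D.𝔞, (1 : ℂ) ⊗ₜ[ℝ] x ∈ H
  restricts : ∀ i ∈ b.support, RestrictsTo D ((rootSystem H).root i) 0 ∨
    ∃ j, RestrictsTo D ((rootSystem H).root i) (D.simple j)

variable {D} {Ξ : Set ι}

variable (D Ξ) in
/-- The inclusion `(𝔤_{Ξ,0})_ℂ → 𝔤_ℂ`. -/
def gZeroIncl : ℂ ⊗[ℝ] gZero D Ξ →ₗ[ℂ] ℂ ⊗[ℝ] 𝔤 :=
  (gZero D Ξ).toSubmodule.subtype.baseChange ℂ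

/-- `v` is an element of weight `lam` that is annihilated by the negative root spaces of
`(𝔤_{Ξ,0})_ℂ`. -/
def IsLowestWeightElement (lam : Module.Dual ℂ H) (v : ℂ ⊗[ℝ] BilinearCochain D Ξ) : Prop :=
  (∀ (A : ℂ ⊗[ℝ] gZero D Ξ) (hA : gZeroIncl D Ξ A ∈ H), ⁅A, v⁆ = lam ⟨_, hA⟩ • v) ∧
  ∀ i : H.root, ¬ b.IsPos i → ∀ A : ℂ ⊗[ℝ] gZero D Ξ,
    gZeroIncl D Ξ A ∈ rootSpace H ((rootSystem H).root i) → ⁅A, v⁆ = 0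

/-- The isotypical component of `(ker □)_ℂ` represented by the weight `lam` of
`H²(𝔭_{Ξ,+}, 𝔤)`: by duality, it is generated by the elements of lowest weight `-lam`. -/
def isotypicComponent (D : SimpleRestrictedRoots 𝔤 ι) (Ξ : Set ι) (lam : Module.Dual ℂ H) :
    LieSubmodule ℂ (ℂ ⊗[ℝ] gZero D Ξ) (ℂ ⊗[ℝ] BilinearCochain D Ξ) :=
  LieSubmodule.lieSpan ℂ (ℂ ⊗[ℝ] gZero D Ξ)
    {v | v ∈ (harmonicSpace D Ξ).baseChange ℂ ∧ IsLowestWeightElement b (-lam) v}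

/-- The component of the harmonic cochain `φ` that is represented by `lam` is non-trivial. -/
def HasComponent (φ : BilinearCochain D Ξ) (lam : Module.Dual ℂ H) : Prop :=
  ∃ x ∈ isotypicComponent b D Ξ lam, x ≠ 0 ∧
    (1 : ℂ) ⊗ₜ[ℝ] φ - x ∈
      ⨆ mu : {mu : Module.Dual ℂ H // mu ≠ lam}, isotypicComponent b D Ξ mu.1

end Complexification

/-! ### Parabolic geometries -/

section Geometry

open VectorField

instance instLEInftyMinSmoothness : ENat.LEInfty (minSmoothness ℝ 3) :=
  ⟨by rw [minSmoothness_of_isRCLikeNormedField]; exact ENat.LEInfty.out⟩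

instance instCompleteModel {E : Type*} [NormedAddCommGroup E] [NormedSpace ℝ E]
    [FiniteDimensional ℝ E] : CompleteSpace E := FiniteDimensional.complete ℝ E

variable {EG : Type*} [NormedAddCommGroup EG] [NormedSpace ℝ EG] [FiniteDimensional ℝ EG]
  {G : Type*} [TopologicalSpace G] [ChartedSpace EG G] [Group G] [LieGroup 𝓘(ℝ, EG) ∞ G]

/-- The Lie algebra of `G`. -/
abbrev LieAlg (EG : Type*) [NormedAddCommGroup EG] [NormedSpace ℝ EG] (G : Type*)
    [TopologicalSpace G] [ChartedSpace EG G] [Group G] : Type _ := GroupLieAlgebra 𝓘(ℝ, EG) G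

instance instFiniteLieAlg : Module.Finite ℝ (LieAlg EG G) := inferInstanceAs (Module.Finite ℝ EG)

/-- The adjoint action of `g ∈ G` on the Lie algebra of `G`. -/
def adjointAction (g : G) : LieAlg EG G →ₗ[ℝ] LieAlg EG G :=
  (mfderiv 𝓘(ℝ, EG) 𝓘(ℝ, EG) (fun x : G => g * x * g⁻¹) 1).toLinearMap

variable {EP : Type*} [NormedAddCommGroup EP] [NormedSpace ℝ EP] [FiniteDimensional ℝ EP]
  {P : Type*} [TopologicalSpace P] [ChartedSpace EP P] [Group P] [LieGroup 𝓘(ℝ, EP) ∞ P]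

/-- The derivative at the identity of a homomorphism `P → G`. -/
def derivOne (f : P →* G) : LieAlg EP P →ₗ[ℝ] LieAlg EG G :=
  (mfderiv 𝓘(ℝ, EP) 𝓘(ℝ, EG) (fun p : P => f p) 1).toLinearMap

/-- `f` embeds `P` as a closed Lie subgroup of `G` with Lie algebra `𝔭` that normalizes `𝔭`. For a
parabolic subalgebra `𝔭` these are the subgroups between the normalizer `N_G(𝔭)` and its identity
component. -/
structure IsParabolicSubgroup (𝔭 : Submodule ℝ (LieAlg EG G)) (f : P →* G) : Prop where
  contMDiff : ContMDiff 𝓘(ℝ, EP) 𝓘(ℝ, EG) ∞ (fun p : P => f p)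
  isClosedEmbedding : Topology.IsClosedEmbedding (fun p : P => f p)
  derivOne_injective : Function.Injective (derivOne (EG := EG) (EP := EP) f)
  range_derivOne : LinearMap.range (derivOne (EG := EG) (EP := EP) f) = 𝔭
  map_adjointAction : ∀ p : P, 𝔭.map (adjointAction (f p)) = 𝔭

variable {EM : Type*} [NormedAddCommGroup EM] [NormedSpace ℝ EM] [FiniteDimensional ℝ EM]
  {M : Type*} [TopologicalSpace M] [ChartedSpace EM M] [IsManifold 𝓘(ℝ, EM) ∞ M]
  {EB : Type*} [NormedAddCommGroup EB] [NormedSpace ℝ EB] [FiniteDimensional ℝ EB]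
  {B : Type*} [TopologicalSpace B] [ChartedSpace EB B] [IsManifold 𝓘(ℝ, EB) ∞ B]

/-- A smooth principal `P`-bundle `π : B → M` with (right) principal action `act`. -/
structure IsPrincipalBundle (π : B → M) (act : B → P → B) : Prop where
  contMDiff_proj : ContMDiff 𝓘(ℝ, EB) 𝓘(ℝ, EM) ∞ π
  contMDiff_act : ContMDiff (𝓘(ℝ, EB).prod 𝓘(ℝ, EP)) 𝓘(ℝ, EB) ∞ (fun z : B × P => act z.1 z.2)
  act_one : ∀ u, act u 1 = u
  act_mul : ∀ u p q, act u (p * q) = act (act u p) q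
  proj_act : ∀ u p, π (act u p) = π u
  /-- Local triviality: over an open neighbourhood `U` of each point there are a section `σ` and a
  map `τ` such that `(x, p) ↦ σ(x)p` and `u ↦ (π(u), τ(u))` are inverse to each other. -/
  locally_trivial : ∀ x : M, ∃ U : Set M, IsOpen U ∧ x ∈ U ∧ ∃ (σ : M → B) (τ : B → P),
    ContMDiffOn 𝓘(ℝ, EM) 𝓘(ℝ, EB) ∞ σ U ∧ ContMDiffOn 𝓘(ℝ, EB) 𝓘(ℝ, EP) ∞ τ (π ⁻¹' U) ∧
    (∀ y ∈ U, π (σ y) = y) ∧ (∀ u, π u ∈ U → act (σ (π u)) (τ u) = u) ∧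
    ∀ y ∈ U, ∀ p, τ (act (σ y) p) = p

/-- A Cartan geometry `(B → M, ω)` of type `(G, P)`, where `P` is a subgroup of `G` by means of
`f : P → G`. -/
structure CartanGeometry (f : P →* G) (π : B → M) where
  act : B → P → B
  isPrincipalBundle : IsPrincipalBundle (EP := EP) (EM := EM) (EB := EB) π act
  /-- The Cartan connection `ω`, an absolute parallelism. -/
  conn : ∀ u : B, TangentSpace 𝓘(ℝ, EB) u ≃ₗ[ℝ] LieAlg EG G
  /-- Smoothness: the vector fields `ω⁻¹(X)` are smooth. -/
  contMDiff_conn : ∀ X : LieAlg EG G, ContMDiff 𝓘(ℝ, EB) (𝓘(ℝ, EB).tangent) ∞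
    (fun u : B => (⟨u, (conn u).symm X⟩ : TangentBundle 𝓘(ℝ, EB) B))
  /-- Equivariance: `(r^p)^* ω = Ad(p⁻¹) ∘ ω`. -/
  equivariant : ∀ (u : B) (p : P) (ξ : TangentSpace 𝓘(ℝ, EB) u),
    conn (act u p) (mfderiv 𝓘(ℝ, EB) 𝓘(ℝ, EB) (fun v => act v p) u ξ) =
      adjointAction (f p)⁻¹ (conn u ξ)
  /-- `ω` reproduces the generators of fundamental vector fields. -/
  fundamental : ∀ (u : B) (Z : LieAlg EP P),
    conn (act u 1) (mfderiv 𝓘(ℝ, EP) 𝓘(ℝ, EB) (fun p => act u p) 1 Z) = derivOne f Z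

namespace CartanGeometry

variable {f : P →* G} {π : B → M}
  (C : CartanGeometry (EG := EG) (EP := EP) (EM := EM) (EB := EB) f π)

/-- The vector field `ω⁻¹(X)`. -/
def constantField (X : LieAlg EG G) (u : B) : TangentSpace 𝓘(ℝ, EB) u := (C.conn u).symm X

lemma mdifferentiableAt_constantField (X : LieAlg EG G) (u : B) :
    MDifferentiableAt 𝓘(ℝ, EB) (𝓘(ℝ, EB).tangent)
      (fun u : B => (⟨u, C.constantField X u⟩ : TangentBundle 𝓘(ℝ, EB) B)) u :=
  (C.contMDiff_conn X).mdifferentiableAt (by simp)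

lemma constantField_add (X Y : LieAlg EG G) :
    C.constantField (X + Y) = C.constantField X + C.constantField Y :=
  funext fun u => map_add (C.conn u).symm X Y

lemma constantField_smul (c : ℝ) (X : LieAlg EG G) :
    C.constantField (c • X) = c • C.constantField X :=
  funext fun u => map_smul (C.conn u).symm c X

/-- The curvature function `κ(u)(X, Y) = [X, Y] - ω_u([ω⁻¹(X), ω⁻¹(Y)])`, i.e. the values of the
curvature `dω + ½[ω, ω]` on the vector fields `ω⁻¹(X)` and `ω⁻¹(Y)`. -/
def curvature (u : B) : LieAlg EG G →ₗ[ℝ] LieAlg EG G →ₗ[ℝ] LieAlg EG G :=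
  LinearMap.mk₂ ℝ
    (fun X Y => ⁅X, Y⁆ -
      C.conn u (mlieBracket 𝓘(ℝ, EB) (C.constantField X) (C.constantField Y) u))
    (fun X X' Y => by
      rw [constantField_add, mlieBracket_add_left (C.mdifferentiableAt_constantField X u)
        (C.mdifferentiableAt_constantField X' u), map_add, add_lie, add_sub_add_comm])
    (fun c X Y => by
      rw [constantField_smul, mlieBracket_const_smul_left (C.mdifferentiableAt_constantField X u),
        map_smul, smul_lie, smul_sub])
    (fun X Y Y' => by
      rw [constantField_add, mlieBracket_add_right (C.mdifferentiableAt_constantField Y u)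
        (C.mdifferentiableAt_constantField Y' u), map_add, lie_add, add_sub_add_comm])
    (fun c X Y => by
      rw [constantField_smul, mlieBracket_const_smul_right (C.mdifferentiableAt_constantField Y u),
        map_smul, lie_smul, smul_sub])

variable {ι : Type*} [Fintype ι]

/-- The curvature function with values in `Λ²(𝔤_{Ξ,-})^* ⊗ 𝔤 = Λ²(𝔤/𝔭_Ξ)^* ⊗ 𝔤`. -/
def curvatureCochain (D : SimpleRestrictedRoots (LieAlg EG G) ι) (Ξ : Set ι) (u : B) :
    BilinearCochain D Ξ :=
  (C.curvature u).domRestrict₁₂ (gMinus D Ξ).toSubmodule (gMinus D Ξ).toSubmodule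

end CartanGeometry

end Geometry

end Parabolic

end

/-! The argument is pointwise in `u`: the geometry enters only through the fact that `κH u` is
harmonic, and the rest is representation theory in the spirit of Kostant's theorem. Twice the
Kostant Laplacian equals the Casimir operator of `𝔤_{Ξ,0}`, corrected by the action of `δ = ∑ [X_i,
Z^i]`, minus the identity (`GradedFrame.two_smul_lap`). Hence an alternating cochain is harmonic
exactly when the corrected Casimir operator fixes it. On a lowest weight vector of weight `-ν` in
the complexification that operator is the scalar `⟨ν, ν + 2ρ⟩` (`IsHarmonicModel.smul_sub_mem`), so
`|ν + ρ|² = 1 + |ρ|²`. If a cochain of weight `-ν` is nonzero on root vectors for `-β` and `-γ`,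
then `ν + ρ = ρ - β - γ + μ`, where `β ≠ γ` are positive and `μ` is a root or zero. Moving this
vector into the dominant chamber gives `|ν + ρ|² ≤ 1 + |ρ|²` (`IsPairSum.le_of_isDominant`), the `1`
being the Casimir eigenvalue of the adjoint representation. Equality forces `β, γ` to be the
inversions `α_a, s_a α_c` of a Weyl group element of length two, and `ν + ρ = s_a s_c (m + ρ)` for a
highest root `m` (`IsPairSum.exists_reflections`). A lowest weight vector is therefore nonzero only
on pairs of root vectors for `-α_a` and `-s_a α_c`. Such a vector has no entries in `𝔤_{Ξ-Ψ,0}` iff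
neither `α_a` nor `s_a α_c` has `(Ξ-Ψ)`-height zero. If `α_a` and `α_c` are not orthogonal, `s_a α_c
= α_c + kα_a` with `k ≥ 1`, and only `α_a` matters; if they are orthogonal, `s_a α_c = α_c` and both
matter. A computation with Cartan integers shows that these are exactly the simple roots pairing
negatively with the weight (`simple_pairing_lt_zero_iff`), which also gives statements 1 and 2. For
a general harmonic element, the cochains without entries form a `𝔤_{Ξ,0}`-stable subspace. The norm
estimate replaces complete reducibility: stable subspaces are generated by their lowest weight
vectors (`IsHarmonicModel.le_leviSpan`) and the isotypical components are independent
(`IsHarmonicModel.disjoint_isoComp`). So there are no entries iff every isotypical component that is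
met nontrivially consists of such cochains (`IsHarmonicModel.mem_noEntries_iff`). -/

noncomputable section

set_option linter.unusedSectionVars false

/-! ### Positivity of the form on the root lattice; the cone of positive roots. -/

namespace RootForm

open RootPairing

variable {ι M N : Type*} [Fintype ι] [AddCommGroup M] [Module ℂ M] [AddCommGroup N] [Module ℂ N]

/-- The properties of the bilinear form on weights that is induced by a Killing form. -/
structure IsDualKillingForm (P : RootPairing ι ℂ M N) (F : M →ₗ[ℂ] M →ₗ[ℂ] ℂ) : Prop where
  symm : ∀ x y, F x y = F y x
  two_mul : ∀ i x, 2 * F x (P.root i) = F (P.root i) (P.root i) * P.coroot' i x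
  eq_sum : ∀ x y, F x y = ∑ i, F x (P.root i) * F y (P.root i)
  ne_zero : ∀ i, F (P.root i) (P.root i) ≠ 0

/-- The real part of the form `F`. -/
def ip (F : M →ₗ[ℂ] M →ₗ[ℂ] ℂ) (x y : M) : ℝ := (F x y).re

section ip

variable (F : M →ₗ[ℂ] M →ₗ[ℂ] ℂ)

lemma ip_add_left (x y z : M) : ip F (x + y) z = ip F x z + ip F y z := by simp [ip]
lemma ip_add_right (x y z : M) : ip F x (y + z) = ip F x y + ip F x z := by simp [ip]
lemma ip_sub_left (x y z : M) : ip F (x - y) z = ip F x z - ip F y z := by simp [ip]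
lemma ip_sub_right (x y z : M) : ip F x (y - z) = ip F x y - ip F x z := by simp [ip]
lemma ip_neg_left (x y : M) : ip F (-x) y = -ip F x y := by simp [ip]
lemma ip_neg_right (x y : M) : ip F x (-y) = -ip F x y := by simp [ip]
@[simp] lemma ip_zero_left (y : M) : ip F 0 y = 0 := by simp [ip]
@[simp] lemma ip_zero_right (y : M) : ip F y 0 = 0 := by simp [ip]
lemma ip_intCast_smul_right (n : ℤ) (x y : M) : ip F x ((n : ℂ) • y) = n * ip F x y := by
  simp [ip]
lemma ip_sum_right {κ : Type*} (s : Finset κ) (x : M) (f : κ → M) :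
    ip F x (∑ i ∈ s, f i) = ∑ i ∈ s, ip F x (f i) := by simp [ip]
lemma ip_nsmul_right (n : ℕ) (x y : M) : ip F x (n • y) = n * ip F x y := by
  simp [ip]

end ip

variable {P : RootPairing ι ℂ M N} {F : M →ₗ[ℂ] M →ₗ[ℂ] ℂ}

lemma root_reflectionPerm_self (i : ι) : P.root (P.reflectionPerm i i) = -P.root i := by
  rw [root_reflectionPerm, reflection_apply_self]

namespace IsDualKillingForm

variable (hF : IsDualKillingForm P F)
include hF

lemma ip_comm (x y : M) : ip F x y = ip F y x := by rw [ip, ip, hF.symm]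

lemma reflection_eq (i : ι) (x : M) :
    P.reflection i x = x - (P.coroot' i x) • P.root i := by
  rw [RootPairing.reflection_apply]

lemma map_reflection (i : ι) (x y : M) : F (P.reflection i x) (P.reflection i y) = F x y := by
  rw [hF.reflection_eq, hF.reflection_eq]
  have h1 := hF.two_mul i x
  have h2 := hF.two_mul i y
  have h3 := hF.symm (P.root i) y
  simp only [map_sub, map_smul, LinearMap.sub_apply, LinearMap.smul_apply, smul_eq_mul]
  rw [h3]
  linear_combination (-P.coroot' i y / 2) * h1 + (-P.coroot' i x / 2) * h2

variable [P.IsCrystallographic]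

lemma two_mul_root (i j : ι) :
    2 * F (P.root j) (P.root i) = F (P.root i) (P.root i) * (P.pairingIn ℤ j i : ℂ) := by
  rw [hF.two_mul, root_coroot'_eq_pairing, ← P.algebraMap_pairingIn ℤ]
  simp

/-- Writing `n = F(α, α)`, the sum formula for `F` reads `n = n² S / 4`, where `S` is the sum of the
squared Cartan integers, a positive integer. Hence `n = 4 / S`. -/
lemma root_root (i : ι) :
    ∃ r : ℝ, 0 < r ∧ F (P.root i) (P.root i) = r := by
  set n := F (P.root i) (P.root i) with hn
  have h1 : n = ∑ j, (n / 2 * (P.pairingIn ℤ j i : ℂ)) ^ 2 := by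
    conv_lhs => rw [hn, hF.eq_sum]
    refine Finset.sum_congr rfl fun j _ => ?_
    have := hF.two_mul_root i j
    have h' : F (P.root i) (P.root j) = n / 2 * (P.pairingIn ℤ j i : ℂ) := by
      rw [hF.symm]; linear_combination this / 2
    rw [h']; ring
  have h2 : n ≠ 0 := hF.ne_zero i
  set S : ℤ := ∑ j, (P.pairingIn ℤ j i) ^ 2 with hS
  have hSpos : 0 < S := by
    refine Finset.sum_pos' (fun j _ => sq_nonneg _) ⟨i, Finset.mem_univ _, ?_⟩
    simp
  have h3 : n = n ^ 2 / 4 * (S : ℂ) := by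
    rw [hS]; push_cast; rw [Finset.mul_sum]
    conv_lhs => rw [h1]
    refine Finset.sum_congr rfl fun j _ => ?_
    ring
  have hSc : (S : ℂ) ≠ 0 := by exact_mod_cast hSpos.ne'
  have h4 : n = 4 / (S : ℂ) := by
    field_simp
    have : n * (n * S) = n * 4 := by linear_combination (-4) * h3
    exact mul_left_cancel₀ h2 this
  refine ⟨4 / (S : ℝ), by positivity, ?_⟩
  rw [h4]; push_cast; rfl

lemma ip_root_self_pos (i : ι) : 0 < ip F (P.root i) (P.root i) := by
  obtain ⟨r, hr, h⟩ := hF.root_root i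
  simpa [ip, h] using hr

lemma root_self_eq (i : ι) : F (P.root i) (P.root i) = (ip F (P.root i) (P.root i) : ℂ) := by
  obtain ⟨r, hr, h⟩ := hF.root_root i
  simp [ip, h]

lemma two_mul_ip (i : ι) (x : M) :
    2 * ip F x (P.root i) = ip F (P.root i) (P.root i) * (P.coroot' i x).re := by
  have h := congrArg Complex.re (hF.two_mul i x)
  rw [hF.root_self_eq] at h
  simpa [ip] using h

lemma two_mul_ip_root (i j : ι) :
    2 * ip F (P.root j) (P.root i) = ip F (P.root i) (P.root i) * (P.pairingIn ℤ j i : ℝ) := by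
  have h := congrArg Complex.re (hF.two_mul_root i j)
  rw [hF.root_self_eq] at h
  simpa [ip] using h

lemma root_root_eq (i j : ι) : F (P.root j) (P.root i) = (ip F (P.root j) (P.root i) : ℂ) := by
  have h1 := hF.two_mul_root i j
  have h2 := hF.two_mul_ip_root i j
  rw [hF.root_self_eq] at h1
  have h3 : (2 : ℂ) * (ip F (P.root j) (P.root i) : ℂ) =
      (ip F (P.root i) (P.root i) : ℂ) * (P.pairingIn ℤ j i : ℂ) := by exact_mod_cast h2
  linear_combination h1 / 2 - h3 / 2

/-- Pairings of elements of the root lattice with roots are real. -/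
lemma eq_ip_of_mem {x : M} (hx : x ∈ AddSubgroup.closure (Set.range P.root)) (i : ι) :
    F x (P.root i) = (ip F x (P.root i) : ℂ) := by
  induction hx using AddSubgroup.closure_induction with
  | mem x h => obtain ⟨j, rfl⟩ := h; exact hF.root_root_eq i j
  | zero => simp
  | add x y _ _ h1 h2 => rw [map_add, LinearMap.add_apply, h1, h2, ip_add_left]; push_cast; rfl
  | neg x _ h => rw [map_neg, LinearMap.neg_apply, h, ip_neg_left]; push_cast; rfl

lemma ip_self_eq_sum {x : M} (hx : x ∈ AddSubgroup.closure (Set.range P.root)) :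
    ip F x x = ∑ i, ip F x (P.root i) ^ 2 := by
  have h := hF.eq_sum x x
  simp_rw [hF.eq_ip_of_mem hx] at h
  have h' : F x x = ((∑ i, ip F x (P.root i) ^ 2 : ℝ) : ℂ) := by
    rw [h]; push_cast; exact Finset.sum_congr rfl fun i _ => by ring
  rw [ip, h', Complex.ofReal_re]

lemma ip_self_nonneg {x : M} (hx : x ∈ AddSubgroup.closure (Set.range P.root)) :
    0 ≤ ip F x x := by
  rw [hF.ip_self_eq_sum hx]
  exact Finset.sum_nonneg fun i _ => sq_nonneg _

lemma ip_root_eq_zero {x : M} (hx : x ∈ AddSubgroup.closure (Set.range P.root))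
    (h : ip F x x = 0) (i : ι) : ip F x (P.root i) = 0 := by
  rw [hF.ip_self_eq_sum hx, Finset.sum_eq_zero_iff_of_nonneg fun i _ => sq_nonneg _] at h
  simpa using h i (Finset.mem_univ _)

end IsDualKillingForm

/-- The monoid of sums of simple roots. -/
def posCone (b : P.Base) : AddSubmonoid M := AddSubmonoid.closure (P.root '' b.support)

open scoped Classical in
/-- Half the sum of the positive roots. -/
def halfSum (b : P.Base) : M := (2 : ℂ)⁻¹ • ∑ i, if b.IsPos i then P.root i else 0

/-- A positive root that is maximal among the roots. -/
def IsHighest (b : P.Base) (m : ι) : Prop :=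
  b.IsPos m ∧ ∀ i ∈ b.support, P.root m + P.root i ∉ Set.range P.root

variable (b : P.Base)

lemma simple_mem_posCone {i : ι} (hi : i ∈ b.support) : P.root i ∈ posCone b :=
  AddSubmonoid.subset_closure ⟨i, hi, rfl⟩

lemma posCone_le : (posCone b : Set M) ⊆ AddSubgroup.closure (Set.range P.root) := by
  intro x hx
  induction hx using AddSubmonoid.closure_induction with
  | mem x h => obtain ⟨j, -, rfl⟩ := h; exact AddSubgroup.subset_closure ⟨j, rfl⟩
  | zero => exact zero_mem _
  | add x y _ _ h1 h2 => exact add_mem h1 h2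

lemma exists_sum_of_mem_posCone {x : M} (hx : x ∈ posCone b) :
    ∃ f : ι → ℕ, x = ∑ j ∈ b.support, f j • P.root j := by
  induction hx using AddSubmonoid.closure_induction with
  | mem x h =>
    obtain ⟨j, hj, rfl⟩ := h
    classical
    exact ⟨Pi.single j 1, by
      rw [Finset.sum_eq_single_of_mem j hj fun k _ hk => by simp [Pi.single_eq_of_ne hk]]; simp⟩
  | zero => exact ⟨0, by simp⟩
  | add x y _ _ h1 h2 =>
    obtain ⟨f, hf⟩ := h1
    obtain ⟨g, hg⟩ := h2
    exact ⟨f + g, by simp [hf, hg, add_smul, Finset.sum_add_distrib]⟩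

lemma isPos_of_mem_posCone {i : ι} (hi : P.root i ∈ posCone b) : b.IsPos i := by
  obtain ⟨f, hf⟩ := exists_sum_of_mem_posCone b hi
  rw [Base.isPos_iff', Base.height_eq_sum (f := fun j => (f j : ℤ)) (by simpa using hf)]
  exact Finset.sum_nonneg fun j _ => by positivity

lemma not_isPos_iff (i : ι) : b.IsPos (P.reflectionPerm i i) ↔ ¬ b.IsPos i :=
  Base.IsPos.neg_iff_not b i

lemma root_mem_posCone_iff {i : ι} : P.root i ∈ posCone b ↔ b.IsPos i := by
  refine ⟨isPos_of_mem_posCone b, fun h => ?_⟩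
  rcases b.root_mem_or_neg_mem i with h' | h'
  · exact h'
  · rw [← root_reflectionPerm_self] at h'
    exact absurd h ((not_isPos_iff b i).mp (isPos_of_mem_posCone b h'))

lemma neg_root_mem_posCone_iff {i : ι} : -P.root i ∈ posCone b ↔ ¬ b.IsPos i := by
  rw [← root_reflectionPerm_self, root_mem_posCone_iff, not_isPos_iff]

open scoped Classical in
/-- The positive one of `± root i`. -/
def absRoot (i : ι) : M := if b.IsPos i then P.root i else -P.root i

lemma absRoot_mem (i : ι) : absRoot b i ∈ posCone b := by
  unfold absRoot
  split_ifs with h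
  · exact (root_mem_posCone_iff b).mpr h
  · exact (neg_root_mem_posCone_iff b).mpr h

lemma absRoot_of_isPos {i : ι} (h : b.IsPos i) : absRoot b i = P.root i := if_pos h

lemma absRoot_neg (i : ι) : absRoot b (P.reflectionPerm i i) = absRoot b i := by
  unfold absRoot
  by_cases h : b.IsPos i
  · have h' : ¬ b.IsPos (P.reflectionPerm i i) := by rw [not_isPos_iff]; simpa using h
    rw [if_neg h', if_pos h, root_reflectionPerm_self, neg_neg]
  · have h' : b.IsPos (P.reflectionPerm i i) := by rw [not_isPos_iff]; exact h
    rw [if_pos h', if_neg h, root_reflectionPerm_self]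

/-- The involution `α ↦ -α` on indices. -/
def negPerm (P : RootPairing ι ℂ M N) : Equiv.Perm ι where
  toFun i := P.reflectionPerm i i
  invFun i := P.reflectionPerm i i
  left_inv i := by
    apply P.root.injective
    rw [root_reflectionPerm_self, root_reflectionPerm_self, neg_neg]
  right_inv i := by
    apply P.root.injective
    rw [root_reflectionPerm_self, root_reflectionPerm_self, neg_neg]

/-- Each positive root is counted twice, for `α` and `-α`, and the positive roots sum to `2ρ`.
Summing over all indices makes the expression easy to permute. -/
lemma sum_absRoot : ∑ i, absRoot b i = (4 : ℂ) • halfSum b := by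
  classical
  have h1 : ∑ i, absRoot b i = ∑ i, (if b.IsPos i then P.root i else 0) +
      ∑ i, (if b.IsPos i then 0 else -P.root i) := by
    rw [← Finset.sum_add_distrib]
    refine Finset.sum_congr rfl fun i _ => ?_
    unfold absRoot
    split_ifs <;> simp
  have h2 : ∑ i, (if b.IsPos i then 0 else -P.root i) =
      ∑ i, (if b.IsPos i then P.root i else 0) := by
    rw [← Equiv.sum_comp (negPerm P)]
    refine Finset.sum_congr rfl fun i _ => ?_
    change (if b.IsPos (P.reflectionPerm i i) then 0 else -P.root (P.reflectionPerm i i)) = _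
    rw [root_reflectionPerm_self, neg_neg]
    by_cases h : b.IsPos i
    · rw [if_neg (by rw [not_isPos_iff]; simpa using h), if_pos h]
    · rw [if_pos (by rw [not_isPos_iff]; exact h), if_neg h]
  rw [h1, h2, halfSum, smul_smul, ← two_smul ℂ]
  norm_num

end RootForm

/-! ### Simple reflections and `ρ`, dominance, highest roots. -/

namespace RootForm

open RootPairing

variable {ι M N : Type*} [Fintype ι] [AddCommGroup M] [Module ℂ M] [AddCommGroup N] [Module ℂ N]
  {P : RootPairing ι ℂ M N} {F : M →ₗ[ℂ] M →ₗ[ℂ] ℂ} [P.IsRootSystem] [P.IsCrystallographic]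
  [P.IsReduced] (b : P.Base)

/-- A simple reflection permutes the positive roots other than its own, so it commutes with taking
absolute values away from `±α_i`. -/
lemma absRoot_reflectionPerm {i j : ι} (hi : i ∈ b.support) (h1 : j ≠ i)
    (h2 : j ≠ P.reflectionPerm i i) :
    absRoot b (P.reflectionPerm i j) = P.reflection i (absRoot b j) := by
  by_cases hj : b.IsPos j
  · rw [absRoot_of_isPos b hj, absRoot_of_isPos b (hj.reflectionPerm hi h1), root_reflectionPerm]
  · have hj' : b.IsPos (P.reflectionPerm j j) := (not_isPos_iff b j).mpr hj
    have h3 : P.reflectionPerm j j ≠ i := by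
      intro h
      apply h2
      apply P.root.injective
      rw [root_reflectionPerm_self, ← h, root_reflectionPerm_self, neg_neg]
    have h4 : P.reflectionPerm (P.reflectionPerm i j) (P.reflectionPerm i j) =
        P.reflectionPerm i (P.reflectionPerm j j) := by
      apply P.root.injective
      rw [root_reflectionPerm_self, root_reflectionPerm, root_reflectionPerm,
        root_reflectionPerm_self, map_neg]
    rw [← absRoot_neg b (P.reflectionPerm i j), h4, ← absRoot_neg b j,
      absRoot_of_isPos b hj', absRoot_of_isPos b (hj'.reflectionPerm hi h3), root_reflectionPerm]

lemma reflectionPerm_self_ne (i : ι) : P.reflectionPerm i i ≠ i := by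
  intro h
  have h1 := root_reflectionPerm_self (P := P) i
  rw [h] at h1
  have h2 : (2 : ℂ) • P.root i = 0 := by rw [two_smul]; nth_rewrite 1 [h1]; simp
  exact P.ne_zero i ((smul_eq_zero.mp h2).resolve_left two_ne_zero)

/-- A simple reflection maps `ρ` to `ρ - α`. -/
lemma reflection_halfSum {i : ι} (hi : i ∈ b.support) :
    P.reflection i (halfSum b) = halfSum b - P.root i := by
  classical
  have h1 : ∑ j, absRoot b j = ∑ j, absRoot b (P.reflectionPerm i j) :=
    (Equiv.sum_comp (P.reflectionPerm i) _).symm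
  have h2 : ∀ j, absRoot b (P.reflectionPerm i j) = P.reflection i (absRoot b j) +
      ((if j = i then (2 : ℂ) • P.root i else 0) +
        if j = P.reflectionPerm i i then (2 : ℂ) • P.root i else 0) := by
    intro j
    have hpos := Base.isPos_of_mem_support hi
    by_cases hj : j = i
    · subst hj
      rw [absRoot_neg, absRoot_of_isPos b hpos, if_pos rfl,
        if_neg (reflectionPerm_self_ne j).symm, reflection_apply_self]
      module
    by_cases hj' : j = P.reflectionPerm i i
    · subst hj'
      rw [reflectionPerm_self, if_neg hj, if_pos rfl, absRoot_neg, absRoot_of_isPos b hpos,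
        reflection_apply_self]
      module
    · rw [if_neg hj, if_neg hj', absRoot_reflectionPerm b hi hj hj']
      simp
  rw [Finset.sum_congr rfl fun j _ => h2 j, Finset.sum_add_distrib, Finset.sum_add_distrib,
    ← map_sum, sum_absRoot, map_smul] at h1
  simp only [Finset.sum_ite_eq', Finset.mem_univ, if_true] at h1
  have h3 : (4 : ℂ) • (P.reflection i (halfSum b)) = (4 : ℂ) • (halfSum b - P.root i) := by
    rw [smul_sub, h1]; module
  exact smul_right_injective M (by norm_num : (4 : ℂ) ≠ 0) h3

lemma coroot'_halfSum {i : ι} (hi : i ∈ b.support) : P.coroot' i (halfSum b) = 1 := by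
  have h := reflection_halfSum b hi
  rw [RootPairing.reflection_apply, sub_right_inj] at h
  have h' : (P.coroot' i (halfSum b) - 1) • P.root i = 0 := by rw [sub_smul, h, one_smul, sub_self]
  exact sub_eq_zero.mp ((smul_eq_zero.mp h').resolve_right (P.ne_zero i))

/-- Nonnegative pairing with the simple roots. -/
def IsDominant (F : M →ₗ[ℂ] M →ₗ[ℂ] ℂ) (b : P.Base) (x : M) : Prop :=
  ∀ i ∈ b.support, 0 ≤ ip F x (P.root i)

lemma IsDominant.ip_nonneg {b : P.Base} {x q : M} (hx : IsDominant F b x) (hq : q ∈ posCone b) :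
    0 ≤ ip F x q := by
  induction hq using AddSubmonoid.closure_induction with
  | mem x h => obtain ⟨j, hj, rfl⟩ := h; exact hx j hj
  | zero => simp
  | add x y _ _ h1 h2 => rw [ip_add_right]; exact add_nonneg h1 h2

namespace IsDualKillingForm

variable (hF : IsDualKillingForm P F)
include hF

lemma two_mul_ip_halfSum {i : ι} (hi : i ∈ b.support) :
    2 * ip F (halfSum b) (P.root i) = ip F (P.root i) (P.root i) := by
  rw [hF.two_mul_ip, coroot'_halfSum b hi]
  simp

/-- On a simple root the value is `|α|²/2`. Strict positivity of `ρ` on the cone makes the cone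
pointed and detects equality in the norm estimate. -/
lemma ip_halfSum_pos {q : M} (hq : q ∈ posCone b) (h0 : q ≠ 0) : 0 < ip F (halfSum b) q := by
  suffices q = 0 ∨ 0 < ip F (halfSum b) q from this.resolve_left h0
  clear h0
  induction hq using AddSubmonoid.closure_induction with
  | mem x h =>
    obtain ⟨j, hj, rfl⟩ := h
    right
    have h1 := hF.two_mul_ip_halfSum b hj
    have h2 := hF.ip_root_self_pos j
    linarith
  | zero => left; rfl
  | add x y _ _ h1 h2 =>
    rcases h1 with rfl | h1
    · rwa [zero_add]
    rcases h2 with rfl | h2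
    · right; rwa [add_zero]
    · right; rw [ip_add_right]; exact add_pos h1 h2

lemma isDominant_halfSum : IsDominant F b (halfSum b) := fun i hi =>
  (hF.ip_halfSum_pos b (simple_mem_posCone b hi) (P.ne_zero i)).le

lemma eq_zero_of_add_eq_zero {p q : M} (hp : p ∈ posCone b) (hq : q ∈ posCone b)
    (h : p + q = 0) : p = 0 := by
  by_contra h0
  have h1 := hF.ip_halfSum_pos b hp h0
  have h2 := (hF.isDominant_halfSum b).ip_nonneg hq
  have h3 : ip F (halfSum b) (p + q) = 0 := by rw [h]; simp
  rw [ip_add_right] at h3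
  linarith

/-- `F(q, q)` is the sum of the squares `F(q, α)²`. A null vector is orthogonal to all roots, hence
to `4ρ`, against the strict positivity of `ρ`. -/
lemma ip_self_pos {q : M} (hq : q ∈ posCone b) (h0 : q ≠ 0) : 0 < ip F q q := by
  have hq' := posCone_le b hq
  refine lt_of_le_of_ne (hF.ip_self_nonneg hq') fun h => ?_
  have h1 := hF.ip_root_eq_zero hq' h.symm
  have h2 : ip F q (halfSum b) = 0 := by
    have h3 : ip F q ((4 : ℤ) • halfSum b) = 0 := by
      have : ((4 : ℤ) • halfSum b) = ∑ i, absRoot b i := by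
        rw [sum_absRoot, ← Int.cast_smul_eq_zsmul ℂ]; norm_num
      rw [this, ip_sum_right]
      refine Finset.sum_eq_zero fun i _ => ?_
      unfold absRoot
      split_ifs
      · exact h1 i
      · rw [ip_neg_right, h1, neg_zero]
    rw [← Int.cast_smul_eq_zsmul ℂ, ip_intCast_smul_right] at h3
    simpa using h3
  have := hF.ip_halfSum_pos b hq h0
  rw [hF.ip_comm, h2] at this
  exact lt_irrefl _ this

lemma pairingIn_neg_iff {i j : ι} :
    P.pairingIn ℤ i j < 0 ↔ ip F (P.root i) (P.root j) < 0 := by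
  have h1 := hF.two_mul_ip_root j i
  have h2 := hF.ip_root_self_pos j
  rw [← Int.cast_lt (R := ℝ), Int.cast_zero]
  constructor
  · intro h; nlinarith
  · intro h; by_contra h3; push Not at h3; nlinarith

lemma pairingIn_pos_iff {i j : ι} :
    0 < P.pairingIn ℤ i j ↔ 0 < ip F (P.root i) (P.root j) := by
  have h1 := hF.two_mul_ip_root j i
  have h2 := hF.ip_root_self_pos j
  rw [← Int.cast_lt (R := ℝ), Int.cast_zero]
  constructor
  · intro h; nlinarith
  · intro h; by_contra h3; push Not at h3; nlinarith

lemma ne_neg_of_isPos {i j : ι} (hi : b.IsPos i) (hj : b.IsPos j) : P.root i ≠ -P.root j := by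
  intro h
  refine P.ne_zero i (hF.eq_zero_of_add_eq_zero b ((root_mem_posCone_iff b).mpr hi)
    ((root_mem_posCone_iff b).mpr hj) ?_)
  rw [h, neg_add_cancel]

variable {b}

lemma isDominant_of_isHighest {m : ι} (hm : IsHighest b m) : IsDominant F b (P.root m) := by
  intro i hi
  by_contra h
  push Not at h
  exact hm.2 i hi (P.root_add_root_mem_of_pairingIn_neg (hF.pairingIn_neg_iff.mpr h)
    (hF.ne_neg_of_isPos b hm.1 (Base.isPos_of_mem_support hi)))

/-- Induction on the number of simple summands of `q`. Since `(q, q) > 0`, some summand `α_i` pairs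
positively with `q`, hence with `m + q` because `m` is dominant; then `m + q - α_i` would be a root
too. -/
lemma root_add_notMem {m : ι} (hm : IsHighest b m) {q : M} (hq : q ∈ posCone b) (h0 : q ≠ 0) :
    P.root m + q ∉ Set.range P.root := by
  obtain ⟨f, hf⟩ := exists_sum_of_mem_posCone b hq
  generalize hn : ∑ j ∈ b.support, f j = n
  induction n generalizing q f with
  | zero =>
    refine absurd ?_ h0
    rw [hf]
    refine Finset.sum_eq_zero fun j hj => ?_
    rw [Finset.sum_eq_zero_iff.mp hn j hj, zero_smul]
  | succ n ih =>
    rintro ⟨k, hk⟩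
    have h1 := hF.ip_self_pos b hq h0
    have h2 : ∃ i ∈ b.support, 0 < f i ∧ 0 < ip F q (P.root i) := by
      by_contra! hcon
      refine absurd h1 (not_lt.mpr ?_)
      nth_rewrite 2 [hf]
      rw [ip_sum_right]
      refine Finset.sum_nonpos fun j hj => ?_
      rw [ip_nsmul_right]
      rcases Nat.eq_zero_or_pos (f j) with h | h
      · rw [h]; simp
      · exact mul_nonpos_of_nonneg_of_nonpos (by positivity) (hcon j hj h)
    obtain ⟨i, hi, hfi, hip⟩ := h2
    classical
    have hq' : q - P.root i = ∑ j ∈ b.support, (f - (Pi.single i 1 : ι → ℕ)) j • P.root j := by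
      have : ∀ j ∈ b.support, f j • P.root j = (f - (Pi.single i 1 : ι → ℕ)) j • P.root j +
          (Pi.single i 1 : ι → ℕ) j • P.root j := by
        intro j hj
        rw [← add_smul]
        congr 1
        rcases eq_or_ne j i with rfl | h
        · simp; lia
        · simp [Pi.single_eq_of_ne h]
      rw [hf, Finset.sum_congr rfl this, Finset.sum_add_distrib,
        Finset.sum_eq_single_of_mem i hi
          (f := fun j => (Pi.single i 1 : ι → ℕ) j • P.root j)
          fun j _ hj => by simp [Pi.single_eq_of_ne hj]]
      simp
    have hmem : q - P.root i ∈ posCone b := by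
      rw [hq']
      exact sum_mem fun j hj => nsmul_mem (simple_mem_posCone b hj) _
    have hsum : ∑ j ∈ b.support, (f - (Pi.single i 1 : ι → ℕ)) j = n := by
      have h3 : ∑ j ∈ b.support, f j = ∑ j ∈ b.support, (f - (Pi.single i 1 : ι → ℕ)) j + 1 := by
        have h4 : ∑ j ∈ b.support, (Pi.single i 1 : ι → ℕ) j = 1 := by
          rw [Finset.sum_eq_single_of_mem i hi fun j _ hj => by simp [Pi.single_eq_of_ne hj]]
          simp
        rw [← h4, ← Finset.sum_add_distrib]
        refine Finset.sum_congr rfl fun j _ => ?_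
        rcases eq_or_ne j i with rfl | h
        · simp; lia
        · simp [Pi.single_eq_of_ne h]
      lia
    -- If `q` is itself simple, maximality applies directly; the induction hypothesis needs a
    -- nonzero remainder.
    by_cases hz : q - P.root i = 0
    · rw [sub_eq_zero] at hz
      exact hm.2 i hi ⟨k, by rw [hk, hz]⟩
    · refine ih hmem hz _ hq' hsum ?_
      have h3 : 0 < ip F (P.root k) (P.root i) := by
        rw [hk, ip_add_left]
        have := hF.isDominant_of_isHighest hm i hi
        linarith
      have h4 : k ≠ i := by
        rintro rfl
        have h5 : P.root m + (q - P.root k) = 0 := by rw [← add_sub_assoc, ← hk, sub_self]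
        exact P.ne_zero m (hF.eq_zero_of_add_eq_zero b ((root_mem_posCone_iff b).mpr hm.1) hmem h5)
      have := P.root_sub_root_mem_of_pairingIn_pos (hF.pairingIn_pos_iff.mpr h3) h4
      rwa [hk, add_sub_assoc] at this

/-- If the integer were at least `2`, then `k = j - m` would be a root. For `k` positive, `m + k =
j` contradicts maximality; for `k` negative, `m - k` turns out to be a root and gives the same
contradiction. -/
lemma pairingIn_isHighest {m j : ι} (hm : IsHighest b m) (hj : b.IsPos j) (hjm : j ≠ m) :
    P.pairingIn ℤ j m = 0 ∨ P.pairingIn ℤ j m = 1 := by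
  have h0 : 0 ≤ P.pairingIn ℤ j m := by
    by_contra h
    push Not at h
    have h1 := hF.pairingIn_neg_iff.mp h
    rw [hF.ip_comm] at h1
    exact absurd h1 (not_lt.mpr ((hF.isDominant_of_isHighest hm).ip_nonneg
      ((root_mem_posCone_iff b).mpr hj)))
  by_contra hcon
  have h2 : 2 ≤ P.pairingIn ℤ j m := by lia
  obtain ⟨k, hk⟩ := P.root_sub_root_mem_of_pairingIn_pos (by lia : 0 < P.pairingIn ℤ j m) hjm
  by_cases hkp : b.IsPos k
  · exact hF.root_add_notMem hm ((root_mem_posCone_iff b).mpr hkp) (P.ne_zero k)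
      ⟨j, by rw [hk]; abel⟩
  · have hl := (neg_root_mem_posCone_iff b).mpr hkp
    have hne : -P.root k ≠ 0 := neg_ne_zero.mpr (P.ne_zero k)
    refine hF.root_add_notMem hm hl hne ?_
    rcases eq_or_lt_of_le h2 with h3 | h3
    -- Integer equal to `2`: the reflection of `j` in `m` is `j - 2m = k - m`, the negative of `m -
    -- k`.
    · rw [← neg_mem_range_root_iff]
      refine ⟨P.reflectionPerm m j, ?_⟩
      rw [root_reflectionPerm, P.reflection_apply_root' ℤ, ← h3, hk]
      module
    · have h4 : 0 < P.pairingIn ℤ k m := by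
        have h5 : 2 * ip F (P.root k) (P.root m) =
          ip F (P.root m) (P.root m) * (P.pairingIn ℤ j m - 2 : ℝ) := by
          rw [hk, ip_sub_left, mul_sub, hF.two_mul_ip_root m j]; ring
        rw [hF.pairingIn_pos_iff]
        have h6 := hF.ip_root_self_pos m
        have h7 : (2 : ℝ) < P.pairingIn ℤ j m := by exact_mod_cast h3
        nlinarith
      have h8 : k ≠ m := fun h => hkp (h ▸ hm.1)
      have := P.root_sub_root_mem_of_pairingIn_pos h4 h8
      rw [← neg_mem_range_root_iff] at this
      convert this using 1
      abel

end IsDualKillingForm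
end RootForm

/-! ### The Casimir eigenvalue, root system automorphisms and the norm estimate. -/

namespace RootForm

open RootPairing

variable {ι M N : Type*} [Fintype ι] [AddCommGroup M] [Module ℂ M] [AddCommGroup N] [Module ℂ N]
  {P : RootPairing ι ℂ M N} {F : M →ₗ[ℂ] M →ₗ[ℂ] ℂ} [P.IsRootSystem] [P.IsCrystallographic]
  [P.IsReduced] {b : P.Base}

lemma negIndex_negIndex (i : ι) :
    P.reflectionPerm (P.reflectionPerm i i) (P.reflectionPerm i i) = i := by
  apply P.root.injective
  rw [root_reflectionPerm_self, root_reflectionPerm_self, neg_neg]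

namespace IsDualKillingForm

variable (hF : IsDualKillingForm P F)
include hF

/-- The Casimir eigenvalue of the adjoint representation is `1`. -/
lemma ip_isHighest {m : ι} (hm : IsHighest b m) :
    ip F (P.root m) (P.root m) + 2 * ip F (halfSum b) (P.root m) = 1 := by
  classical
  set n := ip F (P.root m) (P.root m) with hn
  have hnpos : 0 < n := hF.ip_root_self_pos m
  have hip : ∀ i, ip F (P.root m) (P.root i) = n / 2 * P.pairingIn ℤ i m := by
    intro i
    have := hF.two_mul_ip_root m i
    rw [hF.ip_comm]; linarith
  have hs := hF.ip_self_eq_sum (x := P.root m) (AddSubgroup.subset_closure ⟨m, rfl⟩)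
  -- The Cartan integers with `m` are `0` or `±1` except at `±m`, so the absolute value of the
  -- integer equals its square, except at `±m`, where `2 = 4 - 2`.
  have habs : ∀ i, ip F (P.root m) (absRoot b i) =
      n / 2 * ((P.pairingIn ℤ i m : ℝ) ^ 2 - ((if i = m then (2 : ℝ) else 0) +
        if i = P.reflectionPerm m m then (2 : ℝ) else 0)) := by
    intro i
    by_cases hi : b.IsPos i
    · have hne : i ≠ P.reflectionPerm m m := by
        rintro rfl
        exact (not_isPos_iff b m).mp hi hm.1
      rw [absRoot_of_isPos b hi, hip, if_neg hne]
      congr 1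
      by_cases him : i = m
      · subst him; simp; norm_num
      · rw [if_neg him]
        rcases hF.pairingIn_isHighest hm hi him with h | h <;> simp [h]
    · have hi' := (not_isPos_iff b i).mpr hi
      have hne : i ≠ m := by rintro rfl; exact hi hm.1
      rw [← absRoot_neg, absRoot_of_isPos b hi', hip, if_neg hne]
      congr 1
      by_cases him : i = P.reflectionPerm m m
      · subst him
        rw [negIndex_negIndex]; simp; norm_num
      · rw [if_neg him]
        have him' : P.reflectionPerm i i ≠ m := by
          rintro rfl
          apply him
          apply P.root.injective
          rw [root_reflectionPerm_self, root_reflectionPerm_self, neg_neg]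
        have hneg : P.pairingIn ℤ i m = -P.pairingIn ℤ (P.reflectionPerm i i) m := by
          simp
        rcases hF.pairingIn_isHighest hm hi' him' with h | h <;> rw [hneg, h] <;> simp
  have hsum : ip F (P.root m) ((4 : ℂ) • halfSum b) =
      n / 2 * (∑ i, (P.pairingIn ℤ i m : ℝ) ^ 2 - 4) := by
    rw [← sum_absRoot, ip_sum_right, Finset.sum_congr rfl fun i _ => habs i, ← Finset.mul_sum,
      Finset.sum_sub_distrib, Finset.sum_add_distrib]
    simp only [Finset.sum_ite_eq', Finset.mem_univ, if_true]
    norm_num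
  have h4 : ip F (P.root m) ((4 : ℂ) • halfSum b) = 4 * ip F (halfSum b) (P.root m) := by
    have := ip_intCast_smul_right F 4 (P.root m) (halfSum b)
    rw [hF.ip_comm (P.root m) (halfSum b)] at this
    simpa using this
  have hs' : n = n ^ 2 / 4 * ∑ i, (P.pairingIn ℤ i m : ℝ) ^ 2 := by
    rw [Finset.mul_sum]
    conv_lhs => rw [hn, hs]
    refine Finset.sum_congr rfl fun i _ => ?_
    rw [hip]; ring
  -- The same sum of squares is evaluated by the trace formula for `(m, m)`; combined with `hsum`,
  -- the unknown sum cancels.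
  have hs'' : 1 = n / 4 * ∑ i, (P.pairingIn ℤ i m : ℝ) ^ 2 := by
    have : n * 1 = n * (n / 4 * ∑ i, (P.pairingIn ℤ i m : ℝ) ^ 2) := by
      rw [mul_one]; conv_lhs => rw [hs']
      ring
    exact mul_left_cancel₀ hnpos.ne' this
  rw [h4] at hsum
  linarith

/-- Take a root of maximal height among those above `α_i`. No irreducibility is assumed, so there
may be several highest roots. -/
lemma exists_isHighest_of_isPos {i : ι} (hi : b.IsPos i) :
    ∃ m, IsHighest b m ∧ P.root m - P.root i ∈ posCone b := by
  classical
  obtain ⟨m, hm, hmax⟩ := Finset.exists_max_image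
    (Finset.univ.filter fun j => P.root j - P.root i ∈ posCone b) b.height
    ⟨i, by simp [zero_mem]⟩
  simp only [Finset.mem_filter, Finset.mem_univ, true_and] at hm hmax
  have hmpos : b.IsPos m := by
    rw [← root_mem_posCone_iff b]
    have := add_mem hm ((root_mem_posCone_iff b).mpr hi)
    rwa [sub_add_cancel] at this
  refine ⟨m, ⟨hmpos, ?_⟩, hm⟩
  rintro k hk ⟨l, hl⟩
  have h1 : P.root l - P.root i ∈ posCone b := by
    rw [hl, add_sub_right_comm]
    exact add_mem hm (simple_mem_posCone b hk)
  have h2 := hmax l h1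
  rw [b.height_add hl, Base.height_one_of_mem_support hk] at h2
  lia

lemma exists_isHighest [Nonempty ι] {μ : M} (hμ : μ = 0 ∨ μ ∈ Set.range P.root) :
    ∃ m, IsHighest b m ∧ P.root m - μ ∈ posCone b := by
  rcases hμ with rfl | ⟨i, rfl⟩
  · obtain ⟨i, hi⟩ := Base.support_nonempty b
    obtain ⟨m, hm, -⟩ := hF.exists_isHighest_of_isPos (Base.isPos_of_mem_support hi)
    exact ⟨m, hm, by rw [sub_zero]; exact (root_mem_posCone_iff b).mpr hm.1⟩
  · by_cases hi : b.IsPos i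
    · exact hF.exists_isHighest_of_isPos hi
    · have hi' := (not_isPos_iff b i).mpr hi
      obtain ⟨m, hm, h⟩ := hF.exists_isHighest_of_isPos hi'
      refine ⟨m, hm, ?_⟩
      -- For a negative root `-p`, use a highest root above `p`: `m - (-p) = (m - p) + 2p`.
      have hp := (root_mem_posCone_iff b).mpr hi'
      have := add_mem h (add_mem hp hp)
      rw [root_reflectionPerm_self] at this
      convert this using 1
      abel

end IsDualKillingForm

/-- Linear automorphisms that preserve the roots and the form. -/
structure IsAuto (P : RootPairing ι ℂ M N) (F : M →ₗ[ℂ] M →ₗ[ℂ] ℂ) (f : M ≃ₗ[ℂ] M) : Prop where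
  map_root : ∀ i, f (P.root i) ∈ Set.range P.root
  map_form : ∀ x y, F (f x) (f y) = F x y

namespace IsAuto

variable {f g : M ≃ₗ[ℂ] M}

lemma ip_map (hf : IsAuto P F f) (x y : M) : ip F (f x) (f y) = ip F x y := by
  rw [ip, ip, hf.map_form]

lemma trans (hf : IsAuto P F f) (hg : IsAuto P F g) : IsAuto P F (f.trans g) where
  map_root i := by
    obtain ⟨j, hj⟩ := hf.map_root i
    rw [LinearEquiv.trans_apply, ← hj]
    exact hg.map_root j
  map_form x y := by
    rw [LinearEquiv.trans_apply, LinearEquiv.trans_apply, hg.map_form, hf.map_form]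

lemma reflection (hF : IsDualKillingForm P F) (i : ι) : IsAuto P F (P.reflection i) where
  map_root j := ⟨P.reflectionPerm i j, root_reflectionPerm _ _ _⟩
  map_form := hF.map_reflection i

lemma refl : IsAuto P F (LinearEquiv.refl ℂ M) where
  map_root j := ⟨j, rfl⟩
  map_form _ _ := rfl

/-- The permutation of the roots that is induced by an automorphism. -/
def perm (hf : IsAuto P F f) : Equiv.Perm ι :=
  Equiv.ofBijective (fun i => (hf.map_root i).choose) <| by
    refine Finite.injective_iff_bijective.mp fun i j h => ?_
    apply P.root.injective
    apply f.injective
    rw [← (hf.map_root i).choose_spec, ← (hf.map_root j).choose_spec]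
    exact congrArg P.root h

lemma root_perm (hf : IsAuto P F f) (i : ι) : P.root (hf.perm i) = f (P.root i) :=
  (hf.map_root i).choose_spec

-- The roots span, so an automorphism is determined by the images of the finitely many roots.
variable (P F) in
lemma finite : {f : M ≃ₗ[ℂ] M | IsAuto P F f}.Finite := by
  refine Set.Finite.of_injOn (f := fun f i => f (P.root i))
    (t := Set.pi Set.univ fun _ : ι => Set.range P.root) (fun f hf i _ => hf.map_root i) ?_
    (Set.Finite.pi fun _ => Set.finite_range _)
  intro f _ g _ h
  apply LinearEquiv.toLinearMap_injective
  refine LinearMap.ext_on_range (v := P.root) IsRootSystem.span_root_eq_top fun i => ?_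
  exact congrFun h i

/-- Choose an automorphism maximizing `(f x, ρ)` in the finite group. Composing with `s_i` changes
this value by `-(f x, α_i)`, so that pairing is nonnegative. -/
lemma exists_isDominant (hF : IsDualKillingForm P F) (b : P.Base) (x : M) :
    ∃ f : M ≃ₗ[ℂ] M, IsAuto P F f ∧ IsDominant F b (f x) := by
  obtain ⟨f, hf, hmax⟩ := Set.exists_max_image _ (fun f : M ≃ₗ[ℂ] M => ip F (f x) (halfSum b))
    (finite P F) ⟨_, refl⟩
  refine ⟨f, hf, fun i hi => ?_⟩
  have hf' : IsAuto P F f := hf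
  have h1 := hmax _ (hf'.trans (reflection hF i))
  have h2 : ip F (P.reflection i (f x)) (halfSum b) =
      ip F (f x) (halfSum b) - ip F (f x) (P.root i) := by
    have h3 := (reflection hF i).ip_map (f x) (P.reflection i (halfSum b))
    rw [reflection_same] at h3
    rw [h3, reflection_halfSum b hi, ip_sub_right]
  rw [LinearEquiv.trans_apply, h2] at h1
  linarith

end IsAuto

/-- `x` is `ρ` minus two different positive roots plus a root or zero. -/
structure IsPairSum (b : P.Base) (x : M) (β γ : ι) (μ : M) : Prop where
  pos_left : b.IsPos β
  pos_right : b.IsPos γ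
  ne : β ≠ γ
  mem : μ = 0 ∨ μ ∈ Set.range P.root
  eq : x = halfSum b - P.root β - P.root γ + μ

lemma IsPairSum.swap {x : M} {β γ : ι} {μ : M} (h : IsPairSum b x β γ μ) :
    IsPairSum b x γ β μ :=
  ⟨h.pos_right, h.pos_left, h.ne.symm, h.mem, by rw [h.eq]; abel⟩

/-- The four roots `±β`, `±γ`. -/
def IsOneOf (P : RootPairing ι ℂ M N) (β γ i : ι) : Prop :=
  i = β ∨ i = γ ∨ i = P.reflectionPerm β β ∨ i = P.reflectionPerm γ γ

-- Removing two positive roots from `ρ` amounts to flipping their signs in the sum of all positive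
-- roots.
open scoped Classical in
lemma sum_signed_absRoot {β γ : ι} (hβ : b.IsPos β) (hγ : b.IsPos γ) (h : β ≠ γ) :
    ∑ i, (if IsOneOf P β γ i then -absRoot b i else absRoot b i) =
      (4 : ℂ) • (halfSum b - P.root β - P.root γ) := by
  have hn : ∀ {i j : ι}, b.IsPos i → b.IsPos j → i ≠ P.reflectionPerm j j := by
    rintro i j hi hj rfl
    exact (not_isPos_iff b j).mp hi hj
  have hinj : P.reflectionPerm β β ≠ P.reflectionPerm γ γ := fun h' => h <| by
    apply P.root.injective
    have := congrArg P.root h'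
    rwa [root_reflectionPerm_self, root_reflectionPerm_self, neg_inj] at this
  have h1 : ∀ i, (if IsOneOf P β γ i then -absRoot b i else absRoot b i) = absRoot b i -
      ((if i = β then (2 : ℂ) • P.root β else 0) + ((if i = γ then (2 : ℂ) • P.root γ else 0) +
        ((if i = P.reflectionPerm β β then (2 : ℂ) • P.root β else 0) +
          (if i = P.reflectionPerm γ γ then (2 : ℂ) • P.root γ else 0)))) := by
    intro i
    by_cases h1 : i = β
    · subst h1
      rw [if_pos (show IsOneOf P i γ i from Or.inl rfl), if_pos rfl, if_neg h, if_neg (hn hβ hβ), if_neg (hn hβ hγ),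
        absRoot_of_isPos b hβ]
      module
    by_cases h2 : i = γ
    · subst h2
      rw [if_pos (show IsOneOf P β i i from Or.inr (Or.inl rfl)), if_pos rfl, if_neg h1, if_neg (hn hγ hβ),
        if_neg (hn hγ hγ), absRoot_of_isPos b hγ]
      module
    by_cases h3 : i = P.reflectionPerm β β
    · subst h3
      rw [if_pos (show IsOneOf P β γ (P.reflectionPerm β β) from Or.inr (Or.inr (Or.inl rfl))), if_pos rfl, if_neg h1, if_neg h2, if_neg hinj,
        absRoot_neg, absRoot_of_isPos b hβ]
      module
    by_cases h4 : i = P.reflectionPerm γ γ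
    · subst h4
      rw [if_pos (show IsOneOf P β γ (P.reflectionPerm γ γ) from Or.inr (Or.inr (Or.inr rfl))), if_pos rfl, if_neg h1, if_neg h2, if_neg h3,
        absRoot_neg, absRoot_of_isPos b hγ]
      module
    · rw [if_neg (by simp [IsOneOf, h1, h2, h3, h4]), if_neg h1, if_neg h2, if_neg h3, if_neg h4]
      simp
  rw [Finset.sum_congr rfl fun i _ => h1 i]
  simp only [Finset.sum_sub_distrib, Finset.sum_add_distrib, Finset.sum_ite_eq', Finset.mem_univ,
    if_true, sum_absRoot]
  module

section core

variable {f : M ≃ₗ[ℂ] M} (hF : IsDualKillingForm P F) (hf : IsAuto P F f)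
include hF hf

lemma map_absRoot (i : ι) :
    f (absRoot b i) = absRoot b (hf.perm i) ∨ f (absRoot b i) = -absRoot b (hf.perm i) := by
  unfold absRoot
  split_ifs <;> simp [hf.root_perm]

-- An automorphism turns the signed sum for `ρ - β - γ` into another signed sum over the absolute
-- values of roots. Its difference from the all-positive sum counts the flipped roots, so it lies in
-- the cone, and it vanishes only if no sign is flipped.
open scoped Classical in
lemma halfSum_sub_map_mem {β γ : ι} (hβ : b.IsPos β) (hγ : b.IsPos γ) (h : β ≠ γ) :
    ∃ q ∈ posCone b, (2 : ℂ) • (halfSum b - f (halfSum b - P.root β - P.root γ)) = q ∧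
      (q = 0 → ∀ i, absRoot b (hf.perm i) =
        f (if IsOneOf P β γ i then -absRoot b i else absRoot b i)) := by
  set s : ι → M := fun i => if IsOneOf P β γ i then -absRoot b i else absRoot b i with hs
  have h1 : ∀ i, absRoot b (hf.perm i) - f (s i) = 0 ∨
      absRoot b (hf.perm i) - f (s i) = (2 : ℂ) • absRoot b (hf.perm i) := by
    intro i
    have : f (s i) = absRoot b (hf.perm i) ∨ f (s i) = -absRoot b (hf.perm i) := by
      simp only [hs]
      split_ifs
      · rw [map_neg]
        rcases map_absRoot hF hf i (b := b) with h | h <;> simp [h]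
      · exact map_absRoot hF hf i
    rcases this with h | h
    · left; rw [h, sub_self]
    · right; rw [h]; module
  have h2 : ∀ i, ∃ q ∈ posCone b, absRoot b (hf.perm i) - f (s i) = (2 : ℂ) • q := by
    intro i
    rcases h1 i with h | h
    · exact ⟨0, zero_mem _, by rw [h, smul_zero]⟩
    · exact ⟨_, absRoot_mem b _, h⟩
  choose q hq hq' using h2
  refine ⟨∑ i, q i, sum_mem fun i _ => hq i, ?_, fun h0 i => ?_⟩
  · have h3 : ∑ i, (absRoot b (hf.perm i) - f (s i)) =
        (4 : ℂ) • (halfSum b - f (halfSum b - P.root β - P.root γ)) := by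
      rw [Finset.sum_sub_distrib, Equiv.sum_comp hf.perm, sum_absRoot, ← map_sum,
        sum_signed_absRoot hβ hγ h, map_smul, smul_sub]
    rw [Finset.sum_congr rfl fun i _ => hq' i, ← Finset.smul_sum] at h3
    have h4 : (2 : ℂ) • ∑ i, q i =
        (2 : ℂ) • ((2 : ℂ) • (halfSum b - f (halfSum b - P.root β - P.root γ))) := by
      rw [h3, smul_smul]; norm_num
    exact (smul_right_injective M (two_ne_zero : (2 : ℂ) ≠ 0) h4).symm
  · have h5 : q i = 0 := by
      rw [← Finset.add_sum_erase _ _ (Finset.mem_univ i)] at h0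
      exact hF.eq_zero_of_add_eq_zero b (hq i) (sum_mem fun j _ => hq j) h0
    have := hq' i
    rw [h5, smul_zero, sub_eq_zero] at this
    exact this

/-- The norm estimate for weights of two-cochains, and the case of equality. -/
lemma IsPairSum.le_of_isDominant {x : M} {β γ : ι} {μ : M} (h : IsPairSum b x β γ μ)
    (hd : IsDominant F b (f x)) :
    ip F x x ≤ 1 + ip F (halfSum b) (halfSum b) ∧
      (ip F x x = 1 + ip F (halfSum b) (halfSum b) →
        (∀ i, b.IsPos i → (f (P.root i) ∈ posCone b ↔ i ≠ β ∧ i ≠ γ)) ∧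
        ∃ m, IsHighest b m ∧ f μ = P.root m ∧ f x = halfSum b + P.root m) := by
  have : Nonempty ι := ⟨β⟩
  obtain ⟨q, hq, hq1, hq2⟩ := halfSum_sub_map_mem hF hf h.pos_left h.pos_right h.ne
  have hμ : f μ = 0 ∨ f μ ∈ Set.range P.root := by
    rcases h.mem with rfl | ⟨i, rfl⟩
    · left; simp
    · right; exact hf.map_root i
  obtain ⟨m, hm, hm'⟩ := hF.exists_isHighest (b := b) hμ
  set r := P.root m - f μ with hr
  have hfx : (2 : ℂ) • (halfSum b + P.root m - f x) = q + (2 : ℕ) • r := by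
    rw [h.eq, map_add, ← hq1, hr, ← Nat.cast_smul_eq_nsmul ℂ]
    push_cast
    module
  -- The comparison vector `y = ρ + m` has norm `1 + |ρ|²` by the Casimir eigenvalue, and `t = 2(y -
  -- f x)` lies in the cone.
  set y := halfSum b + P.root m with hy
  set t := q + (2 : ℕ) • r with ht
  have htmem : t ∈ posCone b := add_mem hq (nsmul_mem hm' 2)
  have hyd : ∀ p ∈ posCone b, ip F (halfSum b) p ≤ ip F y p := by
    intro p hp
    rw [hy, ip_add_left]
    have := (hF.isDominant_of_isHighest hm).ip_nonneg hp
    linarith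
  have hyy : ip F y y = 1 + ip F (halfSum b) (halfSum b) := by
    rw [hy]
    simp only [ip_add_left, ip_add_right]
    have := hF.ip_isHighest hm
    rw [hF.ip_comm (P.root m) (halfSum b)]
    linarith
  have hxx : ip F x x = ip F (f x) (f x) := (hf.ip_map x x).symm
  have h2 : ∀ z, ip F z ((2 : ℂ) • (y - f x)) = 2 * ip F z (y - f x) := by
    intro z
    simpa using ip_intCast_smul_right F 2 z (y - f x)
  -- Both terms are nonnegative by dominance, and the first is at least `(ρ, t)`. Equality therefore
  -- forces `t = 0`, and with it `q = r = 0`.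
  have hdiff : 2 * (ip F y y - ip F x x) = ip F y t + ip F (f x) t := by
    rw [hxx, ← hfx, h2, h2]
    simp only [ip_sub_right]
    rw [hF.ip_comm (f x) y]
    ring
  have hn1 := hyd t htmem
  have hn2 := (hF.isDominant_halfSum b).ip_nonneg htmem
  have hn3 := hd.ip_nonneg htmem
  refine ⟨by linarith, fun heq => ?_⟩
  have ht0 : t = 0 := by
    by_contra h0
    have := hF.ip_halfSum_pos b htmem h0
    linarith
  have hq0 : q = 0 := hF.eq_zero_of_add_eq_zero b hq (nsmul_mem hm' 2) ht0
  have hr0 : r = 0 := by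
    rw [ht, hq0, zero_add, two_nsmul] at ht0
    exact hF.eq_zero_of_add_eq_zero b hm' hm' ht0
  refine ⟨fun i hi => ?_, m, hm, (sub_eq_zero.mp hr0).symm, ?_⟩
  · have h3 := hq2 hq0 i
    have hmem := absRoot_mem b (hf.perm i)
    rw [h3, absRoot_of_isPos b hi] at hmem
    have hne : i ≠ P.reflectionPerm β β ∧ i ≠ P.reflectionPerm γ γ := by
      constructor <;> rintro rfl
      · exact (not_isPos_iff b _).mp hi h.pos_left
      · exact (not_isPos_iff b _).mp hi h.pos_right
    by_cases hone : IsOneOf P β γ i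
    · rw [if_pos hone, map_neg] at hmem
      constructor
      · intro hcon
        have := hF.eq_zero_of_add_eq_zero b hcon hmem (add_neg_cancel _)
        exact absurd (f.injective (this.trans (map_zero f).symm)) (P.ne_zero i)
      · rintro ⟨h4, h5⟩
        rcases hone with h6 | h6 | h6 | h6
        exacts [absurd h6 h4, absurd h6 h5, absurd h6 hne.1, absurd h6 hne.2]
    · rw [if_neg hone] at hmem
      simp only [IsOneOf, not_or] at hone
      exact ⟨fun _ => ⟨hone.1, hone.2.1⟩, fun _ => hmem⟩
  · rw [ht0] at hfx
    have := (smul_eq_zero.mp hfx).resolve_left two_ne_zero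
    exact (sub_eq_zero.mp this).symm

end core

end RootForm

/-! ### The case of equality: Weyl group elements of length two. -/

namespace RootForm

open RootPairing

variable {ι M N : Type*} [Fintype ι] [AddCommGroup M] [Module ℂ M] [AddCommGroup N] [Module ℂ N]
  {P : RootPairing ι ℂ M N} {F : M →ₗ[ℂ] M →ₗ[ℂ] ℂ} [P.IsRootSystem] [P.IsCrystallographic]
  [P.IsReduced] {b : P.Base}

lemma map_mem_posCone {f : M ≃ₗ[ℂ] M} (h : ∀ i ∈ b.support, f (P.root i) ∈ posCone b) {q : M}
    (hq : q ∈ posCone b) : f q ∈ posCone b := by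
  induction hq using AddSubmonoid.closure_induction with
  | mem x hx => obtain ⟨j, hj, rfl⟩ := hx; exact h j hj
  | zero => rw [map_zero]; exact zero_mem _
  | add x y _ _ h1 h2 => rw [map_add]; exact add_mem h1 h2

lemma exists_simple_map_notMem {f : M ≃ₗ[ℂ] M} {j : ι} (hj : b.IsPos j)
    (h : f (P.root j) ∉ posCone b) : ∃ i ∈ b.support, f (P.root i) ∉ posCone b := by
  by_contra! hcon
  exact h (map_mem_posCone hcon ((root_mem_posCone_iff b).mpr hj))

lemma IsAuto.neg_map_mem {f : M ≃ₗ[ℂ] M} (hf : IsAuto P F f) {i : ι}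
    (h : f (P.root i) ∉ posCone b) : -f (P.root i) ∈ posCone b := by
  rw [← hf.root_perm] at h ⊢
  rw [neg_root_mem_posCone_iff]
  rwa [root_mem_posCone_iff] at h

lemma IsAuto.map_halfSum {f : M ≃ₗ[ℂ] M} (hf : IsAuto P F f)
    (h : ∀ i, b.IsPos i → f (P.root i) ∈ posCone b) : f (halfSum b) = halfSum b := by
  have h1 : ∀ i, f (absRoot b i) = absRoot b (hf.perm i) := by
    intro i
    by_cases hi : b.IsPos i
    · have h2 := h i hi
      rw [← hf.root_perm, root_mem_posCone_iff] at h2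
      rw [absRoot_of_isPos b hi, absRoot_of_isPos b h2, hf.root_perm]
    · have hi' := (not_isPos_iff b i).mpr hi
      have h2 := h _ hi'
      rw [root_reflectionPerm_self, map_neg, ← hf.root_perm, neg_root_mem_posCone_iff] at h2
      rw [← absRoot_neg b (hf.perm i), absRoot_of_isPos b ((not_isPos_iff b _).mpr h2),
        ← absRoot_neg b i, absRoot_of_isPos b hi', root_reflectionPerm_self,
        root_reflectionPerm_self, hf.root_perm, map_neg]
  have h3 : (4 : ℂ) • f (halfSum b) = (4 : ℂ) • halfSum b := by
    rw [← map_smul, ← sum_absRoot, map_sum, Finset.sum_congr rfl fun i _ => h1 i,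
      Equiv.sum_comp hf.perm]
  exact smul_right_injective M (by norm_num : (4 : ℂ) ≠ 0) h3

/-- An automorphism that maps positive roots to positive roots permutes the highest roots. -/
lemma IsAuto.isHighest_symm (hF : IsDualKillingForm P F) {f : M ≃ₗ[ℂ] M} (hf : IsAuto P F f)
    (h : ∀ i, b.IsPos i → f (P.root i) ∈ posCone b) {m : ι} (hm : IsHighest b m) :
    IsHighest b (hf.perm.symm m) := by
  have h1 : f (P.root (hf.perm.symm m)) = P.root m := by
    rw [← hf.root_perm, Equiv.apply_symm_apply]
  constructor
  · by_contra hcon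
    have hn := h _ ((not_isPos_iff b _).mpr hcon)
    rw [root_reflectionPerm_self, map_neg, h1] at hn
    exact (neg_root_mem_posCone_iff b).mp hn hm.1
  · rintro k hk ⟨l, hl⟩
    have h2 := congrArg f hl
    rw [map_add, h1, ← hf.root_perm] at h2
    refine hF.root_add_notMem hm (h k (Base.isPos_of_mem_support hk)) ?_ ⟨_, h2⟩
    exact fun h0 => P.ne_zero k (f.injective (h0.trans (map_zero f).symm))

variable (hF : IsDualKillingForm P F)
include hF

lemma IsPairSum.ip_le {x : M} {β γ : ι} {μ : M} (h : IsPairSum b x β γ μ) :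
    ip F x x ≤ 1 + ip F (halfSum b) (halfSum b) := by
  obtain ⟨f, hf, hd⟩ := IsAuto.exists_isDominant hF b x
  exact (h.le_of_isDominant hF hf hd).1

/-- In the extremal case `f x = ρ + m`, and `f` maps every positive root other than `β, γ` into the
cone, where `ρ + m` is strictly positive. -/
lemma IsPairSum.ip_root_pos {x : M} {β γ : ι} {μ : M} (h : IsPairSum b x β γ μ)
    (heq : ip F x x = 1 + ip F (halfSum b) (halfSum b)) {i : ι} (hi : b.IsPos i) (h1 : i ≠ β)
    (h2 : i ≠ γ) : 0 < ip F x (P.root i) := by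
  obtain ⟨f, hf, hd⟩ := IsAuto.exists_isDominant hF b x
  obtain ⟨h3, m, hm, -, h4⟩ := (h.le_of_isDominant hF hf hd).2 heq
  have h5 := (h3 i hi).mpr ⟨h1, h2⟩
  rw [← hf.ip_map, h4, ip_add_left]
  have h6 := (hF.isDominant_of_isHighest hm).ip_nonneg h5
  have h7 := hF.ip_halfSum_pos b h5 fun h0 =>
    P.ne_zero i (f.injective (h0.trans (map_zero f).symm))
  linarith

/-- Since `f` makes exactly `a` and `γ` negative, `f ∘ s_a` makes only `s_a γ` negative, which must
therefore be a simple root `c`. Then `f ∘ s_a ∘ s_c` preserves positivity, so it fixes `ρ` and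
permutes the highest roots. -/
lemma IsPairSum.exists_reflections_aux {x : M} {a γ : ι} {μ : M} (h : IsPairSum b x a γ μ)
    (ha : a ∈ b.support) {f : M ≃ₗ[ℂ] M} (hf : IsAuto P F f) {θ : ι} (hθ : IsHighest b θ)
    (hfx : f x = halfSum b + P.root θ)
    (hpos : ∀ i, b.IsPos i → (f (P.root i) ∈ posCone b ↔ i ≠ a ∧ i ≠ γ)) :
    ∃ c ∈ b.support, ∃ m, a ≠ c ∧ IsHighest b m ∧
      x = P.reflection a (P.reflection c (P.root m + halfSum b)) ∧
      γ = P.reflectionPerm a c := by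
  have hposa := h.pos_left
  have hγ' : b.IsPos (P.reflectionPerm a γ) := h.pos_right.reflectionPerm ha h.ne.symm
  set g := (P.reflection a).trans f with hg
  have hgauto : IsAuto P F g := (IsAuto.reflection hF a).trans hf
  have hga : -g (P.root a) = f (P.root a) := by
    rw [hg, LinearEquiv.trans_apply, reflection_apply_self, map_neg, neg_neg]
  have hgi : ∀ i, g (P.root i) = f (P.root (P.reflectionPerm a i)) := by
    intro i; rw [root_reflectionPerm]; rfl
  have h1 : ∀ i, b.IsPos i → (g (P.root i) ∈ posCone b ↔ i ≠ P.reflectionPerm a γ) := by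
    intro i hi
    by_cases hia : i = a
    · subst hia
      have h2 : f (P.root i) ∉ posCone b := fun hcon => ((hpos i hi).mp hcon).1 rfl
      have h3 := hf.neg_map_mem h2
      rw [← hga, neg_neg] at h3
      refine iff_of_true h3 ?_
      intro h4
      have h5 := congrArg (P.reflectionPerm i) h4
      rw [reflectionPerm_self] at h5
      rw [← h5] at h
      exact (not_isPos_iff b i).mp h.pos_right hi
    · rw [hgi, hpos _ (hi.reflectionPerm ha hia)]
      have h2 : P.reflectionPerm a i ≠ a := by
        intro h4
        have h5 := congrArg (P.reflectionPerm a) h4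
        rw [reflectionPerm_self] at h5
        rw [h5] at hi
        exact (not_isPos_iff b a).mp hi hposa
      have h3 : P.reflectionPerm a i = γ ↔ i = P.reflectionPerm a γ := by
        constructor
        · rintro rfl; rw [reflectionPerm_self]
        · rintro rfl; rw [reflectionPerm_self]
      simp [h2, h3]
  obtain ⟨c, hc, hc'⟩ := exists_simple_map_notMem hγ' fun hcon => (h1 _ hγ').mp hcon rfl
  have hcγ : c = P.reflectionPerm a γ := by
    by_contra hcon
    exact hc' ((h1 c (Base.isPos_of_mem_support hc)).mpr hcon)
  have hac : a ≠ c := by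
    rintro rfl
    have h5 := congrArg (P.reflectionPerm a) hcγ
    rw [reflectionPerm_self] at h5
    rw [← h5] at h
    exact (not_isPos_iff b a).mp h.pos_right hposa
  have hposc := Base.isPos_of_mem_support hc
  set u := (P.reflection c).trans g with hu
  have huauto : IsAuto P F u := (IsAuto.reflection hF c).trans hgauto
  have h2 : ∀ i, b.IsPos i → u (P.root i) ∈ posCone b := by
    intro i hi
    by_cases hic : i = c
    · subst hic
      have h3 := hgauto.neg_map_mem hc'
      rwa [hu, LinearEquiv.trans_apply, reflection_apply_self, map_neg]
    · rw [hu, LinearEquiv.trans_apply, ← root_reflectionPerm, h1 _ (hi.reflectionPerm hc hic),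
        ← hcγ]
      intro h4
      have h5 := congrArg (P.reflectionPerm c) h4
      rw [reflectionPerm_self] at h5
      rw [h5] at hi
      exact (not_isPos_iff b c).mp hi hposc
  refine ⟨c, hc, huauto.perm.symm θ, hac, huauto.isHighest_symm hF h2 hθ, ?_, ?_⟩
  · apply f.injective
    change f x = u (P.root (huauto.perm.symm θ) + halfSum b)
    rw [map_add, huauto.map_halfSum h2, ← huauto.root_perm, Equiv.apply_symm_apply, hfx, add_comm]
  · rw [hcγ, reflectionPerm_self]

/-- In the case of equality the two roots are the inversions of an element of length two of the
Weyl group. -/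
lemma IsPairSum.exists_reflections {x : M} {β γ : ι} {μ : M} (h : IsPairSum b x β γ μ)
    (heq : ip F x x = 1 + ip F (halfSum b) (halfSum b)) :
    ∃ a ∈ b.support, ∃ c ∈ b.support, ∃ m, a ≠ c ∧ IsHighest b m ∧
      x = P.reflection a (P.reflection c (P.root m + halfSum b)) ∧
      (β = a ∧ γ = P.reflectionPerm a c ∨ γ = a ∧ β = P.reflectionPerm a c) := by
  obtain ⟨f, hf, hd⟩ := IsAuto.exists_isDominant hF b x
  obtain ⟨hpos, θ, hθ, -, hfx⟩ := (h.le_of_isDominant hF hf hd).2 heq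
  -- An automorphism that makes some positive root negative makes a simple one negative; here it has
  -- to be `β` or `γ`.
  obtain ⟨a, ha, ha'⟩ := exists_simple_map_notMem h.pos_left
    fun hcon => ((hpos _ h.pos_left).mp hcon).1 rfl
  have h1 : a = β ∨ a = γ := by
    by_contra! hcon
    exact ha' ((hpos a (Base.isPos_of_mem_support ha)).mpr hcon)
  rcases h1 with rfl | rfl
  · obtain ⟨c, hc, m, h2, h3, h4, h5⟩ := h.exists_reflections_aux hF ha hf hθ hfx hpos
    exact ⟨a, ha, c, hc, m, h2, h3, h4, Or.inl ⟨rfl, h5⟩⟩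
  · obtain ⟨c, hc, m, h2, h3, h4, h5⟩ := h.swap.exists_reflections_aux hF ha hf hθ hfx
      fun i hi => (hpos i hi).trans and_comm
    exact ⟨a, ha, c, hc, m, h2, h3, h4, Or.inr ⟨rfl, h5⟩⟩

lemma pairingIn_simple_eq_zero_iff {i j : ι} :
    P.pairingIn ℤ i j = 0 ↔ F (P.root i) (P.root j) = 0 := by
  have h1 := hF.two_mul_root j i
  have h2 := hF.ne_zero j
  constructor
  · intro h
    rw [h] at h1
    simpa using h1
  · intro h
    rw [h, mul_zero] at h1
    have := (mul_eq_zero.mp h1.symm).resolve_left h2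
    exact_mod_cast this

/-- The pairings of the weight `s_a s_c (m + ρ) - ρ` with the simple roots. -/
lemma simple_pairing_lt_zero_iff {a c i m : ι} (ha : a ∈ b.support) (hc : c ∈ b.support)
    (hac : a ≠ c) (hm : IsHighest b m) (hi : i ∈ b.support) :
    ∃ r : ℝ, F (P.root i) (P.reflection a (P.reflection c (P.root m + halfSum b)) - halfSum b) = r ∧
      (r < 0 ↔ i = a ∨ (i = c ∧ F (P.root a) (P.root c) = 0)) := by
  set w := P.reflection a (P.reflection c (P.root m + halfSum b)) - halfSum b with hw
  set p := fun x y => P.pairingIn ℤ x y with hp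
  have hpc : ∀ x y, P.coroot' y (P.root x) = (p x y : ℂ) := by
    intro x y
    rw [root_coroot'_eq_pairing, ← P.algebraMap_pairingIn ℤ]; simp [hp]
  -- `z` is the coroot value of the weight, expanded with the two reflection formulas and the value
  -- `1` of `ρ` on simple coroots. Its sign follows from `p m j ≥ 0` and from `p x y ≤ 0` for
  -- distinct simple roots.
  set z : ℤ := (p m i + 1) - (p m c + 1) * p c i - ((p m a + 1) - (p m c + 1) * p c a) * p a i - 1
    with hz
  have hzw : P.coroot' i w = (z : ℂ) := by
    rw [hw, hz]
    simp only [RootPairing.reflection_apply, map_sub, map_add, map_smul, smul_eq_mul, hpc,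
      coroot'_halfSum b ha, coroot'_halfSum b hc, coroot'_halfSum b hi]
    push_cast
    ring
  have hni := hF.ip_root_self_pos i
  have hdom : ∀ j ∈ b.support, 0 ≤ p m j := by
    intro j hj
    by_contra hcon
    push Not at hcon
    have := hF.pairingIn_neg_iff.mp hcon
    exact absurd (hF.isDominant_of_isHighest hm j hj) (not_le.mpr this)
  have hle : ∀ x ∈ b.support, ∀ y ∈ b.support, x ≠ y → p x y ≤ 0 := fun x hx y hy hxy =>
    b.pairingIn_le_zero_of_ne hxy hx hy
  have hsame : ∀ x, p x x = 2 := fun x => by simp [hp]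
  have hpac : p a c = 0 ↔ F (P.root a) (P.root c) = 0 := pairingIn_simple_eq_zero_iff hF
  have hpca : p c a = 0 ↔ F (P.root a) (P.root c) = 0 := by
    rw [hF.symm]; exact pairingIn_simple_eq_zero_iff hF
  refine ⟨ip F (P.root i) (P.root i) / 2 * z, ?_, ?_⟩
  · have h1 := hF.two_mul i w
    rw [hzw, hF.root_self_eq] at h1
    rw [hF.symm]
    push_cast
    linear_combination h1 / 2
  have hzr : ip F (P.root i) (P.root i) / 2 * z < 0 ↔ z < 0 := by
    rw [← Int.cast_lt (R := ℝ), Int.cast_zero]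
    constructor
    · intro h; by_contra h3; push Not at h3
      have : 0 ≤ ip F (P.root i) (P.root i) / 2 * z := by positivity
      linarith
    · intro h
      exact mul_neg_of_pos_of_neg (by linarith) h
  rw [hzr, ← hpac]
  have h1 := hdom a ha
  have h2 := hdom c hc
  have h3 := hdom i hi
  have h4 := hle c hc a ha hac.symm
  have h5 := hle a ha c hc hac
  by_cases hia : i = a
  · subst hia
    refine iff_of_true ?_ (Or.inl rfl)
    rw [hz, hsame]
    nlinarith
  by_cases hic : i = c
  · subst hic
    by_cases h0 : p a i = 0
    · refine iff_of_true ?_ (Or.inr ⟨rfl, h0⟩)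
      rw [hz, hsame, h0]
      nlinarith
    · refine iff_of_false ?_ (by simp [hia, h0])
      have h6 : p a i ≤ -1 := by lia
      have h7 : p i a ≤ -1 := by
        have : p i a ≠ 0 := fun h => h0 (hpac.mpr (hpca.mp h))
        lia
      rw [hz, hsame]
      push Not
      -- For `i = c` not orthogonal to `a`, this product compensates the negative contribution `-(p
      -- m c + 1)`.
      have h8 : 1 ≤ p a i * p i a := by nlinarith
      nlinarith
  · refine iff_of_false ?_ (by simp [hia, hic])
    have h6 := hle c hc i hi (Ne.symm hic)
    have h7 := hle a ha i hi (Ne.symm hia)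
    rw [hz]
    push Not
    have h8 : 0 ≤ (p m c + 1) * (-p c i) := mul_nonneg (by lia) (by lia)
    have h9 : 0 ≤ (p m a + 1) - (p m c + 1) * p c a := by nlinarith
    have h10 : 0 ≤ ((p m a + 1) - (p m c + 1) * p c a) * (-p a i) := mul_nonneg h9 (by lia)
    linarith

end RootForm

/-! ### The Kostant Laplacian as a Casimir operator. -/

namespace Parabolic

variable {𝔤 : Type*} [LieRing 𝔤] [LieAlgebra ℝ 𝔤] [Module.Finite ℝ 𝔤]
  {I J : Type*} [Fintype I] [Fintype J]

local notation "κ" => killingForm ℝ 𝔤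

variable (𝔤 I J) in
/-- Bases `X` of a subalgebra `N`, `y'` of a Levi complement and `Z` of an opposite nilradical,
with dual bases `Z`, `y` and `X` for the Killing form. -/
structure GradedFrame where
  X : I → 𝔤
  Z : I → 𝔤
  y : J → 𝔤
  y' : J → 𝔤
  N : Submodule ℝ 𝔤
  resolution : ∀ W, ∑ i, κ (Z i) W • X i + ∑ r, κ (y r) W • y' r + ∑ i, κ (X i) W • Z i = W
  X_mem : ∀ i, X i ∈ N
  lie_mem : ∀ {A B}, A ∈ N → B ∈ N → ⁅A, B⁆ ∈ N
  y_lie_mem : ∀ r {A}, A ∈ N → ⁅y r, A⁆ ∈ N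
  sum_of_mem : ∀ {W}, W ∈ N → ∑ i, κ (Z i) W • X i = W
  y_eq : ∀ r, ∑ s, κ (y s) (y r) • y' s = y r

lemma killing_lie (A B C : 𝔤) : κ ⁅A, B⁆ C = κ A ⁅B, C⁆ :=
  LieModule.traceForm_apply_lie_apply ℝ 𝔤 𝔤 A B C

lemma killing_comm (A B : 𝔤) : κ A B = κ B A := LieModule.traceForm_comm ℝ 𝔤 𝔤 A B

namespace GradedFrame

variable (S : GradedFrame 𝔤 I J)

/-- The projection to `N`. -/
def pm : 𝔤 →ₗ[ℝ] 𝔤 := ∑ i, (κ (S.Z i)).smulRight (S.X i)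
/-- The projection to the Levi complement. -/
def pz : 𝔤 →ₗ[ℝ] 𝔤 := ∑ r, (κ (S.y r)).smulRight (S.y' r)
/-- The projection to the opposite nilradical. -/
def pp : 𝔤 →ₗ[ℝ] 𝔤 := ∑ i, (κ (S.X i)).smulRight (S.Z i)

lemma pm_apply (W : 𝔤) : S.pm W = ∑ i, κ (S.Z i) W • S.X i := by simp [pm]
lemma pz_apply (W : 𝔤) : S.pz W = ∑ r, κ (S.y r) W • S.y' r := by simp [pz]
lemma pp_apply (W : 𝔤) : S.pp W = ∑ i, κ (S.X i) W • S.Z i := by simp [pp]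

lemma add_eq (W : 𝔤) : S.pm W + S.pz W + S.pp W = W := by
  rw [pm_apply, pz_apply, pp_apply, S.resolution]

lemma pm_of_mem {W : 𝔤} (hW : W ∈ S.N) : S.pm W = W := by rw [pm_apply, S.sum_of_mem hW]

/-- The element `∑ [X_i, Z^i]` of the center of the Levi subalgebra. -/
def delta : 𝔤 := ∑ i, ⁅S.X i, S.Z i⁆

section identities

variable {V : Type*} [AddCommGroup V] [Module ℝ V] (G : 𝔤 →ₗ[ℝ] 𝔤 →ₗ[ℝ] V)

lemma killing_Z_lie_Z (i j : I) (W : 𝔤) : κ ⁅S.Z i, S.Z j⁆ W = κ (S.Z j) ⁅W, S.Z i⁆ := by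
  rw [← lie_skew, map_neg, LinearMap.neg_apply, killing_lie, ← lie_skew, map_neg, neg_neg]

/-- By invariance, `κ([Z_i, Z_j], W)` is the `X_j`-coordinate of `[W, Z_i]`. This turns the double
sums of the codifferential into single sums with the projection to `N`. -/
lemma sum_killing_right (W : 𝔤) :
    ∑ i, ∑ j, κ ⁅S.Z i, S.Z j⁆ W • G (S.X i) (S.X j) = ∑ i, G (S.X i) (S.pm ⁅W, S.Z i⁆) := by
  refine Finset.sum_congr rfl fun i _ => ?_
  rw [pm_apply, map_sum]
  refine Finset.sum_congr rfl fun j _ => ?_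
  rw [map_smul, killing_Z_lie_Z]

lemma sum_killing_left (W : 𝔤) :
    ∑ i, ∑ j, κ ⁅S.Z i, S.Z j⁆ W • G (S.X i) (S.X j) = -∑ i, G (S.pm ⁅W, S.Z i⁆) (S.X i) := by
  rw [Finset.sum_comm, ← Finset.sum_neg_distrib]
  refine Finset.sum_congr rfl fun i _ => ?_
  rw [pm_apply, map_sum, LinearMap.sum_apply, ← Finset.sum_neg_distrib]
  refine Finset.sum_congr rfl fun j _ => ?_
  rw [map_smul, LinearMap.smul_apply, ← killing_Z_lie_Z, ← lie_skew, map_neg, LinearMap.neg_apply,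
    neg_smul]

lemma sum_pm_comm (W : 𝔤) :
    ∑ i, G (S.X i) (S.pm ⁅W, S.Z i⁆) = -∑ i, G (S.pm ⁅W, S.Z i⁆) (S.X i) := by
  rw [← sum_killing_right, sum_killing_left]

/-- Invariance of the Killing form exchanges the `Z_j`-coordinates of `[W, Z_i]` with the
`X_i`-coordinates of `[X_j, W]`. -/
lemma sum_pp {W : 𝔤} (hW : W ∈ S.N) :
    ∑ i, G (S.pp ⁅W, S.Z i⁆) (S.X i) = ∑ i, G (S.Z i) ⁅S.X i, W⁆ := by
  have h : ∀ i, G (S.Z i) ⁅S.X i, W⁆ =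
      ∑ j, κ (S.X i) ⁅W, S.Z j⁆ • G (S.Z i) (S.X j) := by
    intro i
    conv_lhs => rw [← S.sum_of_mem (S.lie_mem (S.X_mem i) hW)]
    rw [map_sum]
    refine Finset.sum_congr rfl fun j _ => ?_
    rw [map_smul, killing_comm, killing_lie]
  rw [Finset.sum_congr rfl fun i _ => h i, Finset.sum_comm]
  refine Finset.sum_congr rfl fun i _ => ?_
  rw [pp_apply, map_sum, LinearMap.sum_apply]
  refine Finset.sum_congr rfl fun j _ => ?_
  rw [map_smul, LinearMap.smul_apply]

lemma sum_pz {W : 𝔤} (hW : W ∈ S.N) :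
    ∑ i, G (S.pz ⁅W, S.Z i⁆) (S.X i) = ∑ r, G (S.y' r) ⁅S.y r, W⁆ := by
  have h : ∀ r, G (S.y' r) ⁅S.y r, W⁆ = ∑ i, κ (S.y r) ⁅W, S.Z i⁆ • G (S.y' r) (S.X i) := by
    intro r
    conv_lhs => rw [← S.sum_of_mem (S.y_lie_mem r hW)]
    rw [map_sum]
    refine Finset.sum_congr rfl fun i _ => ?_
    rw [map_smul, killing_comm, killing_lie]
  rw [Finset.sum_congr rfl fun i _ => h i, Finset.sum_comm]
  refine Finset.sum_congr rfl fun i _ => ?_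
  rw [pz_apply, map_sum, LinearMap.sum_apply]
  refine Finset.sum_congr rfl fun j _ => ?_
  rw [map_smul, LinearMap.smul_apply]

lemma sum_y_comm : ∑ r, G (S.y' r) (S.y r) = ∑ r, G (S.y r) (S.y' r) := by
  have h1 : ∀ r, G (S.y' r) (S.y r) = ∑ s, κ (S.y s) (S.y r) • G (S.y' r) (S.y' s) := by
    intro r
    conv_lhs => rw [← S.y_eq r]
    simp
  have h2 : ∀ r, G (S.y r) (S.y' r) = ∑ s, κ (S.y s) (S.y r) • G (S.y' s) (S.y' r) := by
    intro r
    conv_lhs => rw [← S.y_eq r]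
    simp
  rw [Finset.sum_congr rfl fun r _ => h1 r, Finset.sum_congr rfl fun r _ => h2 r, Finset.sum_comm]
  refine Finset.sum_congr rfl fun r _ => Finset.sum_congr rfl fun s _ => ?_
  rw [killing_comm]

end identities

lemma trace_eq (f : 𝔤 →ₗ[ℝ] 𝔤) :
    LinearMap.trace ℝ 𝔤 f = ∑ i, κ (S.Z i) (f (S.X i)) + ∑ r, κ (S.y r) (f (S.y' r)) +
      ∑ i, κ (S.X i) (f (S.Z i)) := by
  have h : f = ∑ i, (κ (S.Z i)).smulRight (f (S.X i)) + ∑ r, (κ (S.y r)).smulRight (f (S.y' r)) +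
      ∑ i, (κ (S.X i)).smulRight (f (S.Z i)) := by
    ext W
    conv_lhs => rw [← S.resolution W]
    simp
  conv_lhs => rw [h]
  simp [LinearMap.trace_smulRight]

/-- The Casimir operator of the Killing form acts on the adjoint representation by `1`. -/
lemma casimir_eq [LieAlgebra.IsKilling ℝ 𝔤] (A : 𝔤) :
    ∑ i, ⁅S.Z i, ⁅S.X i, A⁆⁆ + ∑ i, ⁅S.X i, ⁅S.Z i, A⁆⁆ + ∑ r, ⁅S.y' r, ⁅S.y r, A⁆⁆ = A := by
  rw [← sub_eq_zero]
  refine (LieAlgebra.IsKilling.killingForm_nondegenerate ℝ 𝔤).1 _ fun B => ?_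
  have key : ∀ P Q : 𝔤, κ ⁅P, ⁅Q, A⁆⁆ B = κ Q ⁅A, ⁅B, P⁆⁆ := by
    intro P Q
    rw [← lie_skew P, map_neg, LinearMap.neg_apply, killing_lie, killing_lie, ← map_neg,
      ← lie_neg, lie_skew]
  -- The Killing form is this trace. Evaluated in the frame, it is the pairing of the Casimir
  -- operator applied to `A` with `B`.
  have h := S.trace_eq (LieAlgebra.ad ℝ 𝔤 A ∘ₗ LieAlgebra.ad ℝ 𝔤 B)
  rw [← killingForm_apply_apply] at h
  have h2 : ∑ r, κ ⁅S.y' r, ⁅S.y r, A⁆⁆ B = ∑ r, κ (S.y r) ⁅A, ⁅B, S.y' r⁆⁆ :=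
    Finset.sum_congr rfl fun r _ => key _ _
  simp only [map_sub, map_add, map_sum, LinearMap.sub_apply, LinearMap.add_apply,
    LinearMap.sum_apply, key]
  rw [h]
  simp only [LinearMap.comp_apply, LieAlgebra.ad_apply]
  ring

/-- `∑ [X_i, [X, Z^i]_-]` in terms of the Casimir operator of the Levi subalgebra. -/
lemma sum_lie_pm {W : 𝔤} (hW : W ∈ S.N) :
    ∑ i, ⁅S.X i, S.pm ⁅W, S.Z i⁆⁆ = ∑ r, ⁅S.y' r, ⁅S.y r, W⁆⁆ - ⁅S.delta, W⁆ := by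
  let G : 𝔤 →ₗ[ℝ] 𝔤 →ₗ[ℝ] 𝔤 := (LieAlgebra.ad ℝ 𝔤 : 𝔤 →ₗ[ℝ] Module.End ℝ 𝔤)
  have hG : ∀ A B, G A B = ⁅A, B⁆ := fun A B => rfl
  have h1 := S.sum_pz G hW
  have h2 := S.sum_pp G hW
  simp only [hG] at h1 h2
  -- The projection to `N` is the identity minus the other two projections; their sums become a Levi
  -- Casimir and a term that combines with the first one into `δ` by the Jacobi identity.
  have h3 : ∀ i, ⁅S.X i, S.pm ⁅W, S.Z i⁆⁆ = ⁅S.X i, ⁅W, S.Z i⁆⁆ + ⁅S.pz ⁅W, S.Z i⁆, S.X i⁆ +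
      ⁅S.pp ⁅W, S.Z i⁆, S.X i⁆ := by
    intro i
    have := S.add_eq ⁅W, S.Z i⁆
    conv_rhs => rw [← lie_skew (S.pz _), ← lie_skew (S.pp _)]
    nth_rewrite 2 [← this]
    rw [lie_add, lie_add]
    abel
  have h4 : ∀ i, ⁅S.X i, ⁅W, S.Z i⁆⁆ + ⁅S.Z i, ⁅S.X i, W⁆⁆ = -⁅⁅S.X i, S.Z i⁆, W⁆ := by
    intro i
    have := lie_jacobi (S.X i) W (S.Z i)
    rw [lie_skew, ← lie_skew (S.X i) (S.Z i), lie_neg, eq_neg_iff_add_eq_zero, ← this]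
    abel
  rw [Finset.sum_congr rfl fun i _ => h3 i, Finset.sum_add_distrib, Finset.sum_add_distrib, h1, h2,
    add_right_comm, ← Finset.sum_add_distrib, Finset.sum_congr rfl fun i _ => h4 i, delta,
    sum_lie, Finset.sum_neg_distrib]
  abel

/-- The action of `A` on bilinear maps. -/
def act (A : 𝔤) (φ : 𝔤 →ₗ[ℝ] 𝔤 →ₗ[ℝ] 𝔤) (X Y : 𝔤) : 𝔤 :=
  ⁅A, φ X Y⁆ - φ ⁅A, X⁆ Y - φ X ⁅A, Y⁆

section laplacian

variable (φ : 𝔤 →ₗ[ℝ] 𝔤 →ₗ[ℝ] 𝔤)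

/-- The value part of the codifferential. -/
def cod (X : 𝔤) : 𝔤 := -∑ i, ⁅S.Z i, φ (S.X i) X⁆ -
  (2 : ℝ)⁻¹ • ∑ i, ∑ j, κ ⁅S.Z i, S.Z j⁆ X • φ (S.X i) (S.X j)

/-- The differential of a two-cochain. -/
def dif (X Y W : 𝔤) : 𝔤 :=
  ⁅X, φ Y W⁆ - ⁅Y, φ X W⁆ + ⁅W, φ X Y⁆ - φ ⁅X, Y⁆ W + φ ⁅X, W⁆ Y - φ ⁅Y, W⁆ X

/-- The Kostant Laplacian. -/
def lap (X Y : 𝔤) : 𝔤 :=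
  (⁅X, S.cod φ Y⁆ - ⁅Y, S.cod φ X⁆ - S.cod φ ⁅X, Y⁆) +
  (-∑ i, ⁅S.Z i, dif φ (S.X i) X Y⁆ - (2 : ℝ)⁻¹ • ∑ i, ∑ j,
    (κ ⁅S.Z i, S.Z j⁆ X • dif φ (S.X i) (S.X j) Y - κ ⁅S.Z i, S.Z j⁆ Y • dif φ (S.X i) (S.X j) X))

/-- The Casimir operator of the Levi subalgebra plus the action of `delta`. -/
def cas (X Y : 𝔤) : 𝔤 :=
  ∑ r, (⁅S.y' r, act (S.y r) φ X Y⁆ - act (S.y r) φ ⁅S.y' r, X⁆ Y - act (S.y r) φ X ⁅S.y' r, Y⁆) +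
    act S.delta φ X Y

variable {φ} (hφ : ∀ A, φ A A = 0) (hpm : ∀ A B, φ (S.pm A) B = φ A B)
include hφ hpm

lemma swap (A B : 𝔤) : φ A B = -φ B A := by
  have h := hφ (A + B)
  simp only [map_add, LinearMap.add_apply, hφ, zero_add, add_zero] at h
  exact eq_neg_of_add_eq_zero_right (by rw [add_comm] at h; rw [add_comm]; exact h)

/-- The terms of the Laplacian in which one argument and the value are transformed. -/
lemma mixed_terms {X Y : 𝔤} (hX : X ∈ S.N) :
    ∑ i, ⁅S.Z i, ⁅X, φ (S.X i) Y⁆⁆ - ∑ i, ⁅X, ⁅S.Z i, φ (S.X i) Y⁆⁆ +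
      ∑ i, ⁅S.Z i, φ ⁅S.X i, X⁆ Y⁆ -
      ∑ i, ∑ j, κ ⁅S.Z i, S.Z j⁆ X • ⁅S.X i, φ (S.X j) Y⁆ =
    -∑ r, ⁅S.y' r, φ ⁅S.y r, X⁆ Y⁆ := by
  let G : 𝔤 →ₗ[ℝ] 𝔤 →ₗ[ℝ] 𝔤 := LinearMap.mk₂ ℝ (fun A B => ⁅A, φ B Y⁆)
    (by simp) (by simp) (by simp) (by simp)
  have hG : ∀ A B, G A B = ⁅A, φ B Y⁆ := fun A B => rfl
  have h1 := S.sum_pz G hX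
  have h2 := S.sum_pp G hX
  have h3 := S.sum_killing_left G X
  simp only [hG] at h1 h2 h3
  rw [h3, ← h1, ← h2, ← Finset.sum_sub_distrib, ← Finset.sum_add_distrib, sub_neg_eq_add,
    ← Finset.sum_add_distrib, ← Finset.sum_neg_distrib]
  refine Finset.sum_congr rfl fun i _ => ?_
  have h4 := S.add_eq ⁅X, S.Z i⁆
  have h5 : ⁅S.Z i, ⁅X, φ (S.X i) Y⁆⁆ - ⁅X, ⁅S.Z i, φ (S.X i) Y⁆⁆ =
      -⁅⁅X, S.Z i⁆, φ (S.X i) Y⁆ := by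
    rw [lie_lie]; abel
  rw [h5]
  nth_rewrite 1 [← h4]
  rw [add_lie, add_lie]
  abel

lemma quadratic_term (X Y : 𝔤) :
    ∑ i, ∑ j, κ ⁅S.Z i, S.Z j⁆ X • φ ⁅S.X i, S.X j⁆ Y =
      φ (∑ i, ⁅S.X i, S.pm ⁅X, S.Z i⁆⁆) Y := by
  let G : 𝔤 →ₗ[ℝ] 𝔤 →ₗ[ℝ] 𝔤 := LinearMap.mk₂ ℝ (fun A B => φ ⁅A, B⁆ Y)
    (by simp) (by simp) (by simp) (by simp)
  have h3 := S.sum_killing_right G X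
  simp only [G, LinearMap.mk₂_apply] at h3
  rw [h3, map_sum, LinearMap.sum_apply]

/-- The terms of the Laplacian in which both arguments are transformed. -/
lemma argument_terms {X Y : 𝔤} (hX : X ∈ S.N) (hY : Y ∈ S.N) :
    ∑ i, ∑ j, κ ⁅S.Z i, S.Z j⁆ ⁅X, Y⁆ • φ (S.X i) (S.X j) -
      (2 : ℝ) • ∑ i, ∑ j, κ ⁅S.Z i, S.Z j⁆ X • φ ⁅S.X i, Y⁆ (S.X j) +
      (2 : ℝ) • ∑ i, ∑ j, κ ⁅S.Z i, S.Z j⁆ Y • φ ⁅S.X i, X⁆ (S.X j) =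
    ∑ r, φ ⁅S.y' r, X⁆ ⁅S.y r, Y⁆ + ∑ r, φ ⁅S.y r, X⁆ ⁅S.y' r, Y⁆ := by
  have hsw := S.swap hφ hpm
  let G : 𝔤 → 𝔤 →ₗ[ℝ] 𝔤 →ₗ[ℝ] 𝔤 := fun W => LinearMap.mk₂ ℝ (fun A B => φ ⁅A, W⁆ B)
    (by simp) (by simp) (by simp) (by simp)
  have hG : ∀ W A B, G W A B = φ ⁅A, W⁆ B := fun W A B => rfl
  have hz : ∀ {U W : 𝔤}, U ∈ S.N → ∑ i, φ ⁅S.pz ⁅U, S.Z i⁆, W⁆ (S.X i) =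
      ∑ r, φ ⁅S.y' r, W⁆ ⁅S.y r, U⁆ := fun {U W} hU => S.sum_pz (G W) hU
  -- The nilradical part for `U` is traded for the `N`-part for `W`, so that the `pp` and `pm` terms
  -- cancel and only Levi terms remain.
  have hp : ∀ {U W : 𝔤}, U ∈ S.N → ∑ i, φ ⁅S.pp ⁅U, S.Z i⁆, W⁆ (S.X i) =
      -∑ i, φ ⁅S.pm ⁅W, S.Z i⁆, U⁆ (S.X i) := by
    intro U W hU
    have h1 := S.sum_pp (G W) hU
    have h2 := S.sum_pm_comm (G U) W
    simp only [hG] at h1 h2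
    rw [h1, ← h2]
    refine Finset.sum_congr rfl fun i _ => ?_
    rw [← hpm, ← lie_skew, map_neg, map_neg, LinearMap.neg_apply, hsw, neg_neg]
  have hk : ∀ {U W : 𝔤}, ∑ i, ∑ j, κ ⁅S.Z i, S.Z j⁆ U • φ ⁅S.X i, W⁆ (S.X j) =
      -∑ i, φ ⁅S.pm ⁅U, S.Z i⁆, W⁆ (S.X i) := fun {U W} => S.sum_killing_left (G W) U
  have hq := S.sum_killing_left φ ⁅X, Y⁆
  have hq' : ∀ i, φ (S.pm ⁅⁅X, Y⁆, S.Z i⁆) (S.X i) =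
      (-(φ ⁅S.pm ⁅Y, S.Z i⁆, X⁆ (S.X i) + φ ⁅S.pz ⁅Y, S.Z i⁆, X⁆ (S.X i) +
        φ ⁅S.pp ⁅Y, S.Z i⁆, X⁆ (S.X i))) +
      (φ ⁅S.pm ⁅X, S.Z i⁆, Y⁆ (S.X i) + φ ⁅S.pz ⁅X, S.Z i⁆, Y⁆ (S.X i) +
        φ ⁅S.pp ⁅X, S.Z i⁆, Y⁆ (S.X i)) := by
    intro i
    rw [hpm, lie_lie, map_sub, LinearMap.sub_apply, ← lie_skew X ⁅Y, S.Z i⁆,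
      ← lie_skew Y ⁅X, S.Z i⁆, map_neg, map_neg,
      LinearMap.neg_apply, LinearMap.neg_apply, sub_neg_eq_add]
    nth_rewrite 1 [← S.add_eq ⁅Y, S.Z i⁆]
    nth_rewrite 1 [← S.add_eq ⁅X, S.Z i⁆]
    simp only [add_lie, map_add, LinearMap.add_apply]
  rw [hq, Finset.sum_congr rfl fun i _ => hq' i]
  simp only [Finset.sum_add_distrib, Finset.sum_neg_distrib, hk, hz hX, hz hY, hp hX, hp hY]
  have h5 : ∑ r, φ ⁅S.y r, X⁆ ⁅S.y' r, Y⁆ = -∑ r, φ ⁅S.y' r, Y⁆ ⁅S.y r, X⁆ := by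
    rw [← Finset.sum_neg_distrib]
    exact Finset.sum_congr rfl fun r _ => hsw _ _
  rw [h5]
  module

lemma cod_lie_sub (X Y : 𝔤) :
    (2 : ℝ) • (⁅X, S.cod φ Y⁆ - ⁅Y, S.cod φ X⁆ - S.cod φ ⁅X, Y⁆) =
      (-(2 : ℝ) • ∑ i, ⁅X, ⁅S.Z i, φ (S.X i) Y⁆⁆ -
        ∑ i, ∑ j, κ ⁅S.Z i, S.Z j⁆ Y • ⁅X, φ (S.X i) (S.X j)⁆) +
      ((2 : ℝ) • ∑ i, ⁅Y, ⁅S.Z i, φ (S.X i) X⁆⁆ +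
        ∑ i, ∑ j, κ ⁅S.Z i, S.Z j⁆ X • ⁅Y, φ (S.X i) (S.X j)⁆) +
      ((2 : ℝ) • ∑ i, ⁅S.Z i, φ (S.X i) ⁅X, Y⁆⁆ +
        ∑ i, ∑ j, κ ⁅S.Z i, S.Z j⁆ ⁅X, Y⁆ • φ (S.X i) (S.X j)) := by
  simp only [cod, lie_sub, lie_neg, lie_smul, lie_sum]
  module

/-- The coefficients are antisymmetric in `i, j`, so the terms of the differential exchanged by
swapping `X_i` and `X_j` coincide, whence the factors `2`. -/
lemma sum_dif (X Y : 𝔤) :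
    ∑ i, ∑ j, κ ⁅S.Z i, S.Z j⁆ X • dif φ (S.X i) (S.X j) Y =
      (2 : ℝ) • ∑ i, ∑ j, κ ⁅S.Z i, S.Z j⁆ X • ⁅S.X i, φ (S.X j) Y⁆ +
      ∑ i, ∑ j, κ ⁅S.Z i, S.Z j⁆ X • ⁅Y, φ (S.X i) (S.X j)⁆ -
      ∑ i, ∑ j, κ ⁅S.Z i, S.Z j⁆ X • φ ⁅S.X i, S.X j⁆ Y +
      (2 : ℝ) • ∑ i, ∑ j, κ ⁅S.Z i, S.Z j⁆ X • φ ⁅S.X i, Y⁆ (S.X j) := by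
  have hc : ∀ f : I → I → 𝔤, ∑ i, ∑ j, κ ⁅S.Z i, S.Z j⁆ X • f j i =
      -∑ i, ∑ j, κ ⁅S.Z i, S.Z j⁆ X • f i j := by
    intro f
    rw [Finset.sum_comm, ← Finset.sum_neg_distrib]
    refine Finset.sum_congr rfl fun i _ => ?_
    rw [← Finset.sum_neg_distrib]
    refine Finset.sum_congr rfl fun j _ => ?_
    rw [← lie_skew, map_neg, LinearMap.neg_apply, neg_smul]
  have h1 := hc fun i j => ⁅S.X i, φ (S.X j) Y⁆
  have h2 := hc fun i j => φ ⁅S.X i, Y⁆ (S.X j)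
  simp only [dif, smul_sub, smul_add, Finset.sum_add_distrib, Finset.sum_sub_distrib]
  rw [h1, h2]
  module

lemma sum_lie_dif (X Y : 𝔤) :
    ∑ i, ⁅S.Z i, dif φ (S.X i) X Y⁆ =
      ∑ i, ⁅S.Z i, ⁅S.X i, φ X Y⁆⁆ - ∑ i, ⁅S.Z i, ⁅X, φ (S.X i) Y⁆⁆ +
      ∑ i, ⁅S.Z i, ⁅Y, φ (S.X i) X⁆⁆ - ∑ i, ⁅S.Z i, φ ⁅S.X i, X⁆ Y⁆ +
      ∑ i, ⁅S.Z i, φ ⁅S.X i, Y⁆ X⁆ + ∑ i, ⁅S.Z i, φ (S.X i) ⁅X, Y⁆⁆ := by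
  have hsw := S.swap hφ hpm
  simp only [dif, lie_sub, lie_add, Finset.sum_add_distrib, Finset.sum_sub_distrib]
  have : ∑ i, ⁅S.Z i, φ ⁅X, Y⁆ (S.X i)⁆ = -∑ i, ⁅S.Z i, φ (S.X i) ⁅X, Y⁆⁆ := by
    rw [← Finset.sum_neg_distrib]
    refine Finset.sum_congr rfl fun i _ => ?_
    rw [hsw, lie_neg]
  rw [this]
  abel

/-- Commuting `X_i` past `Z_i` in the Casimir identity costs the action of `δ`. -/
lemma sum_lie_lie_eq [LieAlgebra.IsKilling ℝ 𝔤] (A : 𝔤) :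
    (2 : ℝ) • ∑ i, ⁅S.Z i, ⁅S.X i, A⁆⁆ = A - ∑ r, ⁅S.y' r, ⁅S.y r, A⁆⁆ - ⁅S.delta, A⁆ := by
  have h := S.casimir_eq A
  have h2 : ⁅S.delta, A⁆ = ∑ i, ⁅S.X i, ⁅S.Z i, A⁆⁆ - ∑ i, ⁅S.Z i, ⁅S.X i, A⁆⁆ := by
    rw [delta, sum_lie, ← Finset.sum_sub_distrib]
    exact Finset.sum_congr rfl fun i _ => lie_lie _ _ _
  rw [h2]
  nth_rewrite 2 [← h]
  module

/-- The tensor `∑ y' ⊗ y` is symmetric, so the terms acting once on the value and once on an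
argument occur in equal pairs. -/
lemma cas_eq (X Y : 𝔤) :
    S.cas φ X Y = ∑ r, ⁅S.y' r, ⁅S.y r, φ X Y⁆⁆ + ⁅S.delta, φ X Y⁆ -
      (2 : ℝ) • ∑ r, ⁅S.y' r, φ ⁅S.y r, X⁆ Y⁆ + (2 : ℝ) • ∑ r, ⁅S.y' r, φ ⁅S.y r, Y⁆ X⁆ +
      φ (∑ r, ⁅S.y' r, ⁅S.y r, X⁆⁆ - ⁅S.delta, X⁆) Y -
      φ (∑ r, ⁅S.y' r, ⁅S.y r, Y⁆⁆ - ⁅S.delta, Y⁆) X +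
      (∑ r, φ ⁅S.y' r, X⁆ ⁅S.y r, Y⁆ + ∑ r, φ ⁅S.y r, X⁆ ⁅S.y' r, Y⁆) := by
  have hsw := S.swap hφ hpm
  let G1 : 𝔤 → 𝔤 → 𝔤 →ₗ[ℝ] 𝔤 →ₗ[ℝ] 𝔤 := fun X Y => LinearMap.mk₂ ℝ (fun A B => ⁅A, φ ⁅B, X⁆ Y⁆)
    (by simp) (by simp) (by simp) (by simp)
  let G2 : 𝔤 → 𝔤 → 𝔤 →ₗ[ℝ] 𝔤 →ₗ[ℝ] 𝔤 := fun X Y => LinearMap.mk₂ ℝ (fun A B => φ ⁅A, ⁅B, X⁆⁆ Y)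
    (by simp) (by simp) (by simp) (by simp)
  have h1 : ∀ X Y, ∑ r, ⁅S.y' r, φ ⁅S.y r, X⁆ Y⁆ = ∑ r, ⁅S.y r, φ ⁅S.y' r, X⁆ Y⁆ :=
    fun X Y => S.sum_y_comm (G1 X Y)
  have h2 : ∀ X Y, ∑ r, φ ⁅S.y' r, ⁅S.y r, X⁆⁆ Y = ∑ r, φ ⁅S.y r, ⁅S.y' r, X⁆⁆ Y :=
    fun X Y => S.sum_y_comm (G2 X Y)
  have h3 : ∀ U : J → 𝔤, ∀ V : J → 𝔤, ∑ r, ⁅U r, φ X ⁅V r, Y⁆⁆ = -∑ r, ⁅U r, φ ⁅V r, Y⁆ X⁆ := by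
    intro U V
    rw [← Finset.sum_neg_distrib]
    exact Finset.sum_congr rfl fun r _ => by rw [hsw, lie_neg]
  simp only [cas, act, lie_sub, Finset.sum_sub_distrib, map_sub, map_sum, LinearMap.sub_apply,
    LinearMap.sum_apply, h3, h2]
  rw [← h1 X Y, ← h1 Y X, hsw X ⁅S.delta, Y⁆]
  have h4 : ∑ r, φ X ⁅S.y r, ⁅S.y' r, Y⁆⁆ = -∑ r, φ ⁅S.y r, ⁅S.y' r, Y⁆⁆ X := by
    rw [← Finset.sum_neg_distrib]
    exact Finset.sum_congr rfl fun r _ => hsw _ _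
  rw [h4]
  module

/-- The Kostant Laplacian in terms of the Casimir operator of the Levi subalgebra. -/
theorem two_smul_lap [LieAlgebra.IsKilling ℝ 𝔤] {X Y : 𝔤} (hX : X ∈ S.N) (hY : Y ∈ S.N) :
    (2 : ℝ) • S.lap φ X Y = S.cas φ X Y - φ X Y := by
  have hXX := S.mixed_terms hφ hpm (Y := Y) hX
  have hYY := S.mixed_terms hφ hpm (Y := X) hY
  have h3 := S.argument_terms hφ hpm hX hY
  have hqX := S.quadratic_term hφ hpm X Y
  have hqY := S.quadratic_term hφ hpm Y X
  rw [S.sum_lie_pm hX] at hqX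
  rw [S.sum_lie_pm hY] at hqY
  rw [lap, smul_add, S.cod_lie_sub hφ hpm]
  simp only [Finset.sum_sub_distrib]
  rw [S.sum_dif hφ hpm X Y, S.sum_dif hφ hpm Y X, S.sum_lie_dif hφ hpm X Y, S.cas_eq hφ hpm,
    ← h3, ← hqX, ← hqY]
  have h5 := S.sum_lie_lie_eq hφ hpm (φ X Y)
  linear_combination (norm := module) (2 : ℝ) • hXX - (2 : ℝ) • hYY - h5

end laplacian

end GradedFrame
end Parabolic

/-! ### The grading element, and the dual frame of the grading. -/

namespace Parabolic

section GradingElement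

variable {𝔤 : Type*} [LieRing 𝔤] [LieAlgebra ℝ 𝔤] {ι : Type*} [Fintype ι]
  (D : SimpleRestrictedRoots 𝔤 ι) (Ξ : Set ι)

lemma exists_gradingElement [Module.Finite ℝ 𝔤] :
    ∃ E : D.𝔞, ∀ j, D.simple j E = Ξ.indicator 1 j := by
  let f := (Module.Basis.span D.linearIndependent).constr ℝ (Ξ.indicator 1 : ι → ℝ)
  obtain ⟨g, hg⟩ := LinearMap.exists_extend f
  obtain ⟨E, hE⟩ := (Module.evalEquiv ℝ D.𝔞).surjective g
  refine ⟨E, fun j => ?_⟩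
  have h1 : g (D.simple j) = Ξ.indicator 1 j := by
    have h2 := LinearMap.congr_fun hg (Module.Basis.span D.linearIndependent j)
    rw [Module.Basis.constr_basis] at h2
    rw [← h2, LinearMap.comp_apply, Submodule.subtype_apply, Module.Basis.span_apply]
  rw [← h1, ← hE, Module.evalEquiv_apply, Module.Dual.eval_apply]

variable [Module.Finite ℝ 𝔤]

/-- An element of `𝔞` whose adjoint action induces the grading by `Ξ`-heights. -/
def gradingElement : D.𝔞 := (exists_gradingElement D Ξ).choose

lemma simple_gradingElement (j : ι) : D.simple j (gradingElement D Ξ) = Ξ.indicator 1 j :=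
  (exists_gradingElement D Ξ).choose_spec j

lemma gradedPiece_le (k : ℤ) :
    gradedPiece D Ξ k ≤
      Module.End.eigenspace (LieAlgebra.ad ℝ 𝔤 (gradingElement D Ξ : 𝔤)) (k : ℝ) := by
  refine iSup_le fun n x hx => ?_
  obtain ⟨n, rfl⟩ := n
  rw [Module.End.mem_eigenspace_iff, LieAlgebra.ad_apply, hx]
  change _ = ((∑ j, Ξ.indicator n j : ℤ) : ℝ) • x
  congr 1
  rw [LinearMap.sum_apply]
  push_cast
  refine Finset.sum_congr rfl fun j _ => ?_
  rw [LinearMap.smul_apply, simple_gradingElement]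
  by_cases h : j ∈ Ξ <;> simp [h]

/-- The graded pieces lie in eigenspaces, which are independent, and they span `𝔤`; so each piece
fills its eigenspace. -/
lemma gradedPiece_eq (k : ℤ) :
    gradedPiece D Ξ k =
      Module.End.eigenspace (LieAlgebra.ad ℝ 𝔤 (gradingElement D Ξ : 𝔤)) (k : ℝ) := by
  refine le_antisymm (gradedPiece_le D Ξ k) ?_
  set e := Module.End.eigenspace (LieAlgebra.ad ℝ 𝔤 (gradingElement D Ξ : 𝔤)) with he
  have hind := Module.End.eigenspaces_iSupIndep (LieAlgebra.ad ℝ 𝔤 (gradingElement D Ξ : 𝔤))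
  have h1 : e k ⊓ ⨆ l : {l : ℤ // l ≠ k}, gradedPiece D Ξ l = ⊥ := by
    rw [eq_bot_iff, ← (hind (k : ℝ)).eq_bot]
    refine inf_le_inf le_rfl (iSup_le fun l => ?_)
    refine (gradedPiece_le D Ξ l).trans ?_
    exact le_iSup₂_of_le (l.1 : ℝ) (by exact_mod_cast l.2) le_rfl
  have h2 : gradedPiece D Ξ k ⊔ ⨆ l : {l : ℤ // l ≠ k}, gradedPiece D Ξ l = ⊤ := by
    rw [eq_top_iff, ← iSup_gradedPiece D Ξ]
    refine iSup_le fun l => ?_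
    by_cases h : l = k
    · rw [h]; exact le_sup_left
    · exact le_sup_of_le_right (le_iSup (fun l : {l : ℤ // l ≠ k} => gradedPiece D Ξ l) ⟨l, h⟩)
  -- The modular law, applied to a complement of the piece that meets the eigenspace trivially.
  have h3 := sup_inf_assoc_of_le (⨆ l : {l : ℤ // l ≠ k}, gradedPiece D Ξ l) (gradedPiece_le D Ξ k)
  rw [h2, top_inf_eq, inf_comm, h1, sup_bot_eq] at h3
  exact h3.le

lemma mem_gradedPiece_iff {k : ℤ} {x : 𝔤} :
    x ∈ gradedPiece D Ξ k ↔ ⁅(gradingElement D Ξ : 𝔤), x⁆ = (k : ℝ) • x := by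
  rw [gradedPiece_eq, Module.End.mem_eigenspace_iff, LieAlgebra.ad_apply]

lemma mem_gZero_iff {x : 𝔤} : x ∈ gZero D Ξ ↔ ⁅(gradingElement D Ξ : 𝔤), x⁆ = 0 := by
  have := mem_gradedPiece_iff D Ξ (k := 0) (x := x)
  rw [Int.cast_zero, zero_smul] at this
  exact this

end GradingElement

section Frame

variable {𝔤 : Type*} [LieRing 𝔤] [LieAlgebra ℝ 𝔤] [Module.Finite ℝ 𝔤] {ι : Type*} [Fintype ι]
  (D : SimpleRestrictedRoots 𝔤 ι) (Ξ : Set ι)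

lemma killingForm_eq_zero_of_mem_iSup {p : ℤ → Prop} {k : ℤ} (h : ∀ l, p l → k + l ≠ 0)
    {x y : 𝔤} (hx : x ∈ gradedPiece D Ξ k) (hy : y ∈ ⨆ l : {l : ℤ // p l}, gradedPiece D Ξ l) :
    killingForm ℝ 𝔤 y x = 0 := by
  induction hy using Submodule.iSup_induction' with
  | zero => simp
  | add a b _ _ ha hb => simp [ha, hb]
  | mem l a ha =>
    rw [killing_comm]
    exact killingForm_gradedPiece D (h l l.2) hx ha

lemma gradedPiece_le_gMinus {k : ℤ} (hk : k < 0) {x : 𝔤} (hx : x ∈ gradedPiece D Ξ k) :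
    x ∈ gMinus D Ξ :=
  Submodule.mem_iSup_of_mem (p := fun k : {k : ℤ // k < 0} => gradedPiece D Ξ k) ⟨k, hk⟩ hx

variable [LieAlgebra.IsKilling ℝ 𝔤]

lemma eq_zero_of_killingForm {x : 𝔤} (h : ∀ k, ∀ y ∈ gradedPiece D Ξ k, killingForm ℝ 𝔤 x y = 0) :
    x = 0 := by
  refine (LieAlgebra.IsKilling.killingForm_nondegenerate ℝ 𝔤).1 x fun y => ?_
  have hy : y ∈ ⨆ k, gradedPiece D Ξ k := by rw [iSup_gradedPiece]; trivial
  induction hy using Submodule.iSup_induction' with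
  | zero => simp
  | add a b _ _ ha hb => rw [map_add, ha, hb, add_zero]
  | mem k a ha => exact h k a ha

/-- The restriction of the Killing form to `𝔤_{Ξ,0}`. -/
def zeroForm : LinearMap.BilinForm ℝ (gradedPiece D Ξ 0) :=
  LinearMap.BilinForm.restrict (killingForm ℝ 𝔤) (gradedPiece D Ξ 0)

lemma zeroForm_apply (x y : gradedPiece D Ξ 0) :
    zeroForm D Ξ x y = killingForm ℝ 𝔤 (x : 𝔤) (y : 𝔤) := rfl

lemma zeroForm_nondegenerate : (zeroForm D Ξ).Nondegenerate := by
  have hs : ∀ x : gradedPiece D Ξ 0, (∀ y, zeroForm D Ξ x y = 0) → x = 0 := by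
    intro x hx
    refine Subtype.ext (eq_zero_of_killingForm D Ξ fun k y hy => ?_)
    by_cases hk : k = 0
    · subst hk
      exact hx ⟨y, hy⟩
    · exact killingForm_gradedPiece D (by simpa using hk) x.2 hy
  refine ⟨hs, fun y hy => hs y fun x => ?_⟩
  rw [zeroForm_apply, killing_comm, ← zeroForm_apply, hy]

/-- A basis of `𝔤_{Ξ,0}`. -/
def zeroBasis : Module.Basis (Fin (Module.finrank ℝ (gradedPiece D Ξ 0))) ℝ (gradedPiece D Ξ 0) :=
  Module.finBasis ℝ _

/-- The dual basis of `𝔤_{Ξ,0}` for the Killing form. -/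
def zeroDualBasis :
    Module.Basis (Fin (Module.finrank ℝ (gradedPiece D Ξ 0))) ℝ (gradedPiece D Ξ 0) :=
  LinearMap.BilinForm.dualBasis (zeroForm D Ξ) (zeroForm_nondegenerate D Ξ) (zeroBasis D Ξ)

lemma sum_zeroBasis (x : gradedPiece D Ξ 0) :
    ∑ r, killingForm ℝ 𝔤 (zeroDualBasis D Ξ r : 𝔤) (x : 𝔤) • (zeroBasis D Ξ r : 𝔤) = x := by
  have h : ∀ r, killingForm ℝ 𝔤 (zeroDualBasis D Ξ r : 𝔤) (x : 𝔤) = (zeroBasis D Ξ).repr x r := by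
    intro r
    rw [← zeroForm_apply]
    conv_lhs => rw [← (zeroBasis D Ξ).sum_repr x]
    simp only [map_sum, map_smul, zeroDualBasis, LinearMap.BilinForm.apply_dualBasis_left]
    simp
  have h2 := congrArg (Submodule.subtype _) ((zeroBasis D Ξ).sum_repr x)
  simp only [map_sum, map_smul, Submodule.subtype_apply] at h2
  simp only [h]
  exact h2

lemma sum_minusBasis {x : 𝔤} (hx : x ∈ gMinus D Ξ) :
    ∑ i, killingForm ℝ 𝔤 (plusBasis D Ξ i) x • (minusBasis D Ξ i : 𝔤) = x := by
  have := congrArg (Submodule.subtype _) ((minusBasis D Ξ).sum_repr ⟨x, hx⟩)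
  simp only [map_sum, map_smul, Submodule.subtype_apply] at this
  conv_rhs => rw [← this]
  exact Finset.sum_congr rfl fun i _ => by
    rw [killingForm_plusBasis D Ξ i ⟨x, hx⟩]; rfl

lemma killingForm_plusBasis_eq_zero {k : ℤ} (hk : 0 ≤ k) {x : 𝔤} (hx : x ∈ gradedPiece D Ξ k)
    (i) : killingForm ℝ 𝔤 (plusBasis D Ξ i) x = 0 :=
  killingForm_eq_zero_of_mem_iSup D Ξ (p := fun l => 0 < l) (fun l hl => by lia) hx
    (plusBasis_mem D Ξ i)

lemma killingForm_minusBasis_eq_zero {k : ℤ} (hk : k ≤ 0) {x : 𝔤} (hx : x ∈ gradedPiece D Ξ k)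
    (i) : killingForm ℝ 𝔤 (minusBasis D Ξ i : 𝔤) x = 0 :=
  killingForm_eq_zero_of_mem_iSup D Ξ (p := fun l => l < 0) (fun l hl => by lia) hx
    (minusBasis D Ξ i).2

lemma killingForm_zeroDualBasis_eq_zero {k : ℤ} (hk : k ≠ 0) {x : 𝔤}
    (hx : x ∈ gradedPiece D Ξ k) (r) : killingForm ℝ 𝔤 (zeroDualBasis D Ξ r : 𝔤) x = 0 :=
  killingForm_gradedPiece D (by simpa using hk) (zeroDualBasis D Ξ r).2 hx

lemma sum_plusBasis {k : ℤ} (hk : 0 < k) {x : 𝔤} (hx : x ∈ gradedPiece D Ξ k) :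
    ∑ i, killingForm ℝ 𝔤 (minusBasis D Ξ i : 𝔤) x • plusBasis D Ξ i = x := by
  rw [← sub_eq_zero]
  refine eq_zero_of_killingForm D Ξ fun l y hy => ?_
  by_cases hl : l < 0
  · have h := sum_minusBasis D Ξ (gradedPiece_le_gMinus D Ξ hl hy)
    rw [map_sub, LinearMap.sub_apply, sub_eq_zero]
    conv_rhs => rw [← h]
    simp only [map_sum, map_smul, LinearMap.sum_apply, LinearMap.smul_apply]
    exact Finset.sum_congr rfl fun i _ => by
      rw [smul_eq_mul, smul_eq_mul, mul_comm, killing_comm (minusBasis D Ξ i : 𝔤)]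
  · rw [map_sub, LinearMap.sub_apply, killingForm_gradedPiece D (by lia) hx hy, sub_zero]
    simp only [map_sum, map_smul, LinearMap.sum_apply, LinearMap.smul_apply]
    exact Finset.sum_eq_zero fun i _ => by
      rw [killingForm_plusBasis_eq_zero D Ξ (by lia) hy, smul_zero]

/-- The frame of `𝔤 = 𝔤_{Ξ,-} ⊕ 𝔤_{Ξ,0} ⊕ 𝔭_{Ξ,+}` given by the chosen bases. -/
def frame : GradedFrame 𝔤 (Fin (Module.finrank ℝ (gMinus D Ξ)))
    (Fin (Module.finrank ℝ (gradedPiece D Ξ 0))) where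
  X i := minusBasis D Ξ i
  Z i := plusBasis D Ξ i
  y r := zeroDualBasis D Ξ r
  y' r := zeroBasis D Ξ r
  N := (gMinus D Ξ).toSubmodule
  resolution W := by
    have hy : W ∈ ⨆ k, gradedPiece D Ξ k := by rw [iSup_gradedPiece]; trivial
    induction hy using Submodule.iSup_induction' with
    | zero => simp
    | add a b _ _ ha hb =>
      simp only [map_add, add_smul, Finset.sum_add_distrib]
      conv_rhs => rw [← ha, ← hb]
      abel
    | mem k a ha =>
      rcases lt_trichotomy k 0 with hk | hk | hk
      · simp only [killingForm_zeroDualBasis_eq_zero D Ξ hk.ne ha,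
          killingForm_minusBasis_eq_zero D Ξ hk.le ha, zero_smul, Finset.sum_const_zero, add_zero]
        exact sum_minusBasis D Ξ (gradedPiece_le_gMinus D Ξ hk ha)
      · subst hk
        simp only [killingForm_plusBasis_eq_zero D Ξ le_rfl ha,
          killingForm_minusBasis_eq_zero D Ξ le_rfl ha, zero_smul, Finset.sum_const_zero,
          add_zero, zero_add]
        exact sum_zeroBasis D Ξ ⟨a, ha⟩
      · simp only [killingForm_zeroDualBasis_eq_zero D Ξ hk.ne' ha,
          killingForm_plusBasis_eq_zero D Ξ hk.le ha, zero_smul, Finset.sum_const_zero, zero_add]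
        exact sum_plusBasis D Ξ hk ha
  X_mem i := (minusBasis D Ξ i).2
  lie_mem hA hB := lie_mem_gMinus D hA hB
  y_lie_mem r _ hA := lie_mem_iSup_neg D le_rfl (zeroDualBasis D Ξ r).2 hA
  sum_of_mem hW := sum_minusBasis D Ξ hW
  y_eq r := sum_zeroBasis D Ξ (zeroDualBasis D Ξ r)

/-- The projection to `𝔤_{Ξ,-}` along `𝔭_Ξ`. -/
def minusProj : 𝔤 →ₗ[ℝ] gMinus D Ξ :=
  ∑ i, (killingForm ℝ 𝔤 (plusBasis D Ξ i)).smulRight (minusBasis D Ξ i)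

lemma coe_minusProj (x : 𝔤) : (minusProj D Ξ x : 𝔤) = (frame D Ξ).pm x := by
  rw [GradedFrame.pm_apply]
  simp [minusProj, frame]

lemma minusProj_coe (x : gMinus D Ξ) : minusProj D Ξ (x : 𝔤) = x :=
  Subtype.ext (by rw [coe_minusProj]; exact (frame D Ξ).pm_of_mem x.2)

lemma minusProj_of_nonneg {k : ℤ} (hk : 0 ≤ k) {x : 𝔤} (hx : x ∈ gradedPiece D Ξ k) :
    minusProj D Ξ x = 0 := by
  simp [minusProj, killingForm_plusBasis_eq_zero D Ξ hk hx]

lemma minusProj_lie (A : gZero D Ξ) (x : 𝔤) :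
    minusProj D Ξ ⁅(A : 𝔤), x⁆ = ⁅A, minusProj D Ξ x⁆ := by
  have hy : x ∈ ⨆ k, gradedPiece D Ξ k := by rw [iSup_gradedPiece]; trivial
  induction hy using Submodule.iSup_induction' with
  | zero => simp
  | add a b _ _ ha hb => rw [lie_add, map_add, map_add, ha, hb, lie_add]
  | mem k a ha =>
    have h1 : ⁅(A : 𝔤), a⁆ ∈ gradedPiece D Ξ k := by
      simpa using lie_mem_gradedPiece D (show (A : 𝔤) ∈ gradedPiece D Ξ 0 from A.2) ha
    by_cases hk : k < 0
    · have h2 := minusProj_coe D Ξ ⟨a, gradedPiece_le_gMinus D Ξ hk ha⟩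
      have h3 := minusProj_coe D Ξ ⟨_, gradedPiece_le_gMinus D Ξ hk h1⟩
      dsimp only at h2 h3
      rw [h2, h3]
      rfl
    · rw [minusProj_of_nonneg D Ξ (by lia) h1, minusProj_of_nonneg D Ξ (by lia) ha, lie_zero]

/-- The extension of a cochain to `𝔤` by zero on `𝔭_Ξ`. -/
def extend : BilinearCochain D Ξ →ₗ[ℝ] 𝔤 →ₗ[ℝ] 𝔤 →ₗ[ℝ] 𝔤 where
  toFun φ := φ.compl₁₂ (minusProj D Ξ) (minusProj D Ξ)
  map_add' _ _ := rfl
  map_smul' _ _ := rfl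

variable {D Ξ}

@[simp]
lemma extend_apply (φ : BilinearCochain D Ξ) (x y : 𝔤) :
    extend D Ξ φ x y = φ (minusProj D Ξ x) (minusProj D Ξ y) := rfl

lemma extend_coe (φ : BilinearCochain D Ξ) (x y : gMinus D Ξ) :
    extend D Ξ φ x y = φ x y := by
  rw [extend_apply, minusProj_coe, minusProj_coe]

lemma lie_extend (A : gZero D Ξ) (φ : BilinearCochain D Ξ) (x y : 𝔤) :
    extend D Ξ ⁅A, φ⁆ x y = ⁅(A : 𝔤), extend D Ξ φ x y⁆ - extend D Ξ φ ⁅(A : 𝔤), x⁆ y -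
      extend D Ξ φ x ⁅(A : 𝔤), y⁆ := by
  simp only [extend_apply, LieHom.lie_apply, LinearMap.sub_apply, minusProj_lie]
  rw [sub_right_comm]
  rfl

lemma laplacian_eq (φ : BilinearCochain D Ξ) (x y : gMinus D Ξ) :
    laplacian (fun A B => φ A B) x y = (frame D Ξ).lap (extend D Ξ φ) x y := by
  have hb : ∀ x y : gMinus D Ξ, minusProj D Ξ ⁅(x : 𝔤), (y : 𝔤)⁆ = minusBracket D x y :=
    fun x y => minusProj_coe D Ξ (minusBracket D x y)
  simp only [laplacian, diff₁, diff₂, codiff₂, codiff₃, GradedFrame.lap, GradedFrame.cod,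
    GradedFrame.dif, frame, extend_apply, minusProj_coe, hb]
  rfl

/-- Since `2□ = cas - 1`, the kernel of the Laplacian is the fixed space of the corrected Casimir
operator. -/
lemma harmonic_iff (φ : BilinearCochain D Ξ) : φ ∈ harmonicSpace D Ξ ↔
    φ.IsAlt ∧ ∀ x y : gMinus D Ξ, (frame D Ξ).cas (extend D Ξ φ) x y = φ x y := by
  refine and_congr_right fun hφ => forall₂_congr fun x y => ?_
  have h := (frame D Ξ).two_smul_lap (φ := extend D Ξ φ) (fun A => hφ _)
    (fun A B => by rw [extend_apply, ← coe_minusProj, minusProj_coe, extend_apply])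
    (X := x) (Y := y) x.2 y.2
  rw [← laplacian_eq, extend_coe] at h
  rw [← sub_eq_zero (a := (frame D Ξ).cas _ _ _), ← h, smul_eq_zero_iff_right two_ne_zero]

end Frame
end Parabolic

/-! ### Invariance of the Casimir operator and the action on harmonic cochains. -/

namespace Parabolic

section Tensor

variable {K L V I J : Type*} [Field K] [LieRing L] [LieAlgebra K L] [Module.Finite K L]
  [LieAlgebra.IsKilling K L] [AddCommGroup V] [Module K V] [Fintype I] [Fintype J]

/-- A tensor `∑ a_i ⊗ b_i` is determined by the endomorphism `x ↦ ∑ κ(a_i, x) b_i`. -/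
lemma sum_bilin_eq_zero {a b : I → L} (h : ∀ x, ∑ i, killingForm K L (a i) x • b i = 0)
    (G : L →ₗ[K] L →ₗ[K] V) : ∑ i, G (a i) (b i) = 0 := by
  let e := Module.finBasis K L
  let hn := LieAlgebra.IsKilling.killingForm_nondegenerate K L
  let d := LinearMap.BilinForm.dualBasis (killingForm K L) hn e
  have hd : ∀ x, ∑ k, killingForm K L x (e k) • d k = x := by
    intro x
    have h1 : ∀ k, killingForm K L x (e k) = d.repr x k := by
      intro k
      conv_lhs => rw [← d.sum_repr x]
      simp only [d, map_sum, map_smul, LinearMap.sum_apply, LinearMap.smul_apply,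
        LinearMap.BilinForm.apply_dualBasis_left]
      simp
    simp only [h1]
    exact d.sum_repr x
  have h2 : ∀ i, G (a i) (b i) = ∑ k, G (d k) (killingForm K L (a i) (e k) • b i) := by
    intro i
    conv_lhs => rw [← hd (a i)]
    simp
  simp_rw [h2]
  rw [Finset.sum_comm]
  refine Finset.sum_eq_zero fun k _ => ?_
  rw [← map_sum, h, map_zero]

/-- Allows Casimir-type sums to be rewritten from the chosen real frame to a basis of weight
vectors. -/
lemma sum_bilin_eq_sum_bilin {a b : I → L} {c d : J → L}
    (h : ∀ x, ∑ i, killingForm K L (a i) x • b i = ∑ j, killingForm K L (c j) x • d j)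
    (G : L →ₗ[K] L →ₗ[K] V) : ∑ i, G (a i) (b i) = ∑ j, G (c j) (d j) := by
  have h1 := sum_bilin_eq_zero (a := Sum.elim a c) (b := Sum.elim b fun j => -d j)
    (by intro x; simp [Fintype.sum_sum_type, h x]) G
  simpa [Fintype.sum_sum_type, ← sub_eq_add_neg, sub_eq_zero] using h1

/-- An endomorphism commuting with `ad A` corresponds to a tensor annihilated by `A`. -/
lemma sum_bilin_lie_eq_zero {a b : I → L} {A : L}
    (h : ∀ x, ∑ i, killingForm K L (a i) ⁅A, x⁆ • b i = ⁅A, ∑ i, killingForm K L (a i) x • b i⁆)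
    (G : L →ₗ[K] L →ₗ[K] V) : ∑ i, (G ⁅A, a i⁆ (b i) + G (a i) ⁅A, b i⁆) = 0 := by
  have h1 := sum_bilin_eq_zero (a := Sum.elim (fun i => ⁅A, a i⁆) a)
    (b := Sum.elim b fun i => ⁅A, b i⁆) (by
      intro x
      have h2 : ∀ i, killingForm K L ⁅A, a i⁆ x = -killingForm K L (a i) ⁅A, x⁆ := by
        intro i
        rw [← lie_skew, map_neg, LinearMap.neg_apply]
        exact congrArg Neg.neg (LieModule.traceForm_apply_lie_apply K L L (a i) A x)
      have h3 := h x
      simp only [lie_sum, lie_smul] at h3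
      simp [Fintype.sum_sum_type, h2, h3]) G
  rw [Finset.sum_add_distrib]
  simpa [Fintype.sum_sum_type] using h1

end Tensor

section Harmonic

variable {𝔤 : Type*} [LieRing 𝔤] [LieAlgebra ℝ 𝔤] [Module.Finite ℝ 𝔤] [LieAlgebra.IsKilling ℝ 𝔤]
  {ι : Type*} [Fintype ι] (D : SimpleRestrictedRoots 𝔤 ι) (Ξ : Set ι)

lemma lie_extend' (A : gZero D Ξ) (φ : BilinearCochain D Ξ) :
    extend D Ξ ⁅A, φ⁆ = ⁅(A : 𝔤), extend D Ξ φ⁆ := by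
  ext x y
  rw [lie_extend]
  simp only [LieHom.lie_apply, LinearMap.sub_apply]
  rw [sub_right_comm]

lemma extend_injective : Function.Injective (extend D Ξ) := by
  intro φ ψ h
  ext x y
  rw [← extend_coe, h, extend_coe]

/-- The sum of the Casimir operator of `𝔤_{Ξ,0}` and the action of `delta`. -/
def casOp (w : 𝔤 →ₗ[ℝ] 𝔤 →ₗ[ℝ] 𝔤) : 𝔤 →ₗ[ℝ] 𝔤 →ₗ[ℝ] 𝔤 :=
  ∑ r, ⁅(zeroBasis D Ξ r : 𝔤), ⁅(zeroDualBasis D Ξ r : 𝔤), w⁆⁆ +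
    ⁅∑ i, ⁅(minusBasis D Ξ i : 𝔤), plusBasis D Ξ i⁆, w⁆

lemma cas_apply (w : 𝔤 →ₗ[ℝ] 𝔤 →ₗ[ℝ] 𝔤) (x y : 𝔤) :
    (frame D Ξ).cas w x y = casOp D Ξ w x y := by
  have h : ∀ (A : 𝔤) (w : 𝔤 →ₗ[ℝ] 𝔤 →ₗ[ℝ] 𝔤) (x y : 𝔤),
      GradedFrame.act A w x y = ⁅A, w⁆ x y := by
    intro A w x y
    simp only [GradedFrame.act, LieHom.lie_apply, LinearMap.sub_apply]
    rw [sub_right_comm]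
  simp only [GradedFrame.cas, h, casOp, LinearMap.add_apply, LinearMap.sum_apply]
  congr 1
  refine Finset.sum_congr rfl fun r _ => ?_
  rw [← h]
  simp only [GradedFrame.act, ← h]
  rfl

lemma minusProj_lie' {A : 𝔤} (hA : A ∈ gZero D Ξ) (x : 𝔤) :
    (minusProj D Ξ ⁅A, x⁆ : 𝔤) = ⁅A, (minusProj D Ξ x : 𝔤)⁆ := by
  rw [minusProj_lie D Ξ ⟨A, hA⟩]
  rfl

lemma pz_of_zero {x : 𝔤} (hx : x ∈ gradedPiece D Ξ 0) : (frame D Ξ).pz x = x := by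
  rw [GradedFrame.pz_apply]
  exact sum_zeroBasis D Ξ ⟨x, hx⟩

lemma pz_of_ne_zero {k : ℤ} (hk : k ≠ 0) {x : 𝔤} (hx : x ∈ gradedPiece D Ξ k) :
    (frame D Ξ).pz x = 0 := by
  rw [GradedFrame.pz_apply]
  exact Finset.sum_eq_zero fun r _ => by
    rw [show (frame D Ξ).y r = zeroDualBasis D Ξ r from rfl,
      killingForm_zeroDualBasis_eq_zero D Ξ hk hx, zero_smul]

lemma pz_lie {A : 𝔤} (hA : A ∈ gZero D Ξ) (x : 𝔤) :
    (frame D Ξ).pz ⁅A, x⁆ = ⁅A, (frame D Ξ).pz x⁆ := by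
  have hy : x ∈ ⨆ k, gradedPiece D Ξ k := by rw [iSup_gradedPiece]; trivial
  induction hy using Submodule.iSup_induction' with
  | zero => simp
  | add a b _ _ ha hb => rw [lie_add, map_add, map_add, ha, hb, lie_add]
  | mem k a ha =>
    have h1 : ⁅A, a⁆ ∈ gradedPiece D Ξ k := by
      simpa using lie_mem_gradedPiece D (show A ∈ gradedPiece D Ξ 0 from hA) ha
    by_cases hk : k = 0
    · subst hk
      rw [pz_of_zero D Ξ ha, pz_of_zero D Ξ h1]
    · rw [pz_of_ne_zero D Ξ hk ha, pz_of_ne_zero D Ξ hk h1, lie_zero]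

/-- The projections to `𝔤_{Ξ,0}` and `𝔤_{Ξ,-}` commute with `ad A`, so the tensors behind the
Casimir operator and behind `δ` are annihilated by `A`. -/
lemma casOp_lie {A : 𝔤} (hA : A ∈ gZero D Ξ) (w : 𝔤 →ₗ[ℝ] 𝔤 →ₗ[ℝ] 𝔤) :
    casOp D Ξ ⁅A, w⁆ = ⁅A, casOp D Ξ w⁆ := by
  let G : 𝔤 →ₗ[ℝ] 𝔤 →ₗ[ℝ] (𝔤 →ₗ[ℝ] 𝔤 →ₗ[ℝ] 𝔤) := LinearMap.mk₂ ℝ (fun a b => ⁅b, ⁅a, w⁆⁆)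
    (by simp) (by simp) (by simp) (by simp)
  let G' : 𝔤 →ₗ[ℝ] 𝔤 →ₗ[ℝ] 𝔤 := LinearMap.mk₂ ℝ (fun a b => ⁅b, a⁆)
    (by simp) (by simp) (by simp) (by simp)
  have h1 := sum_bilin_lie_eq_zero (a := fun r => (zeroDualBasis D Ξ r : 𝔤))
    (b := fun r => (zeroBasis D Ξ r : 𝔤)) (A := A) (fun x => by
      have := pz_lie D Ξ hA x
      rw [GradedFrame.pz_apply, GradedFrame.pz_apply] at this
      exact this) G
  have h2 := sum_bilin_lie_eq_zero (a := plusBasis D Ξ)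
    (b := fun i => (minusBasis D Ξ i : 𝔤)) (A := A) (fun x => by
      have := minusProj_lie' D Ξ hA x
      rw [coe_minusProj, coe_minusProj, GradedFrame.pm_apply, GradedFrame.pm_apply] at this
      exact this) G'
  have h3 : ⁅A, ∑ i, ⁅(minusBasis D Ξ i : 𝔤), plusBasis D Ξ i⁆⁆ = 0 := by
    rw [lie_sum, ← h2]
    refine Finset.sum_congr rfl fun i _ => ?_
    simp only [G', LinearMap.mk₂_apply]
    rw [leibniz_lie, add_comm]
  have h4 : ∑ r, ⁅(zeroBasis D Ξ r : 𝔤), ⁅(zeroDualBasis D Ξ r : 𝔤), ⁅A, w⁆⁆⁆ =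
      ∑ r, ⁅A, ⁅(zeroBasis D Ξ r : 𝔤), ⁅(zeroDualBasis D Ξ r : 𝔤), w⁆⁆⁆ := by
    rw [← sub_eq_zero, ← Finset.sum_sub_distrib, ← neg_eq_zero, ← Finset.sum_neg_distrib, ← h1]
    refine Finset.sum_congr rfl fun i _ => ?_
    simp only [G, LinearMap.mk₂_apply]
    rw [leibniz_lie A, leibniz_lie A (zeroDualBasis D Ξ i : 𝔤), lie_add]
    abel
  rw [casOp, casOp, lie_add, lie_sum, h4, leibniz_lie A, h3, zero_lie, zero_add]

lemma delta_mem : ∑ i, ⁅(minusBasis D Ξ i : 𝔤), plusBasis D Ξ i⁆ ∈ gZero D Ξ := by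
  let G' : 𝔤 →ₗ[ℝ] 𝔤 →ₗ[ℝ] 𝔤 := LinearMap.mk₂ ℝ (fun a b => ⁅b, a⁆)
    (by simp) (by simp) (by simp) (by simp)
  have hE : (gradingElement D Ξ : 𝔤) ∈ gZero D Ξ := by
    rw [mem_gZero_iff, lie_self]
  have h2 := sum_bilin_lie_eq_zero (a := plusBasis D Ξ)
    (b := fun i => (minusBasis D Ξ i : 𝔤)) (fun x => by
      have := minusProj_lie' D Ξ hE x
      rw [coe_minusProj, coe_minusProj, GradedFrame.pm_apply, GradedFrame.pm_apply] at this
      exact this) G'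
  rw [mem_gZero_iff, lie_sum, ← h2]
  refine Finset.sum_congr rfl fun i _ => ?_
  simp only [G', LinearMap.mk₂_apply]
  rw [leibniz_lie, add_comm]

/-- The Casimir operator involves only elements of `𝔤_{Ξ,0}`, hence maps extended cochains to
extended cochains. So equality on `𝔤_{Ξ,-}` suffices for equality on all of `𝔤`. -/
lemma mem_harmonicSpace_iff (φ : BilinearCochain D Ξ) : φ ∈ harmonicSpace D Ξ ↔
    φ.IsAlt ∧ casOp D Ξ (extend D Ξ φ) = extend D Ξ φ := by
  rw [harmonic_iff]
  refine and_congr_right fun hφ => ⟨fun h => ?_, fun h x y => ?_⟩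
  · let ψ : BilinearCochain D Ξ := ∑ r, ⁅(⟨zeroBasis D Ξ r, (zeroBasis D Ξ r).2⟩ : gZero D Ξ),
        ⁅(⟨zeroDualBasis D Ξ r, (zeroDualBasis D Ξ r).2⟩ : gZero D Ξ), φ⁆⁆ +
        ⁅(⟨_, delta_mem D Ξ⟩ : gZero D Ξ), φ⁆
    have h1 : casOp D Ξ (extend D Ξ φ) = extend D Ξ ψ := by
      simp only [ψ, map_add, map_sum, lie_extend', casOp]
    rw [h1]
    congr 1
    ext x y
    rw [← extend_coe, ← h1, ← cas_apply, h]
  · rw [cas_apply, h, extend_coe]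

lemma lie_mem_harmonicSpace (A : gZero D Ξ) {φ : BilinearCochain D Ξ}
    (hφ : φ ∈ harmonicSpace D Ξ) : ⁅A, φ⁆ ∈ harmonicSpace D Ξ := by
  rw [mem_harmonicSpace_iff] at hφ ⊢
  refine ⟨fun x => ?_, ?_⟩
  · have h1 := hφ.1 (x + ⁅A, x⁆)
    simp only [map_add, LinearMap.add_apply, hφ.1 x, hφ.1 ⁅A, x⁆, zero_add, add_zero] at h1
    simp only [LieHom.lie_apply, LinearMap.sub_apply, hφ.1 x, lie_zero, zero_sub]
    rw [← neg_add', add_comm, h1, neg_zero]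
  · rw [lie_extend', casOp_lie D Ξ A.2, hφ.2]

end Harmonic
end Parabolic

/-! ### Weight spaces, dual bases of weight vectors and the form on weights. -/

namespace CartanWeight

open LieAlgebra LieAlgebra.IsKilling LieModule

variable {L : Type*} [LieRing L] [LieAlgebra ℂ L] {H : LieSubalgebra ℂ L}
  {M : Type*} [AddCommGroup M] [Module ℂ M] [LieRingModule L M] [LieModule ℂ L M]

variable (M) in
/-- The simultaneous eigenspace of `H` on a module. -/
def wtSpace (χ : Module.Dual ℂ H) : Submodule ℂ M where
  carrier := {m | ∀ h : H, ⁅(h : L), m⁆ = χ h • m}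
  add_mem' := by
    intro x y hx hy h
    rw [lie_add, hx h, hy h, smul_add]
  zero_mem' := by
    intro h
    simp
  smul_mem' := by
    intro c x hx h
    rw [lie_smul, hx h, smul_comm]

lemma lie_mem_wtSpace {χ ψ : Module.Dual ℂ H} {x : L} {m : M} (hx : x ∈ wtSpace L χ)
    (hm : m ∈ wtSpace M ψ) : ⁅x, m⁆ ∈ wtSpace M (χ + ψ) := by
  intro h
  rw [leibniz_lie, hx h, hm h, smul_lie, lie_smul, LinearMap.add_apply, add_smul]

lemma apply_mem_wtSpace {χ ψ φ : Module.Dual ℂ H} {w : L →ₗ[ℂ] L →ₗ[ℂ] L} {x y : L}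
    (hw : w ∈ wtSpace (L →ₗ[ℂ] L →ₗ[ℂ] L) χ) (hx : x ∈ wtSpace L ψ) (hy : y ∈ wtSpace L φ) :
    w x y ∈ wtSpace L (χ + ψ + φ) := by
  intro h
  have h1 := congrArg (fun f => f x y) (hw h)
  simp only [LieHom.lie_apply, LinearMap.sub_apply, LinearMap.smul_apply, hx h, hy h, map_smul]
    at h1
  rw [sub_sub, sub_eq_iff_eq_add] at h1
  rw [h1, LinearMap.add_apply, LinearMap.add_apply]
  module

/-- The weight components of an element of an `H`-stable submodule belong to the submodule. -/
lemma mem_of_sum_mem {N : Submodule ℂ M} (hN : ∀ h : H, ∀ x ∈ N, ⁅(h : L), x⁆ ∈ N)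
    (s : Finset (Module.Dual ℂ H)) (f : Module.Dual ℂ H → M) (hf : ∀ χ ∈ s, f χ ∈ wtSpace M χ)
    (hs : ∑ χ ∈ s, f χ ∈ N) : ∀ χ ∈ s, f χ ∈ N := by
  classical
  induction s using Finset.induction_on generalizing f with
  | empty => simp
  | insert χ₀ s hχ ih =>
    have h1 : ∀ χ ∈ s, f χ ∈ N := by
      intro χ hχs
      have hne : χ - χ₀ ≠ 0 := sub_ne_zero.mpr fun h => hχ (h ▸ hχs)
      obtain ⟨h, hh⟩ : ∃ h, (χ - χ₀) h ≠ 0 := by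
        by_contra! hcon
        exact hne (LinearMap.ext hcon)
      -- Applying `h - χ₀(h)` kills the `χ₀`-component and rescales the others, the `χ`-component by
      -- a nonzero factor.
      have h2 := ih (fun ψ => (ψ - χ₀) h • f ψ)
        (fun ψ hψ => Submodule.smul_mem _ _ (hf ψ (Finset.mem_insert_of_mem hψ))) (by
          have h3 := sub_mem (hN h _ hs) (N.smul_mem (χ₀ h) hs)
          rw [lie_sum, Finset.smul_sum, ← Finset.sum_sub_distrib,
            Finset.sum_insert hχ, hf χ₀ (Finset.mem_insert_self _ _) h, sub_self, zero_add] at h3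
          convert h3 using 1
          refine Finset.sum_congr rfl fun ψ hψ => ?_
          rw [hf ψ (Finset.mem_insert_of_mem hψ) h, LinearMap.sub_apply, sub_smul]) χ hχs
      exact (N.smul_mem_iff hh).mp h2
    intro χ hχ'
    rcases Finset.mem_insert.mp hχ' with rfl | h
    · rw [Finset.sum_insert hχ] at hs
      exact (N.add_mem_iff_left (N.sum_mem fun ψ hψ => h1 ψ hψ)).mp hs
    · exact h1 χ h

lemma exists_sum_of_mem_iSup {I : Type*} (χ : I → Module.Dual ℂ H) {m : M}
    (hm : m ∈ ⨆ i, wtSpace M (χ i)) : ∃ (s : Finset (Module.Dual ℂ H)) (f : Module.Dual ℂ H → M),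
      (∀ ψ ∈ s, f ψ ∈ wtSpace M ψ) ∧ (∀ ψ ∈ s, ψ ∈ Set.range χ) ∧ ∑ ψ ∈ s, f ψ = m := by
  classical
  have h1 : m ∈ ⨆ ψ : Set.range χ, wtSpace M (ψ : Module.Dual ℂ H) := by
    rwa [iSup_range']
  rw [Submodule.mem_iSup_iff_exists_finsupp] at h1
  obtain ⟨f, hf, hs⟩ := h1
  refine ⟨f.support.image Subtype.val,
    fun ψ => if h : ψ ∈ Set.range χ then f ⟨ψ, h⟩ else 0, ?_, ?_, ?_⟩
  · intro ψ hψ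
    dsimp only
    split_ifs with h
    · exact hf ⟨ψ, h⟩
    · exact zero_mem _
  · intro ψ hψ
    obtain ⟨φ, -, rfl⟩ := Finset.mem_image.mp hψ
    exact φ.2
  · rw [Finset.sum_image fun a _ b _ h => Subtype.ext h, ← hs]
    refine Finset.sum_congr rfl fun ψ _ => ?_
    simp

/-- The `H`-stable submodules are spanned by weight vectors. -/
lemma le_iSup_inf_wtSpace {N : Submodule ℂ M} (hN : ∀ h : H, ∀ x ∈ N, ⁅(h : L), x⁆ ∈ N)
    (htop : ⨆ χ : Module.Dual ℂ H, wtSpace M χ = ⊤) :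
    N ≤ ⨆ χ : Module.Dual ℂ H, N ⊓ wtSpace M χ := by
  intro x hx
  obtain ⟨s, f, h1, -, h2⟩ := exists_sum_of_mem_iSup (fun χ : Module.Dual ℂ H => χ) (m := x)
    (by rw [htop]; trivial)
  rw [← h2]
  refine Submodule.sum_mem _ fun χ hχ => Submodule.mem_iSup_of_mem χ ⟨?_, h1 χ hχ⟩
  exact mem_of_sum_mem hN s f h1 (h2 ▸ hx) χ hχ

/-- A weight vector in a sum of weight spaces is zero unless its weight occurs. -/
lemma exists_eq_of_mem_iSup {I : Type*} (χ : I → Module.Dual ℂ H) {ψ : Module.Dual ℂ H} {m : M}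
    (hm : m ∈ ⨆ i, wtSpace M (χ i)) (h0 : m ≠ 0) (hψ : m ∈ wtSpace M ψ) : ∃ i, χ i = ψ := by
  classical
  obtain ⟨s, f, h1, h2, h3⟩ := exists_sum_of_mem_iSup χ hm
  by_contra hcon
  have hs : ψ ∉ s := fun h => hcon (h2 ψ h)
  have h4 := mem_of_sum_mem (N := ⊥) (L := L) (by simp) (insert ψ s)
    (fun φ => if φ = ψ then -m else f φ) (by
      intro φ hφ
      split_ifs with h
      · rw [h]; exact neg_mem hψ
      · exact h1 φ ((Finset.mem_insert.mp hφ).resolve_left h)) (by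
      rw [Finset.sum_insert hs, if_pos rfl, Finset.sum_congr rfl fun φ hφ =>
        if_neg (show φ ≠ ψ from fun h => hs (h ▸ hφ)), h3, neg_add_cancel]
      exact zero_mem _) ψ (Finset.mem_insert_self _ _)
  rw [if_pos rfl] at h4
  exact h0 (by simpa using h4)

lemma finite_weights [Module.Finite ℂ M] :
    {χ : Module.Dual ℂ H | wtSpace M χ ≠ ⊥}.Finite := by
  have hind : iSupIndep fun χ : Module.Dual ℂ H => wtSpace M χ := by
    intro χ
    rw [disjoint_iff, eq_bot_iff]
    rintro m ⟨h1, h2⟩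
    by_contra h0
    have h3 : (⨆ ψ, ⨆ (_ : ψ ≠ χ), wtSpace M ψ) =
        ⨆ ψ : {ψ : Module.Dual ℂ H // ψ ≠ χ}, wtSpace M ψ.1 := by
      rw [iSup_subtype]
    obtain ⟨i, hi⟩ := exists_eq_of_mem_iSup _ (h3 ▸ h2) h0 h1
    exact i.2 hi
  exact WellFoundedGT.finite_ne_bot_of_iSupIndep hind

variable [Module.Finite ℂ L] [LieAlgebra.IsKilling ℂ L] [H.IsCartanSubalgebra]

lemma mem_wtSpace_iff {χ : Module.Dual ℂ H} {x : L} : x ∈ wtSpace L χ ↔ x ∈ rootSpace H χ := by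
  constructor
  · intro h
    refine weightSpace_le_genWeightSpace L (χ : H → ℂ) ?_
    rw [LieModule.mem_weightSpace]
    exact h
  · exact fun h => lie_eq_smul_of_mem_rootSpace h

lemma mem_wtSpace_zero_iff {x : L} : x ∈ wtSpace L (0 : Module.Dual ℂ H) ↔ x ∈ H := by
  rw [mem_wtSpace_iff]
  change x ∈ rootSpace H (0 : H → ℂ) ↔ x ∈ H
  simp

lemma killingForm_wtSpace {χ ψ : Module.Dual ℂ H} {x y : L} (hx : x ∈ wtSpace L χ)
    (hy : y ∈ wtSpace L ψ) (h : χ + ψ ≠ 0) : killingForm ℂ L x y = 0 := by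
  refine killingForm_apply_eq_zero_of_mem_rootSpace_of_add_ne_zero ℂ L H (mem_wtSpace_iff.mp hx)
    (mem_wtSpace_iff.mp hy) fun h1 => h (LinearMap.ext fun a => congrFun h1 a)

lemma eq_zero_or_mem_range {χ : Module.Dual ℂ H} {x : L} (hx : x ∈ wtSpace L χ) (h0 : x ≠ 0) :
    χ = 0 ∨ χ ∈ Set.range (rootSystem H).root := by
  by_cases hχ : χ = 0
  · exact Or.inl hχ
  right
  rw [mem_wtSpace_iff] at hx
  let α : Weight ℂ H L := ⟨χ, fun h => h0 (by
    rw [← LieSubmodule.mem_bot (R := ℂ) (L := H), ← h]; exact hx)⟩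
  have hα : α.IsNonZero := fun h => hχ (LinearMap.ext fun a => congrFun h a)
  refine ⟨⟨α, by simpa [LieSubalgebra.root] using hα⟩, ?_⟩
  rw [rootSystem_root_apply]
  exact LinearMap.ext fun a => rfl

lemma iSup_wtSpace_eq_top : ⨆ χ : Module.Dual ℂ H, wtSpace L χ = ⊤ := by
  have h := LieModule.iSup_genWeightSpace_eq_top' ℂ H L
  rw [eq_top_iff, ← LieSubmodule.iSup_toSubmodule_eq_top.mpr h]
  refine iSup_le fun α => ?_
  refine le_trans (fun x hx => ?_) (le_iSup _ (Weight.toLinear ℂ H L α))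
  exact mem_wtSpace_iff.mpr hx

/-- A generator of the root space. -/
lemma exists_root_pair (α : H.root) : ∃ e f : L, e ∈ wtSpace L ((rootSystem H).root α) ∧
    f ∈ wtSpace L (-(rootSystem H).root α) ∧ killingForm ℂ L f e = 1 := by
  obtain ⟨e, he, he0⟩ := α.1.exists_ne_zero
  have h2 : ∃ f ∈ rootSpace H (-(α.1 : H → ℂ)), killingForm ℂ L e f ≠ 0 := by
    by_contra! hcon
    have := mem_ker_killingForm_of_mem_rootSpace_of_forall_rootSpace_neg ℂ L H he hcon
    rw [ker_killingForm_eq_bot] at this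
    exact he0 this
  obtain ⟨f, hf, hef⟩ := h2
  refine ⟨e, (killingForm ℂ L e f)⁻¹ • f, mem_wtSpace_iff.mpr he,
    Submodule.smul_mem _ _ (mem_wtSpace_iff.mpr hf), ?_⟩
  rw [map_smul, LinearMap.smul_apply, LieModule.traceForm_comm ℂ L L f e]
  exact inv_mul_cancel₀ hef

variable (H)

/-- The index set of a basis of weight vectors. -/
abbrev FrameIndex : Type _ := Fin (Module.finrank ℂ H) ⊕ H.root

/-- A basis of `H`. -/
def cartanBasis : Module.Basis (Fin (Module.finrank ℂ H)) ℂ H := Module.finBasis ℂ H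

/-- The dual basis of `H`. -/
def cartanDualBasis : Module.Basis (Fin (Module.finrank ℂ H)) ℂ H :=
  LinearMap.BilinForm.dualBasis (traceForm ℂ H L) (traceForm_cartan_nondegenerate ℂ L H)
    (cartanBasis H)

/-- A basis of weight vectors. -/
def vec : FrameIndex H → L := Sum.elim (fun i => cartanBasis H i) fun α => (exists_root_pair α).choose

/-- The dual basis of weight vectors. -/
def dualVec : FrameIndex H → L :=
  Sum.elim (fun i => cartanDualBasis H i) fun α => (exists_root_pair α).choose_spec.choose

/-- The weights of the basis of weight vectors. -/
def wt : FrameIndex H → Module.Dual ℂ H := Sum.elim 0 (rootSystem H).root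

lemma coe_mem_wtSpace (h : H) : (h : L) ∈ wtSpace L (0 : Module.Dual ℂ H) :=
  mem_wtSpace_zero_iff.mpr h.2

lemma vec_mem (k : FrameIndex H) : vec H k ∈ wtSpace L (wt H k) := by
  cases k with
  | inl i => exact coe_mem_wtSpace H _
  | inr α => exact (exists_root_pair α).choose_spec.choose_spec.1

lemma dualVec_mem (k : FrameIndex H) : dualVec H k ∈ wtSpace L (-wt H k) := by
  cases k with
  | inl i =>
    have : -wt H (Sum.inl i) = 0 := by simp [wt]
    rw [this]
    exact coe_mem_wtSpace H _
  | inr α => exact (exists_root_pair α).choose_spec.choose_spec.2.1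

lemma killingForm_dualVec_root (α : H.root) :
    killingForm ℂ L (dualVec H (Sum.inr α)) (vec H (Sum.inr α)) = 1 :=
  (exists_root_pair α).choose_spec.choose_spec.2.2

lemma sum_cartanBasis (x : H) :
    ∑ i, traceForm ℂ H L (cartanDualBasis H i) x • cartanBasis H i = x := by
  have h : ∀ i, traceForm ℂ H L (cartanDualBasis H i) x = (cartanBasis H).repr x i := by
    intro i
    conv_lhs => rw [← (cartanBasis H).sum_repr x]
    simp only [map_sum, map_smul, cartanDualBasis, LinearMap.BilinForm.apply_dualBasis_left]
    simp
  simp only [h]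
  exact (cartanBasis H).sum_repr x

lemma wt_inr_ne_zero (α : H.root) : wt H (Sum.inr α) ≠ 0 := (rootSystem H).ne_zero α

lemma mem_rootSpace_of_mem_wtSpace {α : H.root} {x : L}
    (hx : x ∈ wtSpace L ((rootSystem H).root α)) : x ∈ rootSpace H α.1 := by
  rw [mem_wtSpace_iff, rootSystem_root_apply] at hx
  exact hx

lemma exists_eq_smul (α : H.root) {e x : L} (he : e ∈ wtSpace L ((rootSystem H).root α))
    (he0 : e ≠ 0) (hx : x ∈ wtSpace L ((rootSystem H).root α)) : ∃ c : ℂ, x = c • e := by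
  have h := finrank_rootSpace_eq_one α.1 (LieSubalgebra.isNonZero_coe_root α)
  obtain ⟨c, hc⟩ := (finrank_eq_one_iff_of_nonzero'
    (⟨e, mem_rootSpace_of_mem_wtSpace H he⟩ : rootSpace H α.1)
    (fun h => he0 (congrArg Subtype.val h))).mp h ⟨x, mem_rootSpace_of_mem_wtSpace H hx⟩
  exact ⟨c, (congrArg Subtype.val hc).symm⟩

lemma sum_vec (x : L) : ∑ k, killingForm ℂ L (dualVec H k) x • vec H k = x := by
  have hx : x ∈ ⨆ χ : Module.Dual ℂ H, wtSpace L χ := by rw [iSup_wtSpace_eq_top]; trivial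
  induction hx using Submodule.iSup_induction' with
  | zero => simp
  | add a b _ _ ha hb =>
    simp only [map_add, add_smul, Finset.sum_add_distrib]
    rw [ha, hb]
  | mem χ x hx =>
    by_cases h0 : x = 0
    · simp [h0]
    rw [Fintype.sum_sum_type]
    rcases eq_zero_or_mem_range hx h0 with rfl | ⟨α, rfl⟩
    · have h1 : ∀ α, killingForm ℂ L (dualVec H (Sum.inr α)) x = 0 := fun α =>
        killingForm_wtSpace (dualVec_mem H _) hx (by
          rw [add_zero, neg_ne_zero]; exact wt_inr_ne_zero H α)
      simp only [h1, zero_smul, Finset.sum_const_zero, add_zero]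
      have h2 := congrArg (Submodule.subtype _)
        (sum_cartanBasis H ⟨x, mem_wtSpace_zero_iff.mp hx⟩)
      simp only [map_sum, map_smul, Submodule.subtype_apply] at h2
      exact h2
    · have h1 : ∀ i, killingForm ℂ L (dualVec H (Sum.inl i)) x = 0 := fun α =>
        killingForm_wtSpace (dualVec_mem H _) hx (by
          simp [wt])
      simp only [h1, zero_smul, Finset.sum_const_zero, zero_add]
      have h2 : ∀ β ≠ α, killingForm ℂ L (dualVec H (Sum.inr β)) x = 0 := fun β hβ =>
        killingForm_wtSpace (dualVec_mem H _) hx fun h => hβ ((rootSystem H).root.injective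
          (neg_add_eq_zero.mp h))
      rw [Finset.sum_eq_single α (fun β _ hβ => by rw [h2 β hβ, zero_smul]) (by simp)]
      have h3 : ∃ c : ℂ, x = c • vec H (Sum.inr α) := by
        have h5 : vec H (Sum.inr α) ≠ 0 := by
          intro h
          have := killingForm_dualVec_root H α
          rw [h, map_zero] at this
          exact zero_ne_one this
        exact exists_eq_smul H α (vec_mem H (Sum.inr α)) h5 hx
      obtain ⟨c, rfl⟩ := h3
      rw [map_smul, killingForm_dualVec_root, smul_eq_mul, mul_one]

/-- Products of dual weight vectors with a weight vector span the bilinear maps and are weight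
vectors themselves. -/
lemma iSup_wtSpace_bilin_eq_top :
    ⨆ χ : Module.Dual ℂ H, wtSpace (L →ₗ[ℂ] L →ₗ[ℂ] L) χ = ⊤ := by
  rw [eq_top_iff]
  rintro w -
  let e : FrameIndex H → FrameIndex H → FrameIndex H → L →ₗ[ℂ] L →ₗ[ℂ] L := fun i j k =>
    (killingForm ℂ L (dualVec H i)).smulRight ((killingForm ℂ L (dualVec H j)).smulRight (vec H k))
  have he : ∀ i j k, e i j k ∈ wtSpace (L →ₗ[ℂ] L →ₗ[ℂ] L) (wt H k - wt H i - wt H j) := by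
    intro i j k h
    have hk : ∀ i x, killingForm ℂ L (dualVec H i) ⁅(h : L), x⁆ =
        wt H i h * killingForm ℂ L (dualVec H i) x := by
      intro i x
      have h1 := LieModule.traceForm_apply_lie_apply ℂ L L (dualVec H i) (h : L) x
      have h2 := dualVec_mem H i h
      rw [← lie_skew, h2] at h1
      rw [killingForm, ← h1]
      simp
    ext x y
    simp only [LieHom.lie_apply, LinearMap.sub_apply, LinearMap.smul_apply, e,
      LinearMap.smulRight_apply, hk, lie_smul, vec_mem H k h]
    module
  have hw : w = ∑ i, ∑ j, ∑ k, killingForm ℂ L (dualVec H k) (w (vec H i) (vec H j)) • e i j k := by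
    ext x y
    conv_lhs => rw [← sum_vec H x, ← sum_vec H y]
    simp only [map_sum, map_smul, LinearMap.sum_apply, LinearMap.smul_apply, e,
      LinearMap.smulRight_apply]
    simp only [Finset.smul_sum]
    rw [Finset.sum_comm]
    refine Finset.sum_congr rfl fun i _ => Finset.sum_congr rfl fun j _ => ?_
    conv_lhs => rw [← sum_vec H (w (vec H i) (vec H j))]
    rw [Finset.smul_sum, Finset.smul_sum]
    refine Finset.sum_congr rfl fun k _ => ?_
    module
  rw [hw]
  exact Submodule.sum_mem _ fun i _ => Submodule.sum_mem _ fun j _ => Submodule.sum_mem _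
    fun k _ => Submodule.smul_mem _ _ (Submodule.mem_iSup_of_mem _ (he i j k))

/-- The form on weights induced by the Killing form. -/
def dualForm : Module.Dual ℂ H →ₗ[ℂ] Module.Dual ℂ H →ₗ[ℂ] ℂ :=
  (LinearMap.flip .id).comp (cartanEquivDual H).symm.toLinearMap |>.flip

lemma dualForm_apply (x y : Module.Dual ℂ H) :
    dualForm H x y = x ((cartanEquivDual H).symm y) := rfl

lemma dualForm_eq_traceForm (x y : Module.Dual ℂ H) :
    dualForm H x y = traceForm ℂ H L ((cartanEquivDual H).symm x) ((cartanEquivDual H).symm y) := by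
  rw [dualForm_apply]
  conv_lhs => rw [← (cartanEquivDual H).apply_symm_apply x]
  rfl

lemma isDualKillingForm : RootForm.IsDualKillingForm (rootSystem H) (dualForm H) where
  symm x y := by
    rw [dualForm_eq_traceForm, dualForm_eq_traceForm, traceForm_comm]
  two_mul α x := by
    have h1 := root_apply_cartanEquivDual_symm_ne_zero (LieSubalgebra.isNonZero_coe_root α)
    have h2 : (rootSystem H).coroot' α x = x (coroot α.1) := rfl
    have h3 : dualForm H ((rootSystem H).root α) ((rootSystem H).root α) =
      α.1 ((cartanEquivDual H).symm α.1) := rfl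
    rw [h2, h3, coroot, map_nsmul, map_smul, dualForm_apply, rootSystem_root_apply]
    simp only [smul_eq_mul, nsmul_eq_mul]
    field_simp
    push_cast
    ring
  eq_sum x y := by
    have h := congrArg (fun f => f ((cartanEquivDual H).symm x) ((cartanEquivDual H).symm y))
      (restrict_killingForm_eq_sum (K := ℂ) (L := L) (H := H))
    have h1 : ∀ x (α : H.root), dualForm H x ((rootSystem H).root α) =
        α.1 ((cartanEquivDual H).symm x) := by
      intro x α
      rw [dualForm_eq_traceForm, traceForm_comm, ← dualForm_eq_traceForm]
      rfl
    simp only [h1]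
    rw [dualForm_eq_traceForm, ← restrict_killingForm, h, ← Finset.sum_coe_sort]
    simp only [LinearMap.sum_apply, LinearMap.smulRight_apply, LinearMap.smul_apply, smul_eq_mul]
    rfl
  ne_zero α := root_apply_cartanEquivDual_symm_ne_zero (LieSubalgebra.isNonZero_coe_root α)

lemma lie_vec_dualVec (α : H.root) :
    ⁅vec H (Sum.inr α), dualVec H (Sum.inr α)⁆ = ((cartanEquivDual H).symm α.1 : L) := by
  have h1 : dualVec H (Sum.inr α) ∈ rootSpace H (-(α.1 : H → ℂ)) := by
    have := mem_wtSpace_iff.mp (dualVec_mem H (Sum.inr α))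
    rw [wt, Sum.elim_inr, rootSystem_root_apply] at this
    exact this
  have h := lie_eq_killingForm_smul_of_mem_rootSpace_of_mem_rootSpace_neg (α := α.1)
    (mem_rootSpace_of_mem_wtSpace H (vec_mem H (Sum.inr α))) h1
  rw [LieModule.traceForm_comm, killingForm_dualVec_root, one_smul] at h
  exact h

end CartanWeight

/-! ### The Casimir operator on weight vectors. -/

namespace CartanWeight

open LieAlgebra LieAlgebra.IsKilling LieModule RootForm

variable {L : Type*} [LieRing L] [LieAlgebra ℂ L] [Module.Finite ℂ L] [LieAlgebra.IsKilling ℂ L]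
  {H : LieSubalgebra ℂ L} [H.IsCartanSubalgebra] (b : (rootSystem H).Base) (E : H)

open scoped Classical in
/-- The Casimir operator of the centralizer of `E` plus the sum of the coroots of negative level. -/
def levelCasimir (w : L →ₗ[ℂ] L →ₗ[ℂ] L) : L →ₗ[ℂ] L →ₗ[ℂ] L :=
  ∑ k : FrameIndex H, (if wt H k E = 0 then ⁅vec H k, ⁅dualVec H k, w⁆⁆ else 0) +
    ∑ k : FrameIndex H, if (wt H k E).re < 0 then ⁅⁅vec H k, dualVec H k⁆, w⁆ else 0

/-- A space of alternating bilinear maps on the negative part for the grading by `E`, that is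
stable under the centralizer of `E` and on which the Casimir operator acts by `1`. -/
structure IsHarmonicModel (K : Submodule ℂ (L →ₗ[ℂ] L →ₗ[ℂ] L)) : Prop where
  simple : ∀ i ∈ b.support, (rootSystem H).root i E = 0 ∨ (rootSystem H).root i E = 1
  alt : ∀ w ∈ K, ∀ x, w x x = 0
  vanish : ∀ w ∈ K, ∀ c : ℝ, 0 ≤ c → ∀ x, ⁅(E : L), x⁆ = (c : ℂ) • x → ∀ y, w x y = 0
  stable : ∀ A : L, ⁅(E : L), A⁆ = 0 → ∀ w ∈ K, ⁅A, w⁆ ∈ K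
  casimir : ∀ w ∈ K, levelCasimir E w = w

variable {b E}

lemma exists_nat_eq (h : ∀ i ∈ b.support, (rootSystem H).root i E = 0 ∨ (rootSystem H).root i E = 1)
    {q : Module.Dual ℂ H} (hq : q ∈ posCone b) : ∃ n : ℕ, q E = n := by
  induction hq using AddSubmonoid.closure_induction with
  | mem x hx =>
    obtain ⟨i, hi, rfl⟩ := hx
    rcases h i hi with h | h
    · exact ⟨0, by simpa using h⟩
    · exact ⟨1, by simpa using h⟩
  | zero => exact ⟨0, by simp⟩
  | add x y _ _ hx hy =>
    obtain ⟨n, hn⟩ := hx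
    obtain ⟨m, hm⟩ := hy
    exact ⟨n + m, by rw [LinearMap.add_apply, hn, hm]; push_cast; rfl⟩

lemma exists_nat_root (h : ∀ i ∈ b.support, (rootSystem H).root i E = 0 ∨ (rootSystem H).root i E = 1)
    {i : H.root} (hi : b.IsPos i) : ∃ n : ℕ, (rootSystem H).root i E = n :=
  exists_nat_eq h ((root_mem_posCone_iff b).mpr hi)

lemma exists_nat_root_neg
    (h : ∀ i ∈ b.support, (rootSystem H).root i E = 0 ∨ (rootSystem H).root i E = 1)
    {i : H.root} (hi : ¬ b.IsPos i) : ∃ n : ℕ, (rootSystem H).root i E = -n := by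
  obtain ⟨n, hn⟩ := exists_nat_eq h ((neg_root_mem_posCone_iff b).mpr hi)
  exact ⟨n, by rw [← hn, LinearMap.neg_apply, neg_neg]⟩

lemma lie_eq_zero_of_apply_eq_zero {χ : Module.Dual ℂ H} (hχ : χ E = 0) {A : L}
    (hA : A ∈ wtSpace L χ) : ⁅(E : L), A⁆ = 0 := by
  rw [hA E, hχ, zero_smul]

lemma dualForm_self_eq_sum (ν : Module.Dual ℂ H) :
    dualForm H ν ν = ∑ i, ν (cartanDualBasis H i) * ν (cartanBasis H i) := by
  have h := sum_cartanBasis H ((cartanEquivDual H).symm ν)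
  have h2 : ∀ x, traceForm ℂ H L x ((cartanEquivDual H).symm ν) = ν x := by
    intro x
    rw [traceForm_comm]
    conv_rhs => rw [← (cartanEquivDual H).apply_symm_apply ν]
    rfl
  rw [dualForm_apply]
  conv_lhs => rw [← h]
  simp [h2]

open scoped Classical in
lemma sum_not_isPos : ∑ i, (if b.IsPos i then 0 else -(rootSystem H).root i) = (2 : ℂ) • halfSum b := by
  have h := sum_absRoot b
  have h1 : ∀ i, absRoot b i = (if b.IsPos i then (rootSystem H).root i else 0) +
      (if b.IsPos i then 0 else -(rootSystem H).root i) := by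
    intro i
    unfold absRoot
    split_ifs <;> simp
  have h2 : ∑ i, (if b.IsPos i then (rootSystem H).root i else 0) = (2 : ℂ) • halfSum b := by
    rw [halfSum, smul_smul, mul_inv_cancel₀ two_ne_zero, one_smul]
  simp only [h1, Finset.sum_add_distrib] at h
  rw [h2] at h
  have h3 : (4 : ℂ) • halfSum b = (2 : ℂ) • halfSum b + (2 : ℂ) • halfSum b := by module
  rw [h3] at h
  exact add_left_cancel h

namespace IsHarmonicModel

variable {K : Submodule ℂ (L →ₗ[ℂ] L →ₗ[ℂ] L)} (hK : IsHarmonicModel b E K)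
include hK

lemma swap {w : L →ₗ[ℂ] L →ₗ[ℂ] L} (hw : w ∈ K) (x y : L) : w x y = -w y x := by
  have h := hK.alt w hw (x + y)
  simp only [map_add, LinearMap.add_apply, hK.alt w hw, zero_add, add_zero] at h
  exact eq_neg_of_add_eq_zero_right h

/-- Elements of `K` vanish on vectors of nonnegative level, and the levels of positive roots are
natural numbers. -/
lemma exists_eq_neg_root {w : L →ₗ[ℂ] L →ₗ[ℂ] L} (hw : w ∈ K) {χ : Module.Dual ℂ H} {x y : L}
    (hx : x ∈ wtSpace L χ) (h : w x y ≠ 0) :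
    ∃ β : H.root, b.IsPos β ∧ χ = -(rootSystem H).root β ∧ 0 < ((rootSystem H).root β E).re := by
  have hx0 : x ≠ 0 := by rintro rfl; simp at h
  have hv : ∀ n : ℕ, χ E ≠ n := by
    intro n hn
    refine h (hK.vanish w hw n n.cast_nonneg x ?_ y)
    rw [hx E, hn, Complex.ofReal_natCast]
  rcases eq_zero_or_mem_range hx hx0 with rfl | ⟨i, rfl⟩
  · exact absurd (by simp) (hv 0)
  by_cases hi : b.IsPos i
  · obtain ⟨n, hn⟩ := exists_nat_root hK.simple hi
    exact absurd hn (hv n)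
  · refine ⟨(rootSystem H).reflectionPerm i i, (not_isPos_iff b i).mpr hi, ?_, ?_⟩
    · rw [root_reflectionPerm_self, neg_neg]
    · obtain ⟨n, hn⟩ := exists_nat_root_neg hK.simple hi
      rw [root_reflectionPerm_self, LinearMap.neg_apply, hn, neg_neg, Complex.natCast_re]
      have : n ≠ 0 := by rintro rfl; exact hv 0 (by simpa using hn)
      exact_mod_cast Nat.pos_of_ne_zero this

lemma isPairSum_of_apply_ne_zero {w : L →ₗ[ℂ] L →ₗ[ℂ] L} (hw : w ∈ K) {ν χ ψ : Module.Dual ℂ H}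
    (hν : w ∈ wtSpace (L →ₗ[ℂ] L →ₗ[ℂ] L) (-ν)) {x y : L} (hx : x ∈ wtSpace L χ)
    (hy : y ∈ wtSpace L ψ) (h : w x y ≠ 0) :
    ∃ β γ μ, IsPairSum b (ν + halfSum b) β γ μ ∧
      χ = -(rootSystem H).root β ∧ ψ = -(rootSystem H).root γ ∧
      0 < ((rootSystem H).root β E).re ∧ 0 < ((rootSystem H).root γ E).re := by
  obtain ⟨β, hβ, rfl, hβE⟩ := hK.exists_eq_neg_root hw hx h
  obtain ⟨γ, hγ, rfl, hγE⟩ := hK.exists_eq_neg_root hw hy (x := y) (y := x)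
    (by rw [hK.swap hw]; exact neg_ne_zero.mpr h)
  refine ⟨β, γ, -(-ν + -(rootSystem H).root β + -(rootSystem H).root γ), ⟨hβ, hγ, ?_, ?_, by abel⟩,
    rfl, rfl, hβE, hγE⟩
  -- If `β = γ`, both arguments lie in one root space, which is a line, and `w` is alternating.
  · rintro rfl
    have hx0 : x ≠ 0 := by rintro rfl; simp at h
    rw [← root_reflectionPerm_self] at hx hy
    obtain ⟨c, rfl⟩ := exists_eq_smul H _ hx hx0 hy
    rw [map_smul, hK.alt w hw, smul_zero] at h
    exact h rfl
  · rcases eq_zero_or_mem_range (apply_mem_wtSpace hν hx hy) h with h1 | ⟨i, hi⟩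
    · left; rw [h1, neg_zero]
    · right
      exact ⟨(rootSystem H).reflectionPerm i i, by rw [root_reflectionPerm_self, hi]⟩

lemma exists_apply_vec_ne_zero {w : L →ₗ[ℂ] L →ₗ[ℂ] L} {x : L} (h0 : w x ≠ 0) :
    ∃ l, w x (vec H l) ≠ 0 := by
  by_contra! hcon
  refine h0 (LinearMap.ext fun y => ?_)
  rw [← sum_vec H y]
  simp [hcon]

lemma exists_isPairSum {w : L →ₗ[ℂ] L →ₗ[ℂ] L} (hw : w ∈ K) {ν : Module.Dual ℂ H}
    (hν : w ∈ wtSpace (L →ₗ[ℂ] L →ₗ[ℂ] L) (-ν)) (h0 : w ≠ 0) :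
    ∃ β γ μ, IsPairSum b (ν + halfSum b) β γ μ ∧
      0 < ((rootSystem H).root β E).re ∧ 0 < ((rootSystem H).root γ E).re := by
  obtain ⟨k, hk⟩ : ∃ k, w (vec H k) ≠ 0 := by
    by_contra! hcon
    refine h0 (LinearMap.ext fun y => ?_)
    rw [← sum_vec H y]
    simp [hcon]
  obtain ⟨l, hl⟩ := hK.exists_apply_vec_ne_zero hk
  obtain ⟨β, γ, μ, h1, -, -, h2, h3⟩ :=
    hK.isPairSum_of_apply_ne_zero hw hν (vec_mem H k) (vec_mem H l) hl
  exact ⟨β, γ, μ, h1, h2, h3⟩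

/-- The action of the Casimir operator on a weight vector, modulo the images under negative root
vectors. -/
lemma smul_sub_mem {w : L →ₗ[ℂ] L →ₗ[ℂ] L} (hw : w ∈ K) {ν : Module.Dual ℂ H}
    (hν : w ∈ wtSpace (L →ₗ[ℂ] L →ₗ[ℂ] L) (-ν)) {N : Submodule ℂ (L →ₗ[ℂ] L →ₗ[ℂ] L)}
    (hN : ∀ A : L, ⁅(E : L), A⁆ = 0 → ∀ x ∈ N, ⁅A, x⁆ ∈ N)
    (hB : ∀ i : H.root, ¬ b.IsPos i → (rootSystem H).root i E = 0 →
      ∀ B ∈ wtSpace L ((rootSystem H).root i), ⁅B, w⁆ ∈ N) :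
    w - dualForm H ν (ν + (2 : ℂ) • halfSum b) • w ∈ N := by
  classical
  have ht : ∀ α : H.root, ⁅⁅vec H (Sum.inr α), dualVec H (Sum.inr α)⁆, w⁆ =
      -dualForm H ν ((rootSystem H).root α) • w := by
    intro α
    rw [lie_vec_dualVec, hν, LinearMap.neg_apply, dualForm_apply, rootSystem_root_apply]
  have hneg : ∀ α : H.root, -wt H (Sum.inr α) =
      (rootSystem H).root ((rootSystem H).reflectionPerm α α) := by
    intro α
    rw [root_reflectionPerm_self]
    rfl
  -- For `α` positive the inner factor is a negative root vector, so the term lies in `N`. For `α`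
  -- negative the two factors are exchanged first, and the commutator contributes `-⟨ν, α⟩`.
  have h1 : ∀ α : H.root, wt H (Sum.inr α) E = 0 →
      ⁅vec H (Sum.inr α), ⁅dualVec H (Sum.inr α), w⁆⁆ -
        (if b.IsPos α then (0 : ℂ) else -dualForm H ν ((rootSystem H).root α)) • w ∈ N := by
    intro α hα
    have hv := vec_mem H (Sum.inr α)
    have hd := dualVec_mem H (Sum.inr α)
    rw [hneg] at hd
    have hα' : (rootSystem H).root ((rootSystem H).reflectionPerm α α) E = 0 := by
      rw [← hneg, LinearMap.neg_apply, hα, neg_zero]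
    split_ifs with hp
    · rw [zero_smul, sub_zero]
      refine hN _ (lie_eq_zero_of_apply_eq_zero hα hv) _ (hB _ ?_ hα' _ hd)
      rwa [← not_isPos_iff, negIndex_negIndex]
    · rw [leibniz_lie, ht, add_sub_cancel_left]
      exact hN _ (lie_eq_zero_of_apply_eq_zero hα' hd) _ (hB α hp hα _ hv)
  have h2 : ∑ i, ⁅vec H (Sum.inl i), ⁅dualVec H (Sum.inl i), w⁆⁆ = dualForm H ν ν • w := by
    rw [dualForm_self_eq_sum, Finset.sum_smul]
    refine Finset.sum_congr rfl fun i _ => ?_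
    change ⁅(cartanBasis H i : L), ⁅(cartanDualBasis H i : L), w⁆⁆ = _
    rw [hν, lie_smul, hν, smul_smul, LinearMap.neg_apply, LinearMap.neg_apply, neg_mul_neg]
  have hcas := hK.casimir w hw
  rw [levelCasimir, Fintype.sum_sum_type, Fintype.sum_sum_type] at hcas
  have h3 : ∀ i, wt H (Sum.inl i) = 0 := fun i => rfl
  simp only [h3, LinearMap.zero_apply, if_true, Complex.zero_re, lt_irrefl, if_false,
    Finset.sum_const_zero, zero_add] at hcas
  rw [h2] at hcas
  -- The negative roots of level zero (from the Casimir operator) and the roots of negative level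
  -- (from `δ`) are together all negative roots, whose negatives sum to `2ρ`.
  have h4 : dualForm H ν (ν + (2 : ℂ) • halfSum b) = dualForm H ν ν +
      ∑ α : H.root, (if wt H (Sum.inr α) E = 0 then
        (if b.IsPos α then (0 : ℂ) else -dualForm H ν ((rootSystem H).root α)) else 0) +
      ∑ α : H.root, (if (wt H (Sum.inr α) E).re < 0 then
        -dualForm H ν ((rootSystem H).root α) else 0) := by
    rw [map_add, ← sum_not_isPos, map_sum, add_assoc, ← Finset.sum_add_distrib]
    congr 1
    refine Finset.sum_congr rfl fun α _ => ?_
    have hE : wt H (Sum.inr α) E = (rootSystem H).root α E := rfl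
    rw [hE]
    by_cases hp : b.IsPos α
    · obtain ⟨n, hn⟩ := exists_nat_root hK.simple hp
      rw [hn]
      simp [hp]
    · obtain ⟨n, hn⟩ := exists_nat_root_neg hK.simple hp
      rw [hn]
      rcases Nat.eq_zero_or_pos n with rfl | hn0
      · simp [hp]
      · simp [hp, hn0, hn0.ne']
  have h5 : w - dualForm H ν (ν + (2 : ℂ) • halfSum b) • w =
      ∑ α : H.root, (if wt H (Sum.inr α) E = 0 then
        ⁅vec H (Sum.inr α), ⁅dualVec H (Sum.inr α), w⁆⁆ -
        (if b.IsPos α then (0 : ℂ) else -dualForm H ν ((rootSystem H).root α)) • w else 0) := by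
    rw [h4]
    conv_lhs => enter [1]; rw [← hcas]
    have h6 : ∑ α : H.root, (if (wt H (Sum.inr α) E).re < 0 then
        ⁅⁅vec H (Sum.inr α), dualVec H (Sum.inr α)⁆, w⁆ else 0) =
        (∑ α : H.root, (if (wt H (Sum.inr α) E).re < 0 then
        -dualForm H ν ((rootSystem H).root α) else 0)) • w := by
      rw [Finset.sum_smul]
      refine Finset.sum_congr rfl fun α _ => ?_
      split_ifs
      · exact ht α
      · rw [zero_smul]
    have h7 : ∀ α : H.root, (if wt H (Sum.inr α) E = 0 then
        ⁅vec H (Sum.inr α), ⁅dualVec H (Sum.inr α), w⁆⁆ -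
        (if b.IsPos α then (0 : ℂ) else -dualForm H ν ((rootSystem H).root α)) • w else 0) =
        (if wt H (Sum.inr α) E = 0 then ⁅vec H (Sum.inr α), ⁅dualVec H (Sum.inr α), w⁆⁆ else 0) -
        (if wt H (Sum.inr α) E = 0 then
        (if b.IsPos α then (0 : ℂ) else -dualForm H ν ((rootSystem H).root α)) else 0) • w := by
      intro α
      split_ifs <;> simp
    rw [h6, Finset.sum_congr rfl fun α _ => h7 α, Finset.sum_sub_distrib, ← Finset.sum_smul]
    module
  rw [h5]
  refine Submodule.sum_mem _ fun α _ => ?_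
  by_cases hE : wt H (Sum.inr α) E = 0
  · rw [if_pos hE]
    exact h1 α hE
  · rw [if_neg hE]
    exact zero_mem _

end IsHarmonicModel

end CartanWeight

/-! ### Lowest weight vectors and isotypical components. -/

namespace CartanWeight

open LieAlgebra LieAlgebra.IsKilling LieModule RootForm

variable {L : Type*} [LieRing L] [LieAlgebra ℂ L] [Module.Finite ℂ L] [LieAlgebra.IsKilling ℂ L]
  {H : LieSubalgebra ℂ L} [H.IsCartanSubalgebra] {b : (rootSystem H).Base} {E : H}
  {K N S : Submodule ℂ (L →ₗ[ℂ] L →ₗ[ℂ] L)}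

/-- Stability under the centralizer of `E`. -/
def IsStable (E : H) (N : Submodule ℂ (L →ₗ[ℂ] L →ₗ[ℂ] L)) : Prop :=
  ∀ A : L, ⁅(E : L), A⁆ = 0 → ∀ x ∈ N, ⁅A, x⁆ ∈ N

/-- The submodule generated by a set under the centralizer of `E`. -/
def leviSpan (E : H) (s : Set (L →ₗ[ℂ] L →ₗ[ℂ] L)) : Submodule ℂ (L →ₗ[ℂ] L →ₗ[ℂ] L) :=
  sInf {N | s ⊆ N ∧ IsStable E N}

lemma subset_leviSpan (s : Set (L →ₗ[ℂ] L →ₗ[ℂ] L)) : s ⊆ leviSpan E s := by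
  intro x hx
  rw [leviSpan, SetLike.mem_coe, Submodule.mem_sInf]
  exact fun N hN => hN.1 hx

lemma isStable_leviSpan (s : Set (L →ₗ[ℂ] L →ₗ[ℂ] L)) : IsStable E (leviSpan E s) := by
  intro A hA x hx
  rw [leviSpan, Submodule.mem_sInf] at hx ⊢
  exact fun N hN => hN.2 A hA x (hx N hN)

lemma leviSpan_le {s : Set (L →ₗ[ℂ] L →ₗ[ℂ] L)} (h : s ⊆ N) (hN : IsStable E N) :
    leviSpan E s ≤ N := sInf_le ⟨h, hN⟩

lemma leviSpan_mono {s t : Set (L →ₗ[ℂ] L →ₗ[ℂ] L)} (h : s ⊆ t) : leviSpan E s ≤ leviSpan E t :=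
  leviSpan_le (h.trans (subset_leviSpan t)) (isStable_leviSpan t)

lemma isStable_iSup {ι : Sort*} {f : ι → Submodule ℂ (L →ₗ[ℂ] L →ₗ[ℂ] L)}
    (h : ∀ i, IsStable E (f i)) : IsStable E (⨆ i, f i) := by
  intro A hA x hx
  induction hx using Submodule.iSup_induction' with
  | zero => simp
  | add x y _ _ hx hy => rw [lie_add]; exact add_mem hx hy
  | mem i x hx => exact Submodule.mem_iSup_of_mem i (h i A hA x hx)

lemma IsStable.inf (h : IsStable E N) (h' : IsStable E S) : IsStable E (N ⊓ S) :=
  fun A hA x hx => ⟨h A hA x hx.1, h' A hA x hx.2⟩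

lemma lie_cartan_eq_zero (h : H) : ⁅(E : L), (h : L)⁆ = 0 :=
  lie_eq_zero_of_apply_eq_zero (χ := 0) rfl (coe_mem_wtSpace H h)

lemma IsStable.cartan (h : IsStable E N) (a : H) (x) (hx : x ∈ N) : ⁅(a : L), x⁆ ∈ N :=
  h _ (lie_cartan_eq_zero a) x hx

/-- The centralizer of `E` is spanned by the weight vectors of level zero. -/
lemma mem_of_vec_mem {p : Submodule ℂ L} (h : ∀ k, wt H k E = 0 → vec H k ∈ p) {A : L}
    (hA : ⁅(E : L), A⁆ = 0) : A ∈ p := by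
  rw [← sum_vec H A]
  refine Submodule.sum_mem _ fun k _ => ?_
  by_cases hk : wt H k E = 0
  · exact p.smul_mem _ (h k hk)
  · have h1 := LieModule.traceForm_apply_lie_apply ℂ L L (dualVec H k) (E : L) A
    have h2 := dualVec_mem H k E
    rw [← lie_skew, h2, hA, map_zero, LinearMap.neg_apply, neg_smul, neg_neg, map_smul,
      LinearMap.smul_apply, smul_eq_mul] at h1
    have h3 : killingForm ℂ L (dualVec H k) A = 0 := (mul_eq_zero.mp h1).resolve_left hk
    rw [h3, zero_smul]
    exact zero_mem _

/-- `w` has weight `χ` and is annihilated by the negative root vectors of level zero. -/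
def IsLowest (b : (rootSystem H).Base) (E : H) (χ : Module.Dual ℂ H) (w : L →ₗ[ℂ] L →ₗ[ℂ] L) :
    Prop :=
  w ∈ wtSpace (L →ₗ[ℂ] L →ₗ[ℂ] L) χ ∧ ∀ i : H.root, ¬ b.IsPos i → (rootSystem H).root i E = 0 →
    ∀ B ∈ wtSpace L ((rootSystem H).root i), ⁅B, w⁆ = 0

/-- The submodule generated by the lowest weight vectors of weight `-lam`. -/
def isoComp (b : (rootSystem H).Base) (E : H) (K : Submodule ℂ (L →ₗ[ℂ] L →ₗ[ℂ] L))
    (lam : Module.Dual ℂ H) : Submodule ℂ (L →ₗ[ℂ] L →ₗ[ℂ] L) :=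
  leviSpan E {w | w ∈ K ∧ IsLowest b E (-lam) w}

lemma isStable_isoComp (lam : Module.Dual ℂ H) : IsStable E (isoComp b E K lam) :=
  isStable_leviSpan _

lemma isoComp_mono (h : N ≤ K) (lam : Module.Dual ℂ H) : isoComp b E N lam ≤ isoComp b E K lam :=
  leviSpan_mono fun _ hw => ⟨h hw.1, hw.2⟩

lemma exists_isLowest_of_isoComp_ne_bot {lam : Module.Dual ℂ H} (h : isoComp b E K lam ≠ ⊥) :
    ∃ w ∈ K, w ≠ 0 ∧ IsLowest b E (-lam) w := by
  by_contra! hcon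
  refine h (eq_bot_iff.mpr (leviSpan_le (fun w hw => ?_) fun A _ x hx => ?_))
  · by_contra h0
    exact hcon w hw.1 h0 hw.2
  · rw [(Submodule.mem_bot ℂ).mp hx, lie_zero]
    exact zero_mem _

variable (b E) in
/-- The cone generated by the positive roots of level zero. -/
def levelCone : AddSubmonoid (Module.Dual ℂ H) :=
  AddSubmonoid.closure {q | ∃ i, b.IsPos i ∧ (rootSystem H).root i E = 0 ∧ (rootSystem H).root i = q}

lemma levelCone_le : levelCone b E ≤ posCone b := by
  refine AddSubmonoid.closure_le.mpr ?_
  rintro q ⟨i, hi, -, rfl⟩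
  exact (root_mem_posCone_iff b).mpr hi

/-- The submodule generated by lowest weight vectors is already generated by the positive root
vectors of level zero, which raise weights by elements of the level cone. -/
lemma isoComp_le_iSup (lam : Module.Dual ℂ H) :
    isoComp b E K lam ≤ ⨆ q : levelCone b E, wtSpace (L →ₗ[ℂ] L →ₗ[ℂ] L) (-lam + (q : Module.Dual ℂ H)) := by
  set s := {w | w ∈ K ∧ IsLowest b E (-lam) w} with hs
  let P : Submodule ℂ (L →ₗ[ℂ] L →ₗ[ℂ] L) := sInf {Q | s ⊆ Q ∧ ∀ i, b.IsPos i →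
    (rootSystem H).root i E = 0 → ∀ A ∈ wtSpace L ((rootSystem H).root i), ∀ x ∈ Q, ⁅A, x⁆ ∈ Q}
  have hsP : s ⊆ P := by
    intro x hx
    rw [SetLike.mem_coe, Submodule.mem_sInf]
    exact fun Q hQ => hQ.1 hx
  have hP : ∀ i, b.IsPos i → (rootSystem H).root i E = 0 →
      ∀ A ∈ wtSpace L ((rootSystem H).root i), ∀ x ∈ P, ⁅A, x⁆ ∈ P := by
    intro i hi hE A hA x hx
    rw [Submodule.mem_sInf] at hx ⊢
    exact fun Q hQ => hQ.2 i hi hE A hA x (hx Q hQ)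
  have hst : P ≤ (⨅ C : {C : L // ⁅(E : L), C⁆ = 0},
      P.comap (LieModule.toEnd ℂ L (L →ₗ[ℂ] L →ₗ[ℂ] L) C.1)) := by
    -- The vectors of `P` that the centralizer keeps in `P` contain the generators. They are closed
    -- under each positive root vector `A` because `[C, A]` again centralizes `E`; minimality of `P`
    -- then makes it stable.
    have h1 : P ≤ P ⊓ (⨅ C : {C : L // ⁅(E : L), C⁆ = 0},
        P.comap (LieModule.toEnd ℂ L (L →ₗ[ℂ] L →ₗ[ℂ] L) C.1)) := by
      refine sInf_le ⟨fun w hw => ⟨hsP hw, ?_⟩, ?_⟩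
      · rw [SetLike.mem_coe, Submodule.mem_iInf]
        rintro ⟨C, hC⟩
        rw [Submodule.mem_comap, LieModule.toEnd_apply_apply]
        let p : Submodule ℂ L := P.comap ((LieModule.toEnd ℂ L (L →ₗ[ℂ] L →ₗ[ℂ] L) :
          L →ₗ[ℂ] Module.End ℂ (L →ₗ[ℂ] L →ₗ[ℂ] L)).flip w)
        have hp : ∀ C, C ∈ p ↔ ⁅C, w⁆ ∈ P := fun C => Iff.rfl
        change C ∈ p
        refine mem_of_vec_mem (fun k hk => (hp _).mpr ?_) hC
        cases k with
        | inl i =>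
          change ⁅(cartanBasis H i : L), w⁆ ∈ P
          rw [hw.2.1]
          exact P.smul_mem _ (hsP hw)
        | inr α =>
          by_cases hα : b.IsPos α
          · exact hP α hα hk _ (vec_mem H _) _ (hsP hw)
          · rw [hw.2.2 α hα hk _ (vec_mem H _)]
            exact zero_mem _
      · rintro i hi hE A hA x ⟨hx1, hx2⟩
        refine ⟨hP i hi hE A hA x hx1, ?_⟩
        rw [SetLike.mem_coe, Submodule.mem_iInf] at hx2 ⊢
        rintro ⟨C, hC⟩
        have hA' := lie_eq_zero_of_apply_eq_zero hE hA
        rw [Submodule.mem_comap, LieModule.toEnd_apply_apply, leibniz_lie]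
        refine add_mem (hx2 ⟨⁅C, A⁆, ?_⟩) (hP i hi hE A hA _ (hx2 ⟨C, hC⟩))
        rw [leibniz_lie, hC, hA', zero_lie, lie_zero, add_zero]
    exact h1.trans inf_le_right
  refine (leviSpan_le hsP fun A hA x hx => ?_).trans (sInf_le ⟨fun w hw => ?_, ?_⟩)
  · have := hst hx
    rw [Submodule.mem_iInf] at this
    exact this ⟨A, hA⟩
  · refine Submodule.mem_iSup_of_mem (0 : levelCone b E) ?_
    rw [ZeroMemClass.coe_zero, add_zero]
    exact hw.2.1
  · intro i hi hE A hA x hx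
    induction hx using Submodule.iSup_induction' with
    | zero => simp
    | add x y _ _ hx hy => rw [lie_add]; exact add_mem hx hy
    | mem q x hx =>
      refine Submodule.mem_iSup_of_mem (q + ⟨_, AddSubmonoid.subset_closure ⟨i, hi, hE, rfl⟩⟩) ?_
      have := lie_mem_wtSpace hA hx
      rw [AddSubmonoid.coe_add]
      convert this using 1
      abel_nf

lemma ip_add_self (x q : Module.Dual ℂ H) : ip (dualForm H) (x + q) (x + q) =
    ip (dualForm H) x x + 2 * ip (dualForm H) x q + ip (dualForm H) q q := by
  rw [ip_add_left, ip_add_right, ip_add_right, (isDualKillingForm H).ip_comm q x]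
  ring

lemma iSup_isoComp_le (p : Module.Dual ℂ H → Prop) :
    ⨆ mu : {mu // p mu}, isoComp b E K mu.1 ≤
      ⨆ r : {mu // p mu ∧ isoComp b E K mu ≠ ⊥} × levelCone b E,
        wtSpace (L →ₗ[ℂ] L →ₗ[ℂ] L) (-r.1.1 + (r.2 : Module.Dual ℂ H)) := by
  refine iSup_le fun mu => ?_
  by_cases hmu : isoComp b E K mu.1 = ⊥
  · rw [hmu]; exact bot_le
  · refine (isoComp_le_iSup mu.1).trans (iSup_le fun q => ?_)
    exact le_iSup (fun r : {mu // p mu ∧ isoComp b E K mu ≠ ⊥} × levelCone b E =>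
      wtSpace (L →ₗ[ℂ] L →ₗ[ℂ] L) (-r.1.1 + (r.2 : Module.Dual ℂ H))) (⟨mu.1, mu.2, hmu⟩, q)

namespace IsHarmonicModel

variable (hK : IsHarmonicModel b E K)
include hK

/-- Completing the square: `⟨ν, ν + 2ρ⟩ = |ν + ρ|² - |ρ|²`. -/
lemma norm_eq_of_eq_one {ν : Module.Dual ℂ H}
    (h : dualForm H ν (ν + (2 : ℂ) • halfSum b) = 1) :
    ip (dualForm H) (ν + halfSum b) (ν + halfSum b) =
      1 + ip (dualForm H) (halfSum b) (halfSum b) := by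
  have h1 : ip (dualForm H) ν (ν + (2 : ℂ) • halfSum b) = 1 := by rw [ip, h, Complex.one_re]
  have h2 := (isDualKillingForm H).ip_comm ν (halfSum b)
  rw [two_smul, ip_add_right, ip_add_right] at h1
  simp only [ip_add_left, ip_add_right]
  linarith

lemma norm_eq {ν : Module.Dual ℂ H} {w : L →ₗ[ℂ] L →ₗ[ℂ] L} (hw : w ∈ K) (h0 : w ≠ 0)
    (hl : IsLowest b E (-ν) w) :
    ip (dualForm H) (ν + halfSum b) (ν + halfSum b) =
      1 + ip (dualForm H) (halfSum b) (halfSum b) := by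
  refine hK.norm_eq_of_eq_one ?_
  have h := hK.smul_sub_mem (N := ⊥) hw hl.1 (fun A _ x hx => by
    rw [(Submodule.mem_bot ℂ).mp hx, lie_zero]; exact zero_mem _) (fun i hi hE B hB => by
    rw [hl.2 i hi hE B hB]; exact zero_mem _)
  rw [Submodule.mem_bot, sub_eq_zero] at h
  refine smul_left_injective ℂ h0 ?_
  simp only [one_smul]
  exact h.symm

/-- A harmonic weight vector of extremal norm is not moved to higher norm. -/
lemma ip_root_pos {ν : Module.Dual ℂ H} {w : L →ₗ[ℂ] L →ₗ[ℂ] L} (hw : w ∈ K) (h0 : w ≠ 0)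
    (hν : w ∈ wtSpace (L →ₗ[ℂ] L →ₗ[ℂ] L) (-ν))
    (heq : ip (dualForm H) (ν + halfSum b) (ν + halfSum b) =
      1 + ip (dualForm H) (halfSum b) (halfSum b)) {i : H.root} (hi : b.IsPos i)
    (hE : (rootSystem H).root i E = 0) :
    0 < ip (dualForm H) (ν + halfSum b) ((rootSystem H).root i) := by
  obtain ⟨β, γ, μ, h, hβ, hγ⟩ := hK.exists_isPairSum hw hν h0
  refine h.ip_root_pos (isDualKillingForm H) heq hi ?_ ?_
  · rintro rfl; rw [hE] at hβ; simp at hβ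
  · rintro rfl; rw [hE] at hγ; simp at hγ

/-- A stable space of harmonic elements is generated by its lowest weight vectors. -/
lemma le_leviSpan (hNK : N ≤ K) (hN : IsStable E N) :
    N ≤ leviSpan E {w | w ∈ N ∧ ∃ ν, IsLowest b E (-ν) w} := by
  set N' := leviSpan E {w | w ∈ N ∧ ∃ ν, IsLowest b E (-ν) w} with hN'
  have hst : IsStable E N' := isStable_leviSpan _
  refine (le_iSup_inf_wtSpace hN.cartan (iSup_wtSpace_bilin_eq_top H)).trans (iSup_le ?_)
  by_contra! hcon
  have hfin : {χ : Module.Dual ℂ H | ¬ N ⊓ wtSpace (L →ₗ[ℂ] L →ₗ[ℂ] L) χ ≤ N'}.Finite := by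
    refine (finite_weights (H := H) (M := L →ₗ[ℂ] L →ₗ[ℂ] L)).subset fun χ hχ hbot => hχ ?_
    rw [hbot, inf_bot_eq]
    exact bot_le
  -- Take a bad weight that is lowest in the direction of `ρ`. Negative root vectors lower the
  -- weight, so they move `x` into `N'`.
  obtain ⟨χ, hχ, hmin⟩ := Set.exists_min_image _ (fun χ => ip (dualForm H) (halfSum b) χ) hfin hcon
  obtain ⟨x, ⟨hxN, hxχ⟩, hx⟩ := SetLike.not_le_iff_exists.mp hχ
  obtain ⟨ν, rfl⟩ : ∃ ν, χ = -ν := ⟨-χ, (neg_neg χ).symm⟩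
  have hB : ∀ i : H.root, ¬ b.IsPos i → (rootSystem H).root i E = 0 →
      ∀ B ∈ wtSpace L ((rootSystem H).root i), ⁅B, x⁆ ∈ N' := by
    intro i hi hE B hB
    have h1 := lie_mem_wtSpace hB hxχ
    have h2 := hN B (lie_eq_zero_of_apply_eq_zero hE hB) x hxN
    by_contra hcon
    have h3 := hmin _ (show ¬ _ ≤ N' from fun h => hcon (h ⟨h2, h1⟩))
    have h4 := (isDualKillingForm H).ip_halfSum_pos b ((neg_root_mem_posCone_iff b).mpr hi)
      (neg_ne_zero.mpr ((rootSystem H).ne_zero i))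
    rw [ip_add_right] at h3
    rw [ip_neg_right] at h4
    linarith
  have hx0 : x ≠ 0 := by rintro rfl; exact hx (zero_mem _)
  have h1 := hK.smul_sub_mem (hNK hxN) hxχ hst hB
  -- Modulo `N'` the Casimir operator is this scalar, but it fixes `x`; a value other than `1` would
  -- put `x` in `N'`.
  have h2 : dualForm H ν (ν + (2 : ℂ) • halfSum b) = 1 := by
    by_contra hne
    refine hx ((N'.smul_mem_iff (sub_ne_zero.mpr (Ne.symm hne))).mp ?_)
    rw [sub_smul, one_smul]
    exact h1
  have heq := hK.norm_eq_of_eq_one h2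
  refine hx (subset_leviSpan _ ⟨hxN, ν, hxχ, fun i hi hE B hB => ?_⟩)
  -- If `[B, x] ≠ 0`, its weight is `-(ν + α_j)`, and `|ν + ρ + α_j|` exceeds the maximal norm
  -- because `(ν + ρ, α_j) > 0`. So `x` is a lowest weight vector after all, a contradiction.
  by_contra hne
  have h3 := lie_mem_wtSpace hB hxχ
  have h4 := hK.stable B (lie_eq_zero_of_apply_eq_zero hE hB) x (hNK hxN)
  set j := (rootSystem H).reflectionPerm i i with hj
  have hji : (rootSystem H).root i = -(rootSystem H).root j := by
    rw [hj, root_reflectionPerm_self, neg_neg]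
  have hjp : b.IsPos j := (not_isPos_iff b i).mpr hi
  have h5 : (rootSystem H).root i + -ν = -(ν + (rootSystem H).root j) := by rw [hji]; abel
  rw [h5] at h3
  obtain ⟨β, γ, μ, h6, -, -⟩ := hK.exists_isPairSum h4 h3 hne
  have h7 := h6.ip_le (isDualKillingForm H)
  have h8 := hK.ip_root_pos (hNK hxN) hx0 hxχ heq hjp (by
    rw [← neg_eq_zero, ← LinearMap.neg_apply, ← hji, hE])
  have h9 := (isDualKillingForm H).ip_root_self_pos j
  rw [add_right_comm, ip_add_self] at h7
  linarith

lemma exists_isLowest (hNK : N ≤ K) (hN : IsStable E N) (h : N ≠ ⊥) :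
    ∃ w ∈ N, w ≠ 0 ∧ ∃ ν, IsLowest b E (-ν) w := by
  by_contra! hcon
  refine h (eq_bot_iff.mpr ((hK.le_leviSpan hNK hN).trans
    (leviSpan_le (fun w hw => ?_) fun A _ x hx => ?_)))
  · by_contra h0
    obtain ⟨h1, ν, h2⟩ := hw
    exact hcon w h1 h0 ν h2
  · rw [(Submodule.mem_bot ℂ).mp hx, lie_zero]
    exact zero_mem _

lemma le_iSup_isoComp (hNK : N ≤ K) (hN : IsStable E N) :
    N ≤ ⨆ ν : Module.Dual ℂ H, isoComp b E N ν := by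
  refine (hK.le_leviSpan hNK hN).trans (leviSpan_le ?_ (isStable_iSup isStable_isoComp))
  rintro w ⟨hw, ν, hl⟩
  exact Submodule.mem_iSup_of_mem ν (subset_leviSpan _ ⟨hw, hl⟩)

lemma isoComp_le (lam : Module.Dual ℂ H) : isoComp b E K lam ≤ K :=
  leviSpan_le (fun _ hw => hw.1) hK.stable

/-- From an extremal weight the norm strictly increases along the level cone, so two extremal
weights cannot differ by a nonzero element of it. This separates the isotypical components. -/
lemma eq_zero_of_norm_eq {ν q : Module.Dual ℂ H} {w : L →ₗ[ℂ] L →ₗ[ℂ] L} (hw : w ∈ K) (h0 : w ≠ 0)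
    (hl : IsLowest b E (-ν) w) (hq : q ∈ levelCone b E)
    (heq : ip (dualForm H) (ν + q + halfSum b) (ν + q + halfSum b) =
      1 + ip (dualForm H) (halfSum b) (halfSum b)) : q = 0 := by
  by_contra hq0
  have h1 := hK.norm_eq hw h0 hl
  have h2 : 0 ≤ ip (dualForm H) (ν + halfSum b) q := by
    clear hq0 heq
    induction hq using AddSubmonoid.closure_induction with
    | mem x hx =>
      obtain ⟨i, hi, hE, rfl⟩ := hx
      exact (hK.ip_root_pos hw h0 hl.1 h1 hi hE).le
    | zero => simp
    | add x y _ _ hx hy => rw [ip_add_right]; exact add_nonneg hx hy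
  have h3 := (isDualKillingForm H).ip_self_pos b (levelCone_le hq) hq0
  rw [add_right_comm, ip_add_self] at heq
  linarith

lemma eq_of_isoComp_ne_bot {ν mu : Module.Dual ℂ H} {w : L →ₗ[ℂ] L →ₗ[ℂ] L} (hw : w ∈ K)
    (h0 : w ≠ 0) (hl : IsLowest b E (-ν) w) (hmu : isoComp b E K mu ≠ ⊥) {q : Module.Dual ℂ H}
    (hq : q ∈ levelCone b E) (h : -mu + q = -ν) : mu = ν := by
  have h2 : mu = ν + q := by
    rw [← neg_inj, neg_add, ← h, add_neg_cancel_right]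
  obtain ⟨u, hu, hu0, hul⟩ := exists_isLowest_of_isoComp_ne_bot hmu
  have h3 := hK.norm_eq hu hu0 hul
  rw [h2] at h3
  rw [h2, hK.eq_zero_of_norm_eq hw h0 hl hq h3, add_zero]

lemma eq_of_mem_isoComp {ν lam : Module.Dual ℂ H} {w : L →ₗ[ℂ] L →ₗ[ℂ] L}
    (h0 : w ≠ 0) (hl : IsLowest b E (-ν) w) (hw : w ∈ isoComp b E K lam) : lam = ν := by
  obtain ⟨q, hq⟩ := exists_eq_of_mem_iSup _ (isoComp_le_iSup lam hw) h0 hl.1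
  refine hK.eq_of_isoComp_ne_bot (hK.isoComp_le lam hw) h0 hl (fun h => h0 ?_) q.2 hq
  rw [h] at hw
  exact (Submodule.mem_bot ℂ).mp hw

/-- A nonzero intersection is stable, so it contains a lowest weight vector; its weight would have
to belong to `lam` and also to another component. -/
lemma disjoint_isoComp (lam : Module.Dual ℂ H) :
    Disjoint (isoComp b E K lam)
      (⨆ mu : {mu : Module.Dual ℂ H // mu ≠ lam}, isoComp b E K mu.1) := by
  rw [Submodule.disjoint_def]
  intro x hx1 hx2
  by_contra hx0
  have hst : IsStable E (isoComp b E K lam ⊓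
      ⨆ mu : {mu : Module.Dual ℂ H // mu ≠ lam}, isoComp b E K mu.1) :=
    (isStable_isoComp lam).inf (isStable_iSup fun mu => isStable_isoComp mu.1)
  have hle : isoComp b E K lam ⊓
      ⨆ mu : {mu : Module.Dual ℂ H // mu ≠ lam}, isoComp b E K mu.1 ≤ K :=
    inf_le_left.trans (hK.isoComp_le lam)
  obtain ⟨w, hw, h0, ν, hl⟩ := hK.exists_isLowest hle hst
    ((Submodule.ne_bot_iff _).mpr ⟨x, Submodule.mem_inf.mpr ⟨hx1, hx2⟩, hx0⟩)
  rw [Submodule.mem_inf] at hw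
  obtain ⟨hw1, hw2⟩ := hw
  have hlam := hK.eq_of_mem_isoComp h0 hl hw1
  have hwK := hK.isoComp_le lam hw1
  obtain ⟨r, hq⟩ := exists_eq_of_mem_iSup _ (iSup_isoComp_le (· ≠ lam) hw2) h0 hl.1
  exact r.1.2.1 ((hK.eq_of_isoComp_ne_bot hwK h0 hl r.1.2.2 r.2.2 hq).trans hlam.symm)

/-- A nonzero component of an element of a stable space comes from a lowest weight vector of that
space. -/
lemma exists_isLowest_of_component (hNK : N ≤ K) (hN : IsStable E N) {w x : L →ₗ[ℂ] L →ₗ[ℂ] L}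
    (hw : w ∈ N) {lam : Module.Dual ℂ H} (hx : x ∈ isoComp b E K lam) (hx0 : x ≠ 0)
    (hwx : w - x ∈ ⨆ mu : {mu : Module.Dual ℂ H // mu ≠ lam}, isoComp b E K mu.1) :
    ∃ v ∈ N, v ≠ 0 ∧ IsLowest b E (-lam) v := by
  refine exists_isLowest_of_isoComp_ne_bot fun hbot => hx0 ?_
  have h1 := hK.le_iSup_isoComp hNK hN hw
  have h2 : w ∈ ⨆ mu : {mu : Module.Dual ℂ H // mu ≠ lam}, isoComp b E K mu.1 := by
    refine SetLike.le_def.mp (iSup_le fun mu => ?_) h1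
    by_cases hmu : mu = lam
    · rw [hmu, hbot]; exact bot_le
    · exact (isoComp_mono hNK mu).trans
        (le_iSup (fun mu : {mu : Module.Dual ℂ H // mu ≠ lam} => isoComp b E K mu.1) ⟨mu, hmu⟩)
  have h3 := sub_mem h2 hwx
  rw [sub_sub_cancel] at h3
  exact Submodule.disjoint_def.mp (hK.disjoint_isoComp lam) x hx h3

/-- A harmonic element belongs to a space that contains the isotypical components for which its
component is nonzero. -/
lemma mem_of_components {w : L →ₗ[ℂ] L →ₗ[ℂ] L} (hw : w ∈ K)
    (h : ∀ lam : Module.Dual ℂ H, (∃ x ∈ isoComp b E K lam, x ≠ 0 ∧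
      w - x ∈ ⨆ mu : {mu : Module.Dual ℂ H // mu ≠ lam}, isoComp b E K mu.1) →
      isoComp b E K lam ≤ N) : w ∈ N := by
  have h1 := hK.le_iSup_isoComp le_rfl hK.stable hw
  rw [Submodule.mem_iSup_iff_exists_finsupp] at h1
  obtain ⟨f, hf, hs⟩ := h1
  rw [← hs]
  refine Submodule.sum_mem _ fun lam hlam => h lam ⟨f lam, hf lam, Finsupp.mem_support_iff.mp hlam,
    ?_⟩ (hf lam)
  classical
  rw [← hs, Finsupp.sum, Finset.sum_eq_add_sum_sdiff_singleton_of_mem hlam, add_sub_cancel_left]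
  refine Submodule.sum_mem _ fun mu hmu => ?_
  exact Submodule.mem_iSup_of_mem (p := fun mu : {mu : Module.Dual ℂ H // mu ≠ lam} =>
    isoComp b E K mu.1) ⟨mu, by simpa using (Finset.mem_sdiff.mp hmu).2⟩ (hf mu)

end IsHarmonicModel

end CartanWeight

/-! ### The vanishing criterion for entries. -/

namespace CartanWeight

open LieAlgebra LieAlgebra.IsKilling LieModule RootForm

variable {L : Type*} [LieRing L] [LieAlgebra ℂ L] [Module.Finite ℂ L] [LieAlgebra.IsKilling ℂ L]
  {H : LieSubalgebra ℂ L} [H.IsCartanSubalgebra] {b : (rootSystem H).Base} {E E' : H}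
  {K : Submodule ℂ (L →ₗ[ℂ] L →ₗ[ℂ] L)}

/-- The elements of `K` that vanish upon insertion of an element of level zero for `E'`. -/
def noEntries (K : Submodule ℂ (L →ₗ[ℂ] L →ₗ[ℂ] L)) (E' : H) :
    Submodule ℂ (L →ₗ[ℂ] L →ₗ[ℂ] L) where
  carrier := {w | w ∈ K ∧ ∀ x, ⁅(E' : L), x⁆ = 0 → ∀ y, w x y = 0}
  add_mem' := by
    rintro v w ⟨h1, h2⟩ ⟨h3, h4⟩
    exact ⟨add_mem h1 h3, fun x hx y => by simp [h2 x hx y, h4 x hx y]⟩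
  zero_mem' := ⟨zero_mem _, fun _ _ _ => rfl⟩
  smul_mem' := by
    rintro c w ⟨h1, h2⟩
    exact ⟨K.smul_mem c h1, fun x hx y => by simp [h2 x hx y]⟩

lemma mem_noEntries {w : L →ₗ[ℂ] L →ₗ[ℂ] L} :
    w ∈ noEntries K E' ↔ w ∈ K ∧ ∀ x, ⁅(E' : L), x⁆ = 0 → ∀ y, w x y = 0 := Iff.rfl

/-- `E'` defines a coarser grading than `E`. -/
structure IsCoarser (b : (rootSystem H).Base) (E E' : H) : Prop where
  simple : ∀ i ∈ b.support, (rootSystem H).root i E' = 0 ∨ (rootSystem H).root i E' = 1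
  apply_eq_zero : ∀ i ∈ b.support, (rootSystem H).root i E = 0 → (rootSystem H).root i E' = 0

/-- The component of `w` in the isotypical component of `lam` is nonzero. -/
def HasComp (b : (rootSystem H).Base) (E : H) (K : Submodule ℂ (L →ₗ[ℂ] L →ₗ[ℂ] L))
    (lam : Module.Dual ℂ H) (w : L →ₗ[ℂ] L →ₗ[ℂ] L) : Prop :=
  ∃ x ∈ isoComp b E K lam, x ≠ 0 ∧
    w - x ∈ ⨆ mu : {mu : Module.Dual ℂ H // mu ≠ lam}, isoComp b E K mu.1

lemma IsCoarser.posCone (h : IsCoarser b E E')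
    (hs : ∀ i ∈ b.support, (rootSystem H).root i E = 0 ∨ (rootSystem H).root i E = 1)
    {q : Module.Dual ℂ H} (hq : q ∈ posCone b) (hE : q E = 0) : q E' = 0 := by
  have key : ∃ n m : ℕ, q E = n ∧ q E' = m ∧ (n = 0 → m = 0) := by
    clear hE
    induction hq using AddSubmonoid.closure_induction with
    | mem x hx =>
      obtain ⟨i, hi, rfl⟩ := hx
      rcases hs i hi with h1 | h1
      · exact ⟨0, 0, by simpa using h1, by simpa using h.apply_eq_zero i hi h1, fun _ => rfl⟩
      · rcases h.simple i hi with h2 | h2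
        · exact ⟨1, 0, by simpa using h1, by simpa using h2, fun _ => rfl⟩
        · exact ⟨1, 1, by simpa using h1, by simpa using h2, fun h => h⟩
    | zero => exact ⟨0, 0, by simp, by simp, fun _ => rfl⟩
    | add x y _ _ hx hy =>
      obtain ⟨n, m, h1, h2, h3⟩ := hx
      obtain ⟨n', m', h4, h5, h6⟩ := hy
      refine ⟨n + n', m + m', ?_, ?_, fun h => ?_⟩
      · rw [LinearMap.add_apply, h1, h4]; push_cast; rfl
      · rw [LinearMap.add_apply, h2, h5]; push_cast; rfl
      · rw [h3 (by lia), h6 (by lia)]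
  obtain ⟨n, m, h1, h2, h3⟩ := key
  rw [h1] at hE
  rw [h2, h3 (by exact_mod_cast hE), Nat.cast_zero]

lemma IsCoarser.wt_eq_zero (h : IsCoarser b E E')
    (hs : ∀ i ∈ b.support, (rootSystem H).root i E = 0 ∨ (rootSystem H).root i E = 1)
    {k : FrameIndex H} (hE : wt H k E = 0) : wt H k E' = 0 := by
  cases k with
  | inl i => rfl
  | inr α =>
    change (rootSystem H).root α E = 0 at hE
    change (rootSystem H).root α E' = 0
    by_cases hα : b.IsPos α
    · exact h.posCone hs ((root_mem_posCone_iff b).mpr hα) hE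
    · have := h.posCone hs ((neg_root_mem_posCone_iff b).mpr hα)
        (by rw [LinearMap.neg_apply, hE, neg_zero])
      rwa [LinearMap.neg_apply, neg_eq_zero] at this

lemma IsCoarser.lie_eq_zero (h : IsCoarser b E E')
    (hs : ∀ i ∈ b.support, (rootSystem H).root i E = 0 ∨ (rootSystem H).root i E = 1) {A : L}
    (hA : ⁅(E : L), A⁆ = 0) : ⁅(E' : L), A⁆ = 0 := by
  change A ∈ LinearMap.ker (LieAlgebra.ad ℂ L (E' : L))
  refine mem_of_vec_mem (fun k hk => ?_) hA
  exact lie_eq_zero_of_apply_eq_zero (h.wt_eq_zero hs hk) (vec_mem H k)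

namespace IsHarmonicModel

variable (hK : IsHarmonicModel b E K)
include hK

lemma isStable_noEntries (h : IsCoarser b E E') : IsStable E (noEntries K E') := by
  rintro A hA w ⟨hw, hw'⟩
  refine ⟨hK.stable A hA w hw, fun x hx y => ?_⟩
  have h1 : ⁅(E' : L), ⁅A, x⁆⁆ = 0 := by
    rw [leibniz_lie, h.lie_eq_zero hK.simple hA, hx, zero_lie, lie_zero, add_zero]
  simp [LieHom.lie_apply, hw' x hx, hw' _ h1]

/-- A lowest weight vector attains equality in the norm estimate, which determines both the weight
and the arguments on which it can be nonzero. -/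
lemma exists_pair {w : L →ₗ[ℂ] L →ₗ[ℂ] L} (hw : w ∈ K) (h0 : w ≠ 0) {ν : Module.Dual ℂ H}
    (hl : IsLowest b E (-ν) w) {k l : FrameIndex H} (hkl : w (vec H k) (vec H l) ≠ 0) :
    ∃ a ∈ b.support, ∃ c ∈ b.support, ∃ m, a ≠ c ∧ IsHighest b m ∧
      ν = (rootSystem H).reflection a ((rootSystem H).reflection c
        ((rootSystem H).root m + halfSum b)) - halfSum b ∧
      (wt H k = -(rootSystem H).root a ∧
        wt H l = -(rootSystem H).root ((rootSystem H).reflectionPerm a c) ∨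
      wt H l = -(rootSystem H).root a ∧
        wt H k = -(rootSystem H).root ((rootSystem H).reflectionPerm a c)) := by
  obtain ⟨β, γ, μ, h, hk, hl', -, -⟩ :=
    hK.isPairSum_of_apply_ne_zero hw hl.1 (vec_mem H k) (vec_mem H l) hkl
  obtain ⟨a, ha, c, hc, m, hac, hm, hν, h3⟩ :=
    h.exists_reflections (isDualKillingForm H) (hK.norm_eq hw h0 hl)
  refine ⟨a, ha, c, hc, m, hac, hm, eq_sub_of_add_eq hν, ?_⟩
  rw [hk, hl']
  rcases h3 with ⟨rfl, rfl⟩ | ⟨rfl, rfl⟩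
  · exact Or.inl ⟨rfl, rfl⟩
  · exact Or.inr ⟨rfl, rfl⟩

omit hK in
lemma not_nonneg_iff {a c i m : H.root} (ha : a ∈ b.support) (hc : c ∈ b.support)
    (hac : a ≠ c) (hm : IsHighest b m) (hi : i ∈ b.support) :
    ¬ 0 ≤ dualForm H ((rootSystem H).root i) ((rootSystem H).reflection a
      ((rootSystem H).reflection c ((rootSystem H).root m + halfSum b)) - halfSum b) ↔
    i = a ∨ (i = c ∧ dualForm H ((rootSystem H).root a) ((rootSystem H).root c) = 0) := by
  obtain ⟨r, hr, h⟩ := simple_pairing_lt_zero_iff (isDualKillingForm H) ha hc hac hm hi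
  rw [hr, ← h, Complex.zero_le_real, not_le]

omit hK in
lemma root_reflectionPerm_eq {a c : H.root}
    (h : dualForm H ((rootSystem H).root a) ((rootSystem H).root c) = 0) :
    (rootSystem H).root ((rootSystem H).reflectionPerm a c) = (rootSystem H).root c := by
  have h1 := (isDualKillingForm H).two_mul a ((rootSystem H).root c)
  rw [(isDualKillingForm H).symm, h, mul_zero] at h1
  have h2 := (mul_eq_zero.mp h1.symm).resolve_left ((isDualKillingForm H).ne_zero a)
  rw [RootPairing.root_reflectionPerm, RootPairing.reflection_apply, h2, zero_smul, sub_zero]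

-- If `α_a` and `α_c` are not orthogonal, `s_a α_c` is `α_c` plus a positive multiple of `α_a`, so
-- its level is positive as soon as that of `α_a` is.
omit hK in
lemma reflection_apply_ne_zero (hE' : ∀ i ∈ b.support,
      (rootSystem H).root i E' = 0 ∨ (rootSystem H).root i E' = 1) {a c : H.root}
    (ha : a ∈ b.support) (hc : c ∈ b.support) (hac : a ≠ c) (ha' : (rootSystem H).root a E' ≠ 0)
    (hc' : dualForm H ((rootSystem H).root a) ((rootSystem H).root c) = 0 →
      (rootSystem H).root c E' ≠ 0) :
    (rootSystem H).root ((rootSystem H).reflectionPerm a c) E' ≠ 0 := by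
  by_cases h0 : dualForm H ((rootSystem H).root a) ((rootSystem H).root c) = 0
  · rw [root_reflectionPerm_eq h0]
    exact hc' h0
  have h1 : (rootSystem H).coroot' a ((rootSystem H).root c) =
      ((rootSystem H).pairingIn ℤ c a : ℂ) := by
    rw [RootPairing.root_coroot'_eq_pairing, ← (rootSystem H).algebraMap_pairingIn ℤ]; simp
  have h2 := b.pairingIn_le_zero_of_ne hac.symm hc ha
  have h3 : (rootSystem H).pairingIn ℤ c a ≠ 0 := fun h => h0 (by
    rw [(isDualKillingForm H).symm]
    exact (pairingIn_simple_eq_zero_iff (isDualKillingForm H)).mp h)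
  rw [RootPairing.root_reflectionPerm, RootPairing.reflection_apply, h1, LinearMap.sub_apply,
    LinearMap.smul_apply, (hE' a ha).resolve_left ha', smul_eq_mul, mul_one]
  set z := (rootSystem H).pairingIn ℤ c a
  rcases hE' c hc with h | h <;> rw [h] <;> norm_cast <;> lia

/-- The first part identifies the weight; the second matches the arguments `-α_a` and `-s_a α_c`
with the simple roots on which `ν` is negative. -/
lemma mem_noEntries_iff_of_isLowest (h : IsCoarser b E E') {w : L →ₗ[ℂ] L →ₗ[ℂ] L} (hw : w ∈ K)
    (h0 : w ≠ 0) {ν : Module.Dual ℂ H} (hl : IsLowest b E (-ν) w) :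
    (∃ a ∈ b.support, ∃ c ∈ b.support, ∃ m, a ≠ c ∧ IsHighest b m ∧
      ν = (rootSystem H).reflection a ((rootSystem H).reflection c
        ((rootSystem H).root m + halfSum b)) - halfSum b) ∧
    (w ∈ noEntries K E' ↔ ∀ i ∈ b.support, ¬ 0 ≤ dualForm H ((rootSystem H).root i) ν →
      (rootSystem H).root i E' ≠ 0) := by
  obtain ⟨k, hk⟩ : ∃ k, w (vec H k) ≠ 0 := by
    by_contra! hcon
    refine h0 (LinearMap.ext fun y => ?_)
    rw [← sum_vec H y]
    simp [hcon]
  obtain ⟨l, hkl⟩ := hK.exists_apply_vec_ne_zero hk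
  obtain ⟨a, ha, c, hc, m, hac, hm, hν, h3⟩ := hK.exists_pair hw h0 hl hkl
  refine ⟨⟨a, ha, c, hc, m, hac, hm, hν⟩, fun hN i hi hneg hiE => ?_, fun hi => ⟨hw, ?_⟩⟩
  · rw [hν, not_nonneg_iff ha hc hac hm hi] at hneg
    have hkE : wt H k E' ≠ 0 := fun hE =>
      hkl (hN.2 _ (lie_eq_zero_of_apply_eq_zero hE (vec_mem H k)) _)
    have hlE : wt H l E' ≠ 0 := fun hE => hkl (by
      rw [hK.swap hw, hN.2 _ (lie_eq_zero_of_apply_eq_zero hE (vec_mem H l)), neg_zero])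
    -- A simple root with negative pairing occurs as one of the two arguments: `a` always, and `c`
    -- when orthogonality gives `s_a α_c = α_c`.
    have h4 : wt H k = -(rootSystem H).root i ∨ wt H l = -(rootSystem H).root i := by
      rcases hneg with rfl | ⟨rfl, hF⟩
      · exact h3.imp And.left And.left
      · rw [root_reflectionPerm_eq hF] at h3
        exact h3.symm.imp And.right And.right
    rcases h4 with h4 | h4
    · exact hkE (by rw [h4, LinearMap.neg_apply, hiE, neg_zero])
    · exact hlE (by rw [h4, LinearMap.neg_apply, hiE, neg_zero])
  · intro x hx
    suffices hwx : w x = 0 by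
      intro y
      rw [hwx, LinearMap.zero_apply]
    change x ∈ LinearMap.ker w
    refine mem_of_vec_mem (fun k hk => ?_) hx
    rw [LinearMap.mem_ker]
    by_contra hne
    obtain ⟨l, hkl⟩ := hK.exists_apply_vec_ne_zero hne
    -- The pair may depend on the entry considered, but it represents the same weight `ν`, and the
    -- hypothesis is phrased through `ν` alone.
    obtain ⟨a, ha, c, hc, m, hac, hm, hν, h3⟩ := hK.exists_pair hw h0 hl hkl
    rw [hν] at hi
    have ha' := hi a ha ((not_nonneg_iff ha hc hac hm ha).mpr (Or.inl rfl))
    have hr := reflection_apply_ne_zero h.simple ha hc hac ha' fun hF =>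
      hi c hc ((not_nonneg_iff ha hc hac hm hc).mpr (Or.inr ⟨rfl, hF⟩))
    rcases h3 with ⟨h4, -⟩ | ⟨-, h4⟩
    · rw [h4, LinearMap.neg_apply, neg_eq_zero] at hk
      exact ha' hk
    · rw [h4, LinearMap.neg_apply, neg_eq_zero] at hk
      exact hr hk

/-- A harmonic element vanishes upon insertion of elements of level zero for `E'` if and only if
the weights of its nonzero components are nonnegative on the simple roots of level zero. -/
theorem mem_noEntries_iff (h : IsCoarser b E E') {w : L →ₗ[ℂ] L →ₗ[ℂ] L} (hw : w ∈ K) :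
    w ∈ noEntries K E' ↔ ∀ a ∈ b.support, ∀ c ∈ b.support, a ≠ c → ∀ m, IsHighest b m →
      HasComp b E K ((rootSystem H).reflection a ((rootSystem H).reflection c
        ((rootSystem H).root m + halfSum b)) - halfSum b) w → ∀ i ∈ b.support,
      ¬ 0 ≤ dualForm H ((rootSystem H).root i) ((rootSystem H).reflection a
        ((rootSystem H).reflection c ((rootSystem H).root m + halfSum b)) - halfSum b) →
      (rootSystem H).root i E' ≠ 0 := by
  have hst := hK.isStable_noEntries h
  have hle : noEntries K E' ≤ K := fun w hw => hw.1
  refine ⟨fun hN a ha c hc hac m hm hcomp i hi hneg => ?_,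
    fun hcomp => hK.mem_of_components hw fun lam hlam => leviSpan_le ?_ hst⟩
  · obtain ⟨x, hx, hx0, hwx⟩ := hcomp
    obtain ⟨v, hv, hv0, hvl⟩ := hK.exists_isLowest_of_component hle hst hN hx hx0 hwx
    -- The stable subspace itself contains a lowest weight vector for each component met by `w`, so
    -- the criterion can be read off there.
    exact (hK.mem_noEntries_iff_of_isLowest h (hle hv) hv0 hvl).2.mp hv i hi hneg
  · rintro v ⟨hv, hvl⟩
    by_cases hv0 : v = 0
    · rw [hv0]; exact zero_mem _
    obtain ⟨⟨a, ha, c, hc, m, hac, hm, rfl⟩, h2⟩ :=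
      hK.mem_noEntries_iff_of_isLowest h hv hv0 hvl
    exact h2.mpr fun i hi hneg => hcomp a ha c hc hac m hm hlam i hi hneg

end IsHarmonicModel

end CartanWeight

/-! ### Real and imaginary parts; complexified bilinear maps. -/

namespace Parabolic

section RealStructure

variable {V : Type*} [AddCommGroup V] [Module ℝ V]

lemma exists_eq_add_I_smul (t : ℂ ⊗[ℝ] V) :
    ∃ a b : V, t = (1 : ℂ) ⊗ₜ[ℝ] a + Complex.I • (1 : ℂ) ⊗ₜ[ℝ] b := by
  induction t using TensorProduct.induction_on with
  | zero => exact ⟨0, 0, by simp⟩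
  | tmul z v =>
    refine ⟨z.re • v, z.im • v, ?_⟩
    rw [TensorProduct.tmul_smul, TensorProduct.tmul_smul, TensorProduct.smul_tmul',
      TensorProduct.smul_tmul', TensorProduct.smul_tmul', ← TensorProduct.add_tmul]
    congr 1
    apply Complex.ext <;> simp
  | add x y hx hy =>
    obtain ⟨a, b, rfl⟩ := hx
    obtain ⟨c, d, rfl⟩ := hy
    refine ⟨a + c, b + d, ?_⟩
    rw [TensorProduct.tmul_add, TensorProduct.tmul_add, smul_add]
    abel

lemma eq_zero_of_add_I_smul {a b : V}
    (h : (1 : ℂ) ⊗ₜ[ℝ] a + Complex.I • (1 : ℂ) ⊗ₜ[ℝ] b = 0) : a = 0 ∧ b = 0 := by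
  have key : ∀ f : ℂ →ₗ[ℝ] ℝ, f 1 • a + f Complex.I • b = 0 := by
    intro f
    have h1 := congrArg (fun t => TensorProduct.lid ℝ V (f.rTensor V t)) h
    simpa [TensorProduct.smul_tmul'] using h1
  have h1 := key Complex.reLm
  have h2 := key Complex.imLm
  simp only [Complex.reLm_coe, Complex.imLm_coe, Complex.one_re, Complex.one_im, Complex.I_re,
    Complex.I_im, one_smul, zero_smul, add_zero, zero_add] at h1 h2
  exact ⟨h1, h2⟩

lemma one_tmul_injective : Function.Injective fun v : V => (1 : ℂ) ⊗ₜ[ℝ] v := by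
  intro a b h
  have h1 := eq_zero_of_add_I_smul (a := a - b) (b := 0) (by
    dsimp only at h
    rw [TensorProduct.tmul_sub, h]; simp)
  exact sub_eq_zero.mp h1.1

lemma mem_baseChange_induction {p : Submodule ℝ V} {q : Submodule ℂ (ℂ ⊗[ℝ] V)}
    (h : ∀ v ∈ p, (1 : ℂ) ⊗ₜ[ℝ] v ∈ q) : p.baseChange ℂ ≤ q := by
  rw [Submodule.baseChange_eq_span, Submodule.span_le]
  rintro _ ⟨v, hv, rfl⟩
  exact h v hv

lemma one_tmul_mem_baseChange {p : Submodule ℝ V} {v : V} (h : v ∈ p) :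
    (1 : ℂ) ⊗ₜ[ℝ] v ∈ p.baseChange ℂ := Submodule.tmul_mem_baseChange_of_mem 1 h

end RealStructure

section Complexify

variable {𝔤 : Type*} [LieRing 𝔤] [LieAlgebra ℝ 𝔤]

lemma one_tmul_lie (x y : 𝔤) :
    ⁅(1 : ℂ) ⊗ₜ[ℝ] x, (1 : ℂ) ⊗ₜ[ℝ] y⁆ = (1 : ℂ) ⊗ₜ[ℝ] ⁅x, y⁆ := by
  rw [LieAlgebra.ExtendScalars.bracket_tmul, one_mul]

lemma ad_one_tmul (x y : 𝔤) : LieAlgebra.ad ℂ (ℂ ⊗[ℝ] 𝔤) ((1 : ℂ) ⊗ₜ[ℝ] x) ((1 : ℂ) ⊗ₜ[ℝ] y) =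
    (1 : ℂ) ⊗ₜ[ℝ] ⁅x, y⁆ := one_tmul_lie x y

lemma lie_add_I_smul {A a b : 𝔤} {c : ℝ}
    (h : LieAlgebra.ad ℂ (ℂ ⊗[ℝ] 𝔤) ((1 : ℂ) ⊗ₜ[ℝ] A)
        ((1 : ℂ) ⊗ₜ[ℝ] a + Complex.I • (1 : ℂ) ⊗ₜ[ℝ] b) =
      (c : ℂ) • ((1 : ℂ) ⊗ₜ[ℝ] a + Complex.I • (1 : ℂ) ⊗ₜ[ℝ] b)) :
    ⁅A, a⁆ = c • a ∧ ⁅A, b⁆ = c • b := by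
  have hc : ∀ v : 𝔤, (c : ℂ) • (1 : ℂ) ⊗ₜ[ℝ] v = (1 : ℂ) ⊗ₜ[ℝ] (c • v) := by
    intro v
    rw [TensorProduct.tmul_smul, TensorProduct.smul_tmul', TensorProduct.smul_tmul']
    simp
  rw [map_add, map_smul, ad_one_tmul, ad_one_tmul, smul_add, smul_comm (c : ℂ) Complex.I,
    hc, hc, ← sub_eq_zero, add_sub_add_comm, ← smul_sub, ← TensorProduct.tmul_sub,
    ← TensorProduct.tmul_sub] at h
  obtain ⟨h1, h2⟩ := eq_zero_of_add_I_smul h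
  exact ⟨sub_eq_zero.mp h1, sub_eq_zero.mp h2⟩

/-- The complexification of a bilinear map. -/
def complexify : (𝔤 →ₗ[ℝ] 𝔤 →ₗ[ℝ] 𝔤) →ₗ[ℝ]
    ((ℂ ⊗[ℝ] 𝔤) →ₗ[ℂ] (ℂ ⊗[ℝ] 𝔤) →ₗ[ℂ] (ℂ ⊗[ℝ] 𝔤)) where
  toFun B := LinearMap.BilinMap.baseChange ℂ B
  map_add' B C := by
    ext x y
    simp [TensorProduct.tmul_add]
  map_smul' c B := by
    ext x y
    simp

@[simp]
lemma complexify_tmul (B : 𝔤 →ₗ[ℝ] 𝔤 →ₗ[ℝ] 𝔤) (z w : ℂ) (x y : 𝔤) :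
    complexify B (z ⊗ₜ[ℝ] x) (w ⊗ₜ[ℝ] y) = (z * w) ⊗ₜ[ℝ] B x y :=
  LinearMap.BilinMap.baseChange_tmul ..

lemma bilin_ext {B C : (ℂ ⊗[ℝ] 𝔤) →ₗ[ℂ] (ℂ ⊗[ℝ] 𝔤) →ₗ[ℂ] (ℂ ⊗[ℝ] 𝔤)}
    (h : ∀ x y : 𝔤, B (1 ⊗ₜ[ℝ] x) (1 ⊗ₜ[ℝ] y) = C (1 ⊗ₜ[ℝ] x) (1 ⊗ₜ[ℝ] y)) : B = C := by
  ext x y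
  simpa using h x y

lemma complexify_lie (A : 𝔤) (B : 𝔤 →ₗ[ℝ] 𝔤 →ₗ[ℝ] 𝔤) :
    complexify ⁅A, B⁆ = ⁅(1 : ℂ) ⊗ₜ[ℝ] A, complexify B⁆ := by
  refine bilin_ext fun x y => ?_
  simp only [complexify_tmul, LieHom.lie_apply, LinearMap.sub_apply, one_tmul_lie, mul_one,
    TensorProduct.tmul_sub]

lemma complexify_alt {B : 𝔤 →ₗ[ℝ] 𝔤 →ₗ[ℝ] 𝔤} (hB : ∀ x, B x x = 0) (x : ℂ ⊗[ℝ] 𝔤) :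
    complexify B x x = 0 := by
  obtain ⟨a, b, rfl⟩ := exists_eq_add_I_smul x
  have h := hB (a + b)
  simp only [map_add, LinearMap.add_apply, hB, zero_add, add_zero] at h
  simp only [map_add, map_smul, LinearMap.add_apply, LinearMap.smul_apply, complexify_tmul, hB,
    mul_one, TensorProduct.tmul_zero, smul_zero, zero_add, add_zero]
  rw [← smul_add, ← TensorProduct.tmul_add, h]
  simp

lemma complexify_apply_eq_zero {B : 𝔤 →ₗ[ℝ] 𝔤 →ₗ[ℝ] 𝔤} {a b : 𝔤} (ha : B a = 0) (hb : B b = 0) :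
    complexify B ((1 : ℂ) ⊗ₜ[ℝ] a + Complex.I • (1 : ℂ) ⊗ₜ[ℝ] b) = 0 := by
  ext y
  simp [ha, hb]

lemma complexify_add_I_smul {B C : 𝔤 →ₗ[ℝ] 𝔤 →ₗ[ℝ] 𝔤}
    (h : complexify B + Complex.I • complexify C = 0) : B = 0 ∧ C = 0 := by
  have key : ∀ x y, B x y = 0 ∧ C x y = 0 := by
    intro x y
    have h1 := congrArg (fun f => f (1 ⊗ₜ[ℝ] x) (1 ⊗ₜ[ℝ] y)) h
    simp only [LinearMap.add_apply, LinearMap.smul_apply, complexify_tmul, mul_one,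
      LinearMap.zero_apply] at h1
    exact eq_zero_of_add_I_smul h1
  exact ⟨LinearMap.ext₂ fun x y => (key x y).1, LinearMap.ext₂ fun x y => (key x y).2⟩

lemma killingForm_one_tmul [Module.Finite ℝ 𝔤] (x y : 𝔤) :
    killingForm ℂ (ℂ ⊗[ℝ] 𝔤) (1 ⊗ₜ[ℝ] x) (1 ⊗ₜ[ℝ] y) = (killingForm ℝ 𝔤 x y : ℂ) := by
  have h3 : killingForm ℂ (ℂ ⊗[ℝ] 𝔤) = LinearMap.BilinForm.baseChange ℂ (killingForm ℝ 𝔤) :=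
    LieModule.traceForm_baseChange ℝ 𝔤 𝔤 ℂ
  rw [h3, LinearMap.BilinForm.baseChange_tmul]
  simp

/-- The complexification of the endomorphism given by a tensor. -/
lemma sum_killingForm_tmul [Module.Finite ℝ 𝔤] {I : Type*} [Fintype I] (u v : I → 𝔤) (a b : 𝔤) :
    ∑ i, killingForm ℂ (ℂ ⊗[ℝ] 𝔤) (1 ⊗ₜ[ℝ] u i)
        ((1 : ℂ) ⊗ₜ[ℝ] a + Complex.I • (1 : ℂ) ⊗ₜ[ℝ] b) • ((1 : ℂ) ⊗ₜ[ℝ] v i) =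
      (1 : ℂ) ⊗ₜ[ℝ] (∑ i, killingForm ℝ 𝔤 (u i) a • v i) +
        Complex.I • (1 : ℂ) ⊗ₜ[ℝ] (∑ i, killingForm ℝ 𝔤 (u i) b • v i) := by
  simp only [TensorProduct.tmul_sum, Finset.smul_sum, ← Finset.sum_add_distrib]
  refine Finset.sum_congr rfl fun i _ => ?_
  rw [map_add, map_smul, killingForm_one_tmul, killingForm_one_tmul, add_smul, smul_assoc]
  simp only [TensorProduct.tmul_smul, TensorProduct.smul_tmul']
  simp

end Complexify

end Parabolic

/-! ### The complexified harmonic space as a harmonic model. -/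

namespace Parabolic

open LieAlgebra LieAlgebra.IsKilling CartanWeight

variable {𝔤 : Type*} [LieRing 𝔤] [LieAlgebra ℝ 𝔤] [Module.Finite ℝ 𝔤] [LieAlgebra.IsKilling ℝ 𝔤]
  {ι : Type*} [Fintype ι] {D : SimpleRestrictedRoots 𝔤 ι} {Ξ : Set ι}
  {H : LieSubalgebra ℂ (ℂ ⊗[ℝ] 𝔤)} [H.IsCartanSubalgebra] {b : (rootSystem H).Base}

/-- The element of `H` whose adjoint action induces the grading by `Ξ`-heights. -/
def cartanGrading (hb : IsAdapted b D) (Ξ : Set ι) : H :=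
  ⟨(1 : ℂ) ⊗ₜ[ℝ] (gradingElement D Ξ : 𝔤), hb.mem _ (gradingElement D Ξ).2⟩

lemma RestrictsTo.apply_cartanGrading {α : Module.Dual ℂ H} {lam : Module.Dual ℝ D.𝔞}
    (h : RestrictsTo D α lam) (hb : IsAdapted b D) :
    α (cartanGrading hb Ξ) = (lam (gradingElement D Ξ) : ℂ) := h _ _

lemma apply_cartanGrading_of_simple {α : Module.Dual ℂ H} {j : ι}
    (h : RestrictsTo D α (D.simple j)) (hb : IsAdapted b D) (hj : j ∈ Ξ) :
    α (cartanGrading hb Ξ) = 1 := by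
  rw [h.apply_cartanGrading hb, simple_gradingElement, Set.indicator_of_mem hj]
  simp

lemma apply_cartanGrading_of_notMem {α : Module.Dual ℂ H} {j : ι}
    (h : RestrictsTo D α (D.simple j)) (hb : IsAdapted b D) (hj : j ∉ Ξ) :
    α (cartanGrading hb Ξ) = 0 := by
  rw [h.apply_cartanGrading hb, simple_gradingElement, Set.indicator_of_notMem hj]
  simp

lemma apply_cartanGrading_of_zero {α : Module.Dual ℂ H}
    (h : RestrictsTo D α 0) (hb : IsAdapted b D) : α (cartanGrading hb Ξ) = 0 := by
  rw [h.apply_cartanGrading hb]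
  simp

lemma exists_restrictsTo (hb : IsAdapted b D) {i : H.root} (hi : i ∈ b.support)
    (h : (rootSystem H).root i (cartanGrading hb Ξ) ≠ 0) :
    ∃ j ∈ Ξ, RestrictsTo D ((rootSystem H).root i) (D.simple j) := by
  rcases hb.restricts i hi with h1 | ⟨j, h1⟩
  · exact absurd (apply_cartanGrading_of_zero h1 hb) h
  · by_cases hj : j ∈ Ξ
    · exact ⟨j, hj, h1⟩
    · exact absurd (apply_cartanGrading_of_notMem h1 hb hj) h

lemma root_cartanGrading (hb : IsAdapted b D) (i : H.root) (hi : i ∈ b.support) :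
    (rootSystem H).root i (cartanGrading hb Ξ) = 0 ∨
      (rootSystem H).root i (cartanGrading hb Ξ) = 1 := by
  by_cases h : (rootSystem H).root i (cartanGrading hb Ξ) = 0
  · exact Or.inl h
  · obtain ⟨j, hj, h1⟩ := exists_restrictsTo hb hi h
    exact Or.inr (apply_cartanGrading_of_simple h1 hb hj)

lemma isCoarser_cartanGrading (hb : IsAdapted b D) {Ξ' : Set ι} (h : Ξ' ⊆ Ξ) :
    IsCoarser b (cartanGrading hb Ξ) (cartanGrading hb Ξ') where
  simple := root_cartanGrading hb
  apply_eq_zero i hi h0 := by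
    by_contra hne
    obtain ⟨j, hj, h1⟩ := exists_restrictsTo hb hi hne
    rw [apply_cartanGrading_of_simple h1 hb (h hj)] at h0
    exact one_ne_zero h0

lemma lie_cartanGrading (hb : IsAdapted b D) {a a' : 𝔤} {c : ℝ}
    (h : ⁅(cartanGrading hb Ξ : ℂ ⊗[ℝ] 𝔤), (1 : ℂ) ⊗ₜ[ℝ] a + Complex.I • (1 : ℂ) ⊗ₜ[ℝ] a'⁆ =
      (c : ℂ) • ((1 : ℂ) ⊗ₜ[ℝ] a + Complex.I • (1 : ℂ) ⊗ₜ[ℝ] a')) :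
    ⁅(gradingElement D Ξ : 𝔤), a⁆ = c • a ∧ ⁅(gradingElement D Ξ : 𝔤), a'⁆ = c • a' :=
  lie_add_I_smul h

variable (D Ξ) in
/-- The complex bilinear extension of the elements of `(Λ²(𝔤_{Ξ,-})^* ⊗ 𝔤)_ℂ` to `𝔤_ℂ`. -/
def complexExtend : ℂ ⊗[ℝ] BilinearCochain D Ξ →ₗ[ℂ]
    ((ℂ ⊗[ℝ] 𝔤) →ₗ[ℂ] (ℂ ⊗[ℝ] 𝔤) →ₗ[ℂ] (ℂ ⊗[ℝ] 𝔤)) :=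
  (complexify ∘ₗ extend D Ξ).liftBaseChange ℂ

@[simp]
lemma complexExtend_tmul (z : ℂ) (φ : BilinearCochain D Ξ) :
    complexExtend D Ξ (z ⊗ₜ[ℝ] φ) = z • complexify (extend D Ξ φ) := by
  simp [complexExtend]

lemma complexExtend_one_tmul (φ : BilinearCochain D Ξ) :
    complexExtend D Ξ (1 ⊗ₜ[ℝ] φ) = complexify (extend D Ξ φ) := by simp

lemma complexExtend_injective : Function.Injective (complexExtend D Ξ) := by
  refine (injective_iff_map_eq_zero _).mpr fun t ht => ?_
  obtain ⟨φ, ψ, rfl⟩ := exists_eq_add_I_smul t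
  rw [map_add, map_smul, complexExtend_one_tmul, complexExtend_one_tmul] at ht
  obtain ⟨h1, h2⟩ := complexify_add_I_smul ht
  rw [(map_eq_zero_iff _ (extend_injective D Ξ)).mp h1,
    (map_eq_zero_iff _ (extend_injective D Ξ)).mp h2]
  simp

lemma complexExtend_lie (A : ℂ ⊗[ℝ] gZero D Ξ) (v : ℂ ⊗[ℝ] BilinearCochain D Ξ) :
    complexExtend D Ξ ⁅A, v⁆ = ⁅gZeroIncl D Ξ A, complexExtend D Ξ v⁆ := by
  change complexExtend D Ξ (LieModule.toEnd ℂ (ℂ ⊗[ℝ] gZero D Ξ) (ℂ ⊗[ℝ] BilinearCochain D Ξ) A v) =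
    LieModule.toEnd ℂ (ℂ ⊗[ℝ] 𝔤) ((ℂ ⊗[ℝ] 𝔤) →ₗ[ℂ] (ℂ ⊗[ℝ] 𝔤) →ₗ[ℂ] (ℂ ⊗[ℝ] 𝔤))
      (gZeroIncl D Ξ A) (complexExtend D Ξ v)
  induction A using TensorProduct.induction_on with
  | zero => simp only [map_zero, LinearMap.zero_apply]
  | add A A' hA hA' => simp only [map_add, LinearMap.add_apply, hA, hA']
  | tmul z A =>
    induction v using TensorProduct.induction_on with
    | zero => simp only [map_zero]
    | add v v' hv hv' => simp only [map_add, hv, hv']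
    | tmul s φ =>
      have h1 : gZeroIncl D Ξ (z ⊗ₜ[ℝ] A) = z • (1 : ℂ) ⊗ₜ[ℝ] (A : 𝔤) := by
        rw [gZeroIncl, LinearMap.baseChange_tmul, TensorProduct.smul_tmul', smul_eq_mul, mul_one]
        rfl
      have h2 : LieModule.toEnd ℂ (ℂ ⊗[ℝ] gZero D Ξ) (ℂ ⊗[ℝ] BilinearCochain D Ξ)
          (z ⊗ₜ[ℝ] A) (s ⊗ₜ[ℝ] φ) = (z * s) ⊗ₜ[ℝ] ⁅A, φ⁆ :=
        LieAlgebra.ExtendScalars.bracket_tmul ..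
      rw [h2, complexExtend_tmul, complexExtend_tmul, h1, lie_extend', complexify_lie,
        map_smul, map_smul, LinearMap.smul_apply, smul_smul, mul_comm]
      rfl

lemma gZeroIncl_injective : Function.Injective (gZeroIncl D Ξ) :=
  Module.Flat.lTensor_preserves_injective_linearMap (M := ℂ) _
    (gZero D Ξ).toSubmodule.injective_subtype

lemma lie_gZeroIncl (hb : IsAdapted b D) (A : ℂ ⊗[ℝ] gZero D Ξ) :
    ⁅(cartanGrading hb Ξ : ℂ ⊗[ℝ] 𝔤), gZeroIncl D Ξ A⁆ = 0 := by
  change LieAlgebra.ad ℂ (ℂ ⊗[ℝ] 𝔤) (cartanGrading hb Ξ : ℂ ⊗[ℝ] 𝔤) (gZeroIncl D Ξ A) = 0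
  induction A using TensorProduct.induction_on with
  | zero => rw [map_zero, map_zero]
  | add A A' hA hA' => rw [map_add, map_add, hA, hA', add_zero]
  | tmul z A =>
    have h : LieAlgebra.ad ℂ (ℂ ⊗[ℝ] 𝔤) (cartanGrading hb Ξ : ℂ ⊗[ℝ] 𝔤)
          (gZeroIncl D Ξ (z ⊗ₜ[ℝ] A)) =
        ((1 : ℂ) * z) ⊗ₜ[ℝ] ⁅(gradingElement D Ξ : 𝔤), (A : 𝔤)⁆ :=
      LieAlgebra.ExtendScalars.bracket_tmul ..
    rw [h, (mem_gZero_iff D Ξ).mp A.2, TensorProduct.tmul_zero]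

/-- The grading element is real, so real and imaginary parts of an element commuting with it lie in
`𝔤_{Ξ,0}`: the centralizer in `𝔤_ℂ` is `(𝔤_{Ξ,0})_ℂ`. -/
lemma exists_gZeroIncl_eq (hb : IsAdapted b D) {A : ℂ ⊗[ℝ] 𝔤}
    (hA : ⁅(cartanGrading hb Ξ : ℂ ⊗[ℝ] 𝔤), A⁆ = 0) : ∃ A', gZeroIncl D Ξ A' = A := by
  obtain ⟨a, a', rfl⟩ := exists_eq_add_I_smul A
  obtain ⟨h1, h2⟩ := lie_cartanGrading hb (c := 0) (by rw [hA]; simp)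
  rw [zero_smul] at h1 h2
  refine ⟨(1 : ℂ) ⊗ₜ[ℝ] ⟨a, (mem_gZero_iff D Ξ).mpr h1⟩ +
    Complex.I • (1 : ℂ) ⊗ₜ[ℝ] ⟨a', (mem_gZero_iff D Ξ).mpr h2⟩, ?_⟩
  rw [map_add, map_smul]
  rfl

lemma minusProj_eq_zero {c : ℝ} (hc : 0 ≤ c) {x : 𝔤}
    (hx : ⁅(gradingElement D Ξ : 𝔤), x⁆ = c • x) : minusProj D Ξ x = 0 := by
  have hE : (gradingElement D Ξ : 𝔤) ∈ gZero D Ξ := by rw [mem_gZero_iff, lie_self]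
  have h1 := minusProj_lie' D Ξ hE x
  rw [hx, map_smul] at h1
  have h2 := (minusProj D Ξ x).2
  rw [← SetLike.mem_coe] at h2
  have h3 : (minusProj D Ξ x : 𝔤) ∈ Module.End.eigenspace
      (LieAlgebra.ad ℝ 𝔤 (gradingElement D Ξ : 𝔤)) c := by
    rw [Module.End.mem_eigenspace_iff, LieAlgebra.ad_apply, ← h1]
    rfl
  have h4 := Module.End.eigenspaces_iSupIndep (LieAlgebra.ad ℝ 𝔤 (gradingElement D Ξ : 𝔤)) c
  refine Subtype.ext (Submodule.disjoint_def.mp h4 _ h3 ?_)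
  refine SetLike.le_def.mp (iSup_le fun k => ?_) ((mem_gMinus D).mp (minusProj D Ξ x).2)
  refine (gradedPiece_le D Ξ k).trans (le_iSup₂_of_le (k.1 : ℝ) ?_ le_rfl)
  have : (k.1 : ℝ) < 0 := by exact_mod_cast k.2
  linarith

lemma sum_vec_of_mem_wtSpace {χ : Module.Dual ℂ H} {x : ℂ ⊗[ℝ] 𝔤}
    (hx : x ∈ wtSpace (ℂ ⊗[ℝ] 𝔤) χ) (p : Module.Dual ℂ H → Prop) [DecidablePred p] :
    ∑ k, killingForm ℂ (ℂ ⊗[ℝ] 𝔤) (dualVec H k) x • (if p (wt H k) then vec H k else 0) =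
      if p χ then x else 0 := by
  have h : ∀ k, killingForm ℂ (ℂ ⊗[ℝ] 𝔤) (dualVec H k) x •
      (if p (wt H k) then vec H k else 0) =
      if p χ then killingForm ℂ (ℂ ⊗[ℝ] 𝔤) (dualVec H k) x • vec H k else 0 := by
    intro k
    by_cases hk : wt H k = χ
    · rw [hk, smul_ite, smul_zero]
    · rw [killingForm_wtSpace (dualVec_mem H k) hx fun h => hk (neg_add_eq_zero.mp h)]
      simp
  rw [Finset.sum_congr rfl fun k _ => h k]
  split_ifs
  · exact sum_vec H x
  · exact Finset.sum_const_zero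

lemma exists_int_eq (hb : IsAdapted b D) {χ : Module.Dual ℂ H} {x : ℂ ⊗[ℝ] 𝔤}
    (hx : x ∈ wtSpace (ℂ ⊗[ℝ] 𝔤) χ) (h0 : x ≠ 0) : ∃ n : ℤ, χ (cartanGrading hb Ξ) = n := by
  rcases eq_zero_or_mem_range hx h0 with rfl | ⟨i, rfl⟩
  · exact ⟨0, by simp⟩
  · by_cases hi : b.IsPos i
    · obtain ⟨n, hn⟩ := exists_nat_root (root_cartanGrading hb) hi
      exact ⟨n, by rw [hn]; simp⟩
    · obtain ⟨n, hn⟩ := exists_nat_root_neg (root_cartanGrading hb) hi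
      exact ⟨-n, by rw [hn]; simp⟩

/-- The two descriptions of a graded projection of `𝔤_ℂ`. -/
lemma sum_vec_eq (hb : IsAdapted b D) (p : ℤ → Prop) (q : Module.Dual ℂ H → Prop) [DecidablePred q]
    {I : Type*} [Fintype I] (u v : I → 𝔤)
    (hpq : ∀ (χ : Module.Dual ℂ H) (n : ℤ), χ (cartanGrading hb Ξ) = n → (q χ ↔ p n))
    (h1 : ∀ n, p n → ∀ a ∈ gradedPiece D Ξ n, ∑ i, killingForm ℝ 𝔤 (u i) a • v i = a)
    (h2 : ∀ n, ¬ p n → ∀ a ∈ gradedPiece D Ξ n, ∑ i, killingForm ℝ 𝔤 (u i) a • v i = 0)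
    (x : ℂ ⊗[ℝ] 𝔤) :
    ∑ k, killingForm ℂ (ℂ ⊗[ℝ] 𝔤) (dualVec H k) x • (if q (wt H k) then vec H k else 0) =
      ∑ i, killingForm ℂ (ℂ ⊗[ℝ] 𝔤) (1 ⊗ₜ[ℝ] u i) x • ((1 : ℂ) ⊗ₜ[ℝ] v i) := by
  have hx : x ∈ ⨆ χ : Module.Dual ℂ H, wtSpace (ℂ ⊗[ℝ] 𝔤) χ := by
    rw [iSup_wtSpace_eq_top]; trivial
  induction hx using Submodule.iSup_induction' with
  | zero => simp
  | add x y _ _ hx hy => simp only [map_add, add_smul, Finset.sum_add_distrib, hx, hy]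
  | mem χ x hx =>
    by_cases h0 : x = 0
    · simp [h0]
    obtain ⟨n, hn⟩ := exists_int_eq (Ξ := Ξ) hb hx h0
    rw [sum_vec_of_mem_wtSpace hx]
    have hE := hx (cartanGrading hb Ξ)
    obtain ⟨a, a', rfl⟩ := exists_eq_add_I_smul x
    obtain ⟨ha, ha'⟩ := lie_cartanGrading hb (c := n) (by rw [hE, hn]; simp)
    rw [← mem_gradedPiece_iff] at ha ha'
    rw [sum_killingForm_tmul]
    by_cases hp : p n
    · rw [if_pos ((hpq χ n hn).mpr hp), h1 n hp a ha, h1 n hp a' ha']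
    · rw [if_neg fun h => hp ((hpq χ n hn).mp h), h2 n hp a ha, h2 n hp a' ha']
      simp

/-- The bilinear map `(x, y) ↦ y ⬝ (x ⬝ w)`. -/
def actAct {L M : Type*} [LieRing L] [LieAlgebra ℂ L] [AddCommGroup M] [Module ℂ M]
    [LieRingModule L M] [LieModule ℂ L M] (w : M) : L →ₗ[ℂ] L →ₗ[ℂ] M :=
  LinearMap.mk₂ ℂ (fun x y => ⁅y, ⁅x, w⁆⁆) (by simp) (by simp) (by simp) (by simp)

lemma actAct_apply {L M : Type*} [LieRing L] [LieAlgebra ℂ L] [AddCommGroup M] [Module ℂ M]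
    [LieRingModule L M] [LieModule ℂ L M] (w : M) (x y : L) :
    actAct w x y = ⁅y, ⁅x, w⁆⁆ := rfl

/-- The bilinear map `(x, y) ↦ [y, x] ⬝ w`. -/
def lieAct {L M : Type*} [LieRing L] [LieAlgebra ℂ L] [AddCommGroup M] [Module ℂ M]
    [LieRingModule L M] [LieModule ℂ L M] (w : M) : L →ₗ[ℂ] L →ₗ[ℂ] M :=
  LinearMap.mk₂ ℂ (fun x y => ⁅LieAlgebra.ad ℂ L y x, w⁆)
    (by simp) (by simp) (by simp) (by simp)

lemma lieAct_apply {L M : Type*} [LieRing L] [LieAlgebra ℂ L] [AddCommGroup M] [Module ℂ M]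
    [LieRingModule L M] [LieModule ℂ L M] (w : M) (x y : L) :
    lieAct w x y = ⁅LieAlgebra.ad ℂ L y x, w⁆ := rfl

/-- The weight basis and the complexified real frame describe the same projections of `𝔤_ℂ` to level
zero and to negative level, hence the same tensors. -/
lemma levelCasimir_eq (hb : IsAdapted b D)
    (w : (ℂ ⊗[ℝ] 𝔤) →ₗ[ℂ] (ℂ ⊗[ℝ] 𝔤) →ₗ[ℂ] (ℂ ⊗[ℝ] 𝔤)) :
    levelCasimir (cartanGrading hb Ξ) w =
      ∑ r, ⁅(1 : ℂ) ⊗ₜ[ℝ] (zeroBasis D Ξ r : 𝔤), ⁅(1 : ℂ) ⊗ₜ[ℝ] (zeroDualBasis D Ξ r : 𝔤), w⁆⁆ +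
      ⁅∑ i, (1 : ℂ) ⊗ₜ[ℝ] ⁅(minusBasis D Ξ i : 𝔤), plusBasis D Ξ i⁆, w⁆ := by
  classical
  have h1 := sum_bilin_eq_sum_bilin (sum_vec_eq (H := H) hb (· = 0)
    (fun χ => χ (cartanGrading hb Ξ) = 0) (fun r => (zeroDualBasis D Ξ r : 𝔤))
    (fun r => (zeroBasis D Ξ r : 𝔤))
    (fun χ n h => by rw [h]; exact Int.cast_eq_zero)
    (fun n hn a ha => by subst hn; exact sum_zeroBasis D Ξ ⟨a, ha⟩)
    (fun n hn a ha => Finset.sum_eq_zero fun r _ => by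
      rw [killingForm_zeroDualBasis_eq_zero D Ξ hn ha, zero_smul])) (actAct w)
  have h2 := sum_bilin_eq_sum_bilin (sum_vec_eq (H := H) hb (· < 0)
    (fun χ => (χ (cartanGrading hb Ξ)).re < 0) (plusBasis D Ξ)
    (fun i => (minusBasis D Ξ i : 𝔤))
    (fun χ n h => by simp [h])
    (fun n hn a ha => sum_minusBasis D Ξ (gradedPiece_le_gMinus D Ξ hn ha))
    (fun n hn a ha => Finset.sum_eq_zero fun r _ => by
      rw [killingForm_plusBasis_eq_zero D Ξ (not_lt.mp hn) ha, zero_smul])) (lieAct w)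
  simp only [actAct_apply] at h1
  simp only [lieAct_apply, ad_one_tmul] at h2
  rw [levelCasimir, sum_lie, ← h1, ← h2]
  congr 1
  · refine Finset.sum_congr rfl fun k _ => ?_
    split_ifs <;> simp
  · refine Finset.sum_congr rfl fun k _ => ?_
    split_ifs <;> simp

lemma levelCasimir_complexify (hb : IsAdapted b D) (B : 𝔤 →ₗ[ℝ] 𝔤 →ₗ[ℝ] 𝔤) :
    levelCasimir (cartanGrading hb Ξ) (complexify B) = complexify (casOp D Ξ B) := by
  rw [levelCasimir_eq, casOp, map_add, map_sum, complexify_lie, TensorProduct.tmul_sum]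
  simp only [complexify_lie]

variable (D Ξ) in
/-- The complexification of `ker □`, as a space of bilinear maps on `𝔤_ℂ`. -/
def complexHarmonic : Submodule ℂ ((ℂ ⊗[ℝ] 𝔤) →ₗ[ℂ] (ℂ ⊗[ℝ] 𝔤) →ₗ[ℂ] (ℂ ⊗[ℝ] 𝔤)) :=
  ((harmonicSpace D Ξ).baseChange ℂ).map (complexExtend D Ξ)

lemma complexHarmonic_le {N : Submodule ℂ ((ℂ ⊗[ℝ] 𝔤) →ₗ[ℂ] (ℂ ⊗[ℝ] 𝔤) →ₗ[ℂ] (ℂ ⊗[ℝ] 𝔤))}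
    (h : ∀ φ ∈ harmonicSpace D Ξ, complexify (extend D Ξ φ) ∈ N) : complexHarmonic D Ξ ≤ N := by
  rw [complexHarmonic, Submodule.map_le_iff_le_comap]
  refine mem_baseChange_induction fun φ hφ => ?_
  rw [Submodule.mem_comap, complexExtend_one_tmul]
  exact h φ hφ

lemma lie_mem_baseChange_harmonicSpace (A : ℂ ⊗[ℝ] gZero D Ξ) {v : ℂ ⊗[ℝ] BilinearCochain D Ξ}
    (hv : v ∈ (harmonicSpace D Ξ).baseChange ℂ) : ⁅A, v⁆ ∈ (harmonicSpace D Ξ).baseChange ℂ := by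
  suffices h : (harmonicSpace D Ξ).baseChange ℂ ≤ ((harmonicSpace D Ξ).baseChange ℂ).comap
      (LieModule.toEnd ℂ (ℂ ⊗[ℝ] gZero D Ξ) (ℂ ⊗[ℝ] BilinearCochain D Ξ) A) from h hv
  refine mem_baseChange_induction fun φ hφ => ?_
  rw [Submodule.mem_comap, LieModule.toEnd_apply_apply]
  induction A using TensorProduct.induction_on with
  | zero => simp
  | add A A' hA hA' => rw [add_lie]; exact add_mem hA hA'
  | tmul z A =>
    rw [LieAlgebra.ExtendScalars.bracket_tmul]
    exact Submodule.tmul_mem_baseChange_of_mem _ (lie_mem_harmonicSpace D Ξ A hφ)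

lemma isHarmonicModel (hb : IsAdapted b D) :
    IsHarmonicModel b (cartanGrading hb Ξ) (complexHarmonic D Ξ) where
  simple := root_cartanGrading hb
  alt w hw x := by
    let N : Submodule ℂ ((ℂ ⊗[ℝ] 𝔤) →ₗ[ℂ] (ℂ ⊗[ℝ] 𝔤) →ₗ[ℂ] (ℂ ⊗[ℝ] 𝔤)) :=
      LinearMap.ker ((LinearMap.applyₗ x).comp (LinearMap.applyₗ x))
    refine (complexHarmonic_le (N := N) fun φ hφ => ?_) hw
    exact complexify_alt (fun y => hφ.1 _) x
  vanish w hw c hc x hx y := by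
    let N : Submodule ℂ ((ℂ ⊗[ℝ] 𝔤) →ₗ[ℂ] (ℂ ⊗[ℝ] 𝔤) →ₗ[ℂ] (ℂ ⊗[ℝ] 𝔤)) :=
      LinearMap.ker ((LinearMap.applyₗ y).comp (LinearMap.applyₗ x))
    refine (complexHarmonic_le (N := N) fun φ hφ => ?_) hw
    change complexify (extend D Ξ φ) x y = 0
    obtain ⟨a, a', rfl⟩ := exists_eq_add_I_smul x
    obtain ⟨ha, ha'⟩ := lie_cartanGrading hb hx
    have h0 : ∀ a, ⁅(gradingElement D Ξ : 𝔤), a⁆ = c • a → extend D Ξ φ a = 0 := by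
      intro a ha
      ext z
      rw [extend_apply, minusProj_eq_zero hc ha]
      simp
    rw [complexify_apply_eq_zero (h0 a ha) (h0 a' ha'), LinearMap.zero_apply]
  stable A hA w hw := by
    obtain ⟨A', rfl⟩ := exists_gZeroIncl_eq hb hA
    obtain ⟨v, hv, rfl⟩ := hw
    rw [← complexExtend_lie]
    exact ⟨_, lie_mem_baseChange_harmonicSpace A' hv, rfl⟩
  casimir w hw := by
    -- As a linear operator its fixed points form a complex subspace, so it is enough to treat real
    -- harmonic cochains.
    let T : Module.End ℂ ((ℂ ⊗[ℝ] 𝔤) →ₗ[ℂ] (ℂ ⊗[ℝ] 𝔤) →ₗ[ℂ] (ℂ ⊗[ℝ] 𝔤)) :=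
      ∑ r, LieModule.toEnd ℂ (ℂ ⊗[ℝ] 𝔤)
        ((ℂ ⊗[ℝ] 𝔤) →ₗ[ℂ] (ℂ ⊗[ℝ] 𝔤) →ₗ[ℂ] (ℂ ⊗[ℝ] 𝔤)) ((1 : ℂ) ⊗ₜ[ℝ] (zeroBasis D Ξ r : 𝔤)) ∘ₗ
        LieModule.toEnd ℂ (ℂ ⊗[ℝ] 𝔤)
        ((ℂ ⊗[ℝ] 𝔤) →ₗ[ℂ] (ℂ ⊗[ℝ] 𝔤) →ₗ[ℂ] (ℂ ⊗[ℝ] 𝔤)) ((1 : ℂ) ⊗ₜ[ℝ] (zeroDualBasis D Ξ r : 𝔤)) +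
      LieModule.toEnd ℂ (ℂ ⊗[ℝ] 𝔤)
        ((ℂ ⊗[ℝ] 𝔤) →ₗ[ℂ] (ℂ ⊗[ℝ] 𝔤) →ₗ[ℂ] (ℂ ⊗[ℝ] 𝔤)) (∑ i, (1 : ℂ) ⊗ₜ[ℝ] ⁅(minusBasis D Ξ i : 𝔤), plusBasis D Ξ i⁆)
    have hT : ∀ w, T w = levelCasimir (cartanGrading hb Ξ) w := by
      intro w
      rw [levelCasimir_eq, LinearMap.add_apply, LinearMap.sum_apply]
      rfl
    rw [← hT]
    refine (complexHarmonic_le (N := LinearMap.eqLocus T LinearMap.id) fun φ hφ => ?_) hw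
    rw [LinearMap.mem_eqLocus, hT, levelCasimir_complexify, ((mem_harmonicSpace_iff D Ξ φ).mp hφ).2,
      LinearMap.id_apply]

end Parabolic

/-! ### Transfer to the real harmonic cochains. -/

namespace Parabolic

open LieAlgebra LieAlgebra.IsKilling CartanWeight

variable {𝔤 : Type*} [LieRing 𝔤] [LieAlgebra ℝ 𝔤] [Module.Finite ℝ 𝔤] [LieAlgebra.IsKilling ℝ 𝔤]
  {ι : Type*} [Fintype ι] {D : SimpleRestrictedRoots 𝔤 ι} {Ξ : Set ι}
  {H : LieSubalgebra ℂ (ℂ ⊗[ℝ] 𝔤)} [H.IsCartanSubalgebra] {b : (rootSystem H).Base}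

lemma isLowest_complexExtend_iff (hb : IsAdapted b D) {χ : Module.Dual ℂ H}
    {v : ℂ ⊗[ℝ] BilinearCochain D Ξ} :
    IsLowest b (cartanGrading hb Ξ) χ (complexExtend D Ξ v) ↔ IsLowestWeightElement b χ v := by
  refine ⟨fun ⟨h1, h2⟩ => ⟨fun A hA => ?_, fun i hi A hA => ?_⟩,
    fun ⟨h1, h2⟩ => ⟨fun a => ?_, fun i hi h0 B hB => ?_⟩⟩
  · apply complexExtend_injective
    rw [complexExtend_lie, map_smul]
    exact h1 ⟨_, hA⟩
  · rw [← mem_wtSpace_iff] at hA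
    by_cases h0 : (rootSystem H).root i (cartanGrading hb Ξ) = 0
    · apply complexExtend_injective
      rw [complexExtend_lie, map_zero]
      exact h2 i hi h0 _ hA
    -- In a root space of nonzero level, `(𝔤_{Ξ,0})_ℂ` has only the zero element, so the condition
    -- there is empty.
    · have h3 := (hA (cartanGrading hb Ξ)).symm.trans (lie_gZeroIncl hb A)
      have h4 := (smul_eq_zero.mp h3).resolve_left h0
      rw [(map_eq_zero_iff _ gZeroIncl_injective).mp h4]
      exact zero_lie (L := ℂ ⊗[ℝ] gZero D Ξ) v
  · obtain ⟨A, hA⟩ := exists_gZeroIncl_eq (Ξ := Ξ) hb (lie_cartan_eq_zero a)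
    have h3 : gZeroIncl D Ξ A ∈ H := hA ▸ a.2
    have h4 : (⟨_, h3⟩ : H) = a := Subtype.ext hA
    rw [← hA, ← complexExtend_lie, h1 A h3, map_smul, h4]
  · obtain ⟨A, rfl⟩ := exists_gZeroIncl_eq (Ξ := Ξ) hb (lie_eq_zero_of_apply_eq_zero h0 hB)
    rw [← complexExtend_lie, h2 i hi A (mem_wtSpace_iff.mp hB), map_zero]

lemma map_isotypicComponent (hb : IsAdapted b D) (lam : Module.Dual ℂ H) :
    (isotypicComponent b D Ξ lam).toSubmodule.map (complexExtend D Ξ) =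
      isoComp b (cartanGrading hb Ξ) (complexHarmonic D Ξ) lam := by
  refine le_antisymm ?_ (leviSpan_le ?_ ?_)
  · let N : LieSubmodule ℂ (ℂ ⊗[ℝ] gZero D Ξ) (ℂ ⊗[ℝ] BilinearCochain D Ξ) :=
      { (isoComp b (cartanGrading hb Ξ) (complexHarmonic D Ξ) lam).comap (complexExtend D Ξ) with
        lie_mem := fun {A v} hv => by
          change complexExtend D Ξ ⁅A, v⁆ ∈ isoComp b (cartanGrading hb Ξ) (complexHarmonic D Ξ) lam
          rw [complexExtend_lie]
          exact isStable_isoComp lam _ (lie_gZeroIncl hb A) _ hv }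
    rw [Submodule.map_le_iff_le_comap]
    refine LieSubmodule.lieSpan_le (N := N).mpr fun v hv => ?_
    exact subset_leviSpan _ ⟨⟨v, hv.1, rfl⟩, (isLowest_complexExtend_iff hb).mpr hv.2⟩
  · rintro _ ⟨⟨v, hv, rfl⟩, hl⟩
    exact ⟨v, LieSubmodule.subset_lieSpan ⟨hv, (isLowest_complexExtend_iff hb).mp hl⟩, rfl⟩
  · rintro A hA _ ⟨v, hv, rfl⟩
    obtain ⟨A', rfl⟩ := exists_gZeroIncl_eq hb hA
    exact ⟨⁅A', v⁆, LieSubmodule.lie_mem _ hv, complexExtend_lie A' v⟩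

lemma hasComponent_iff (hb : IsAdapted b D) {φ : BilinearCochain D Ξ} {lam : Module.Dual ℂ H} :
    HasComponent b φ lam ↔ HasComp b (cartanGrading hb Ξ) (complexHarmonic D Ξ) lam
      (complexify (extend D Ξ φ)) := by
  have h : (⨆ mu : {mu : Module.Dual ℂ H // mu ≠ lam}, isoComp b (cartanGrading hb Ξ)
      (complexHarmonic D Ξ) mu.1) = (⨆ mu : {mu : Module.Dual ℂ H // mu ≠ lam},
        isotypicComponent b D Ξ mu.1).toSubmodule.map (complexExtend D Ξ) := by
    rw [LieSubmodule.iSup_toSubmodule, Submodule.map_iSup]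
    exact iSup_congr fun mu => (map_isotypicComponent hb mu.1).symm
  rw [HasComp, h, ← map_isotypicComponent hb, ← complexExtend_one_tmul]
  constructor
  · rintro ⟨x, hx, h0, h1⟩
    refine ⟨_, ⟨x, hx, rfl⟩, (map_ne_zero_iff _ complexExtend_injective).mpr h0, ?_⟩
    rw [← map_sub]
    exact ⟨_, h1, rfl⟩
  · rintro ⟨_, ⟨x, hx, rfl⟩, h0, y, hy, h1⟩
    refine ⟨x, hx, (map_ne_zero_iff _ complexExtend_injective).mp h0, ?_⟩
    rw [← map_sub] at h1
    rw [← complexExtend_injective h1]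
    exact hy

lemma complexify_mem_complexHarmonic {φ : BilinearCochain D Ξ} (h : φ ∈ harmonicSpace D Ξ) :
    complexify (extend D Ξ φ) ∈ complexHarmonic D Ξ :=
  ⟨1 ⊗ₜ[ℝ] φ, one_tmul_mem_baseChange h, complexExtend_one_tmul φ⟩

lemma gradingElement_mem_gZero (Ξ' : Set ι) : (gradingElement D Ξ' : 𝔤) ∈ gZero D Ξ := by
  rw [mem_gZero_iff]
  exact D.maximal.prop.lie_eq_zero _ (gradingElement D Ξ).2 _ (gradingElement D Ξ').2

lemma hasNoEntries_iff (hb : IsAdapted b D) {Ψ : Set ι} {φ : BilinearCochain D Ξ}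
    (hφ : φ ∈ harmonicSpace D Ξ) : HasNoEntries Ψ φ ↔
      complexify (extend D Ξ φ) ∈
        noEntries (complexHarmonic D Ξ) (cartanGrading hb (Ξ \ Ψ)) := by
  rw [mem_noEntries]
  constructor
  · refine fun h => ⟨complexify_mem_complexHarmonic hφ, fun x hx y => ?_⟩
    obtain ⟨a, a', rfl⟩ := exists_eq_add_I_smul x
    obtain ⟨ha, ha'⟩ := lie_cartanGrading hb (c := 0) (by rw [hx]; simp)
    have key : ∀ a, ⁅(gradingElement D (Ξ \ Ψ) : 𝔤), a⁆ = (0 : ℝ) • a → extend D Ξ φ a = 0 := by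
      intro a ha
      ext z
      -- The grading element for `Ξ \ Ψ` lies in `𝔤_{Ξ,0}` because `𝔞` is abelian, so the projection
      -- to `𝔤_{Ξ,-}` preserves its centralizer.
      have h1 := minusProj_lie' D Ξ (gradingElement_mem_gZero (Ξ \ Ψ)) a
      rw [extend_apply, h _ ?_, LinearMap.zero_apply]
      rw [mem_gradedPiece_iff]
      rw [ha, zero_smul, map_zero] at h1
      rw [Int.cast_zero, zero_smul]
      exact h1.symm
    rw [complexify_apply_eq_zero (key a ha) (key a' ha'), LinearMap.zero_apply]
  · rintro ⟨-, h⟩ X hX Y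
    rw [mem_gradedPiece_iff, Int.cast_zero, zero_smul] at hX
    have h1 := h ((1 : ℂ) ⊗ₜ[ℝ] (X : 𝔤)) ((one_tmul_lie _ _).trans (by rw [hX]; simp))
      ((1 : ℂ) ⊗ₜ[ℝ] (Y : 𝔤))
    rw [complexify_tmul, mul_one, extend_coe] at h1
    exact one_tmul_injective (h1.trans (TensorProduct.tmul_zero _ _).symm)

lemma hasNoEntries_iff_forall (hb : IsAdapted b D) {Ψ : Set ι} {φ : BilinearCochain D Ξ}
    (hφ : φ ∈ harmonicSpace D Ξ) : HasNoEntries Ψ φ ↔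
      ∀ a ∈ b.support, ∀ c ∈ b.support, a ≠ c → ∀ m, IsHighestRoot b m →
        HasComponent b φ (pairWeight b a c m) → ∀ i ∈ b.support,
        ¬ 0 ≤ killingInner ((rootSystem H).root i) (pairWeight b a c m) →
        (rootSystem H).root i (cartanGrading hb (Ξ \ Ψ)) ≠ 0 := by
  simp only [hasComponent_iff hb]
  exact (hasNoEntries_iff hb hφ).trans ((isHarmonicModel hb).mem_noEntries_iff
    (isCoarser_cartanGrading hb Set.sdiff_subset) (complexify_mem_complexHarmonic hφ))

lemma hasNoEntries_empty (hb : IsAdapted b D) {φ : BilinearCochain D Ξ}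
    (hφ : φ ∈ harmonicSpace D Ξ) : HasNoEntries ∅ φ := by
  rw [hasNoEntries_iff hb hφ, mem_noEntries]
  have hw := complexify_mem_complexHarmonic hφ
  refine ⟨hw, fun x hx y => ?_⟩
  rw [Set.sdiff_empty] at hx
  exact (isHarmonicModel hb).vanish _ hw 0 le_rfl x (by rw [hx]; simp) y

/-- The criterion for `Ψ = ∅`, which always holds, shows that the simple roots with negative pairing
restrict to elements of `Ξ`. -/
lemma root_cartanGrading_ne_zero (hb : IsAdapted b D) {φ : BilinearCochain D Ξ}
    (hφ : φ ∈ harmonicSpace D Ξ) {a c m i : H.root} (ha : a ∈ b.support) (hc : c ∈ b.support)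
    (hac : a ≠ c) (hm : IsHighestRoot b m) (h : HasComponent b φ (pairWeight b a c m))
    (hi : i ∈ b.support)
    (hneg : ¬ 0 ≤ killingInner ((rootSystem H).root i) (pairWeight b a c m)) :
    (rootSystem H).root i (cartanGrading hb Ξ) ≠ 0 := by
  have := (hasNoEntries_iff_forall hb hφ).mp (hasNoEntries_empty hb hφ) a ha c hc hac m hm h i hi hneg
  rwa [Set.sdiff_empty] at this

lemma killingInner_pairWeight_neg_iff {a c m i : H.root} (ha : a ∈ b.support)
    (hc : c ∈ b.support) (hac : a ≠ c) (hm : IsHighestRoot b m) (hi : i ∈ b.support) :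
    killingInner ((rootSystem H).root i) (pairWeight b a c m) < 0 ↔
      i = a ∨ (i = c ∧ killingInner ((rootSystem H).root a) ((rootSystem H).root c) = 0) := by
  obtain ⟨r, hr, h⟩ := RootForm.simple_pairing_lt_zero_iff (isDualKillingForm H) ha hc hac hm hi
  have h1 : killingInner ((rootSystem H).root i) (pairWeight b a c m) = r := hr
  refine Iff.trans ?_ h
  rw [h1]
  exact_mod_cast Iff.rfl

end Parabolic

end

theorem mainTheorem12
    {EG : Type*} [NormedAddCommGroup EG] [NormedSpace ℝ EG] [FiniteDimensional ℝ EG]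
    {G : Type*} [TopologicalSpace G] [ChartedSpace EG G] [Group G] [LieGroup 𝓘(ℝ, EG) ∞ G]
    [LieAlgebra.IsSimple ℝ (Parabolic.LieAlg EG G)]
    {EP : Type*} [NormedAddCommGroup EP] [NormedSpace ℝ EP] [FiniteDimensional ℝ EP]
    {P : Type*} [TopologicalSpace P] [ChartedSpace EP P] [Group P] [LieGroup 𝓘(ℝ, EP) ∞ P]
    {EM : Type*} [NormedAddCommGroup EM] [NormedSpace ℝ EM] [FiniteDimensional ℝ EM]
    {M : Type*} [TopologicalSpace M] [ChartedSpace EM M] [IsManifold 𝓘(ℝ, EM) ∞ M]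
    {EB : Type*} [NormedAddCommGroup EB] [NormedSpace ℝ EB] [FiniteDimensional ℝ EB]
    {B : Type*} [TopologicalSpace B] [ChartedSpace EB B] [IsManifold 𝓘(ℝ, EB) ∞ B]
    -- the simple restricted roots, the set `Ξ`, and a parabolic geometry of type `(G, P)`
    {ι : Type*} [Fintype ι] (D : Parabolic.SimpleRestrictedRoots (Parabolic.LieAlg EG G) ι)
    (Ξ : Set ι) (f : P →* G)
    (hP : Parabolic.IsParabolicSubgroup (EG := EG) (EP := EP) (Parabolic.parabolic D Ξ) f)
    (π : B → M)
    (C : Parabolic.CartanGeometry (EG := EG) (EP := EP) (EM := EM) (EB := EB) f π)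
    -- its harmonic curvature
    (κH : B → Parabolic.BilinearCochain D Ξ)
    (hκH : ∀ u, Parabolic.IsHarmonicProjection (C.curvatureCochain D Ξ u) (κH u))
    -- the simple roots of the complexification
    (H : LieSubalgebra ℂ (ℂ ⊗[ℝ] Parabolic.LieAlg EG G)) [H.IsCartanSubalgebra]
    (b : (LieAlgebra.IsKilling.rootSystem H).Base) (hb : Parabolic.IsAdapted b D) :
    IsGreatest {Ψ : Set ι | Ψ ⊆ Ξ ∧ ∀ u, Parabolic.HasNoEntries Ψ (κH u)}
      {j : ι | j ∈ Ξ ∧ ∀ i ∈ b.support,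
        Parabolic.RestrictsTo D ((LieAlgebra.IsKilling.rootSystem H).root i) (D.simple j) →
        ∀ a ∈ b.support, ∀ c ∈ b.support, a ≠ c → ∀ m, Parabolic.IsHighestRoot b m →
          (∃ u, Parabolic.HasComponent b (κH u) (Parabolic.pairWeight b a c m)) →
          0 ≤ Parabolic.killingInner ((LieAlgebra.IsKilling.rootSystem H).root i)
            (Parabolic.pairWeight b a c m)} ∧
    ∀ a ∈ b.support, ∀ c ∈ b.support, a ≠ c → ∀ m, Parabolic.IsHighestRoot b m →
      (Parabolic.killingInner ((LieAlgebra.IsKilling.rootSystem H).root a)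
          ((LieAlgebra.IsKilling.rootSystem H).root c) ≠ 0 →
        ∀ i ∈ b.support, Parabolic.killingInner ((LieAlgebra.IsKilling.rootSystem H).root i)
          (Parabolic.pairWeight b a c m) < 0 ↔ i = a) ∧
      (Parabolic.killingInner ((LieAlgebra.IsKilling.rootSystem H).root a)
          ((LieAlgebra.IsKilling.rootSystem H).root c) = 0 →
        ∀ i ∈ b.support, Parabolic.killingInner ((LieAlgebra.IsKilling.rootSystem H).root i)
          (Parabolic.pairWeight b a c m) < 0 ↔ i = a ∨ i = c) := by
  have key : ∀ (Ψ : Set ι) (u : B), Parabolic.HasNoEntries Ψ (κH u) ↔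
      ∀ a ∈ b.support, ∀ c ∈ b.support, a ≠ c → ∀ m, Parabolic.IsHighestRoot b m →
        Parabolic.HasComponent b (κH u) (Parabolic.pairWeight b a c m) → ∀ i ∈ b.support,
        ¬ 0 ≤ Parabolic.killingInner ((LieAlgebra.IsKilling.rootSystem H).root i)
            (Parabolic.pairWeight b a c m) →
        (LieAlgebra.IsKilling.rootSystem H).root i (Parabolic.cartanGrading hb (Ξ \ Ψ)) ≠ 0 :=
    fun Ψ u => Parabolic.hasNoEntries_iff_forall hb (hκH u).1
  refine ⟨⟨⟨fun j hj => hj.1, fun u => (key _ u).mpr ?_⟩, ?_⟩, ?_⟩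
  · intro a ha c hc hac m hm hcomp i hi hneg
    -- A simple root with negative pairing restricts to some `j ∈ Ξ`. This `j` violates the defining
    -- condition, so it survives in the complement and the root has level one there.
    obtain ⟨j, hj, hij⟩ := Parabolic.exists_restrictsTo hb hi
      (Parabolic.root_cartanGrading_ne_zero hb (hκH u).1 ha hc hac hm hcomp hi hneg)
    refine ne_of_eq_of_ne (Parabolic.apply_cartanGrading_of_simple hij hb ?_) one_ne_zero
    exact ⟨hj, fun h => hneg (h.2 i hi hij a ha c hc hac m hm ⟨u, hcomp⟩)⟩
  · rintro Ψ ⟨hΨ, hno⟩ j hj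
    refine ⟨hΨ hj, fun i hi hij a ha c hc hac m hm ⟨u, hcomp⟩ => ?_⟩
    by_contra hneg
    -- For maximality: a root restricting to an element of `Ψ` has level zero for `Ξ \ Ψ`, which the
    -- criterion excludes when its pairing is negative.
    exact (key Ψ u).mp (hno u) a ha c hc hac m hm hcomp i hi hneg
      (Parabolic.apply_cartanGrading_of_notMem hij hb fun h => h.2 hj)
  · intro a ha c hc hac m hm
    refine ⟨fun h0 i hi => ?_, fun h0 i hi => ?_⟩
    · rw [Parabolic.killingInner_pairWeight_neg_iff ha hc hac hm hi]
      simp only [h0, and_false, or_false]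
    · rw [Parabolic.killingInner_pairWeight_neg_iff ha hc hac hm hi]
      simp only [h0, and_true]
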